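/- Let $L\subset S^2$ be a diagram (generic projection) of an oriented link with at least one component, with a marked point $p$ on $L$ away from the crossings, and with $n_+$ right-handed and $n_-$ left-handed crossings. Let $\mathbb F_L$ be the field of fractions of $\mathbb Z/2[x_f]$, with one variable for each face $f$ of $L$. For a set $S$ of crossings let $L_S$ be the resolution that is the $1$-resolution at the crossings in $S$ and the $0$-resolution at the others; one circle of $L_S$ is marked by $p$. For an unmarked circle $C$ let $[C]$ be the sum of the variables of the faces on the side of $C$ not containing $p$. Let $V$ be the $\mathbb F_L$-vector space whose basis consists of the resolutions $L_S$ with each unmarked circle labelled $v_+$ or $v_-$ (the marked circle is labelled $v_0$). It is graded by $h=|S|-n_-$, by $q=\#v_+-\#v_-+|S|+n_+-2n_-$, and by $\delta=2h-q$. Let $\partial_{KH}$ be the reduced Khovanov differential (from $\mu,\Delta$ with $v_0$ treated as $v_-$), let $\partial_{\mathcal V}$ be the sum over unmarked circles $C$ of the maps $v_+\mapsto [C]\,v_-$, and let $\partial=\partial_{KH}+\partial_{\mathcal V}$ (the totally twisted complex over $\mathbb F_L$). Let $KH^{h,q}(L)$ be the homology of the same bigraded complex $\partial_{KH}$ over $\mathbb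 Z/2$, and $KH_s(L)$ the $\delta=s$ part of the homology of $(V,\partial_{KH})$. Let $HT_s(L)$ be the homology of the spanning tree complex: its basis over $\mathbb F_L$ is the set of $T$ with $L_T$ a single circle, in degree $|T|-n_+$, and $$\partial T=\sum_{T'}\Big(\frac1{[B]}+\frac1{[W]}\Big)T',$$ where $T'=T\cup\{c_1,c_2\}$ runs over the basis elements with two more crossings than $T$, and $[B],[W]$ are the areas of the unmarked circles of $L_{T\cup\{c_1\}}$ and $L_{T\cup\{c_2\}}$. Then $\partial_{KH}$, $\partial$ and the spanning tree differential square to zero; $\partial$ has $\delta$-degree $2$ and preserves the increasing filtration $F_p=\{q\le p\}$. Consider the spectral sequence $E^r_{p,s}=Z^r_{p,s}/(Z^{r-1}_{p-1,s}+\partial Z^{r-1}_{p+r-1,s-2})$, with $Z^r_{p,s}=\{x\in F_p: \delta(x)=s,\ \partial x\in F_{p-r}\}$ and differential $E^r_{p,s}\to E^r_{p-r,s+2}$ induced by $\partial$. 1. The associated graded page $E^0$ is the reduced Khovanov complex $(V,\partial_{KH})$, and its homology $E^1$ is the reduced characteristic-$2$ Khovanov homology over $\mathbb F_L$: $E^1_{q,2h-q}\cong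 KH^{h,q}(L)\otimes_{\mathbb Z/2}\mathbb F_L$, $E^1_{q,s}=0$ for $q+s$ odd, and $\bigoplus_q E^1_{q,s}\cong KH_s(L)$. 2. The spectral sequence converges in finitely many steps to $HT(L)$: there is $r_0$ such that for all $r\ge r_0$ all differentials on $E^r$ vanish and the map induced by representatives is an isomorphism from $F_pH_s/F_{p-1}H_s$ to $E^r_{p,s}$, where $H_s$ is the $\delta=s$ part of the homology of $(V,\partial)$ with its induced filtration; this filtration is finite and exhaustive, and $H_s\cong HT_s(L)$. 3. Consequently $\operatorname{rk}_{\mathbb F_L} KH_s(L)\ge \operatorname{rk}_{\mathbb F_L} HT_s(L)$ for every $s\in\mathbb Z$. -/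

import Mathlib

open CategoryTheory

universe u

/-! ### Marked oriented link diagrams on the sphere

A generic projection of an oriented link to the 2-sphere is recorded combinatorially.
`X` is the set of crossings, `O` the set of components of the projection which carry no crossing,
`F` the set of faces.

Every crossing carries two strands, `false` and `true`.  If both strands are drawn pointing upwards,
the strand `false` runs from the south-west to the north-east and the strand `true` runs from the
south-east to the north-west.  An arc of the projection is either a crossingless component, or it
leaves a crossing along one of its strands; `inl (c, i)` is the arc that leaves `c` along `i`. -/

/-- The arcs (edges and crossingless circles) of the projection. -/
abbrev DiagramArc (X O : Type u) : Type u := (X × Bool) ⊕ O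

/-- The incidence data of a marked oriented link diagram. -/
structure DiagramData (X O F : Type u) where
  /-- the arc leaving along the slot `(c, i)` next enters a crossing along the slot `next (c, i)` -/
  next : Equiv.Perm (X × Bool)
  /-- the right-handed crossings; there the strand `false` is the over-strand, and at the
  left-handed crossings the strand `true` is the over-strand -/
  positive : X → Prop
  /-- the face to the left of an arc -/
  left : DiagramArc X O → F
  /-- the face to the right of an arc -/
  right : DiagramArc X O → F
  /-- the arc carrying the marked point -/
  mark : DiagramArc X O

namespace DiagramData

variable {X O F : Type u}

/-- The arc leaving the crossing `c` along the strand `i`. -/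
def out (_D : DiagramData X O F) (c : X) (i : Bool) : DiagramArc X O := Sum.inl (c, i)

/-- The arc entering the crossing `c` along the strand `i`. -/
def inc (D : DiagramData X O F) (c : X) (i : Bool) : DiagramArc X O := Sum.inl (D.next.symm (c, i))

/-- The arc `a` has an end at the crossing `c`. -/
def Touches (D : DiagramData X O F) (c : X) (a : DiagramArc X O) : Prop := ∃ i, a = D.out c i ∨ a = D.inc c i

/-- The number of connected components of the projection. -/
noncomputable def componentCount (D : DiagramData X O F) : ℕ :=
  Nat.card (Quot fun a b : DiagramArc X O => ∃ c, D.Touches c a ∧ D.Touches c b)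

end DiagramData

/-- A marked oriented link diagram on the 2-sphere.  The first four conditions say that the four
corners of a crossing lie in faces; the last two say that the closed surface made of the faces is
connected and is a sphere (Euler's formula `V - E + F = 1 + k` for a projection with `k` components;
here `E - V` is the number of crossings). -/
structure LinkDiagram (X O F : Type u) [Fintype X] [Fintype F] extends DiagramData X O F where
  south : ∀ c, right (toDiagramData.inc c false) = left (toDiagramData.inc c true)
  north : ∀ c, left (toDiagramData.out c false) = right (toDiagramData.out c true)
  west : ∀ c, left (toDiagramData.inc c false) = left (toDiagramData.out c true)
  east : ∀ c, right (toDiagramData.out c false) = right (toDiagramData.inc c true)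
  connected : ∀ f g : F, Relation.EqvGen (fun f g => ∃ a, f = left a ∧ g = right a) f g
  euler : Fintype.card F = Fintype.card X + toDiagramData.componentCount + 1

/-! ### Linear algebra: homology and the spectral sequence of a filtered complex -/

section LinearAlgebra

variable {K V : Type*} [CommRing K] [AddCommGroup V] [Module K V]

/-- The homology at `B` of `A ⟶ B ⟶ ⋯`, where `A` and `B` are graded pieces of the module `V`
and `d` is a differential on `V` which maps `A` to `B`. -/
abbrev pieceHomology (d : V →ₗ[K] V) (A B : Submodule K V) : Type _ :=
  ↥(LinearMap.ker d ⊓ B) ⧸ (A.map d).submoduleOf (LinearMap.ker d ⊓ B)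

/-- The filtration step on homology that is induced by the submodule `G` of `V`: the classes
represented by cycles in `G`. -/
def homologyFiltration (d : V →ₗ[K] V) (A B G : Submodule K V) :
    Submodule K (pieceHomology d A B) :=
  (G.submoduleOf (LinearMap.ker d ⊓ B)).map
    (Submodule.mkQ ((A.map d).submoduleOf (LinearMap.ker d ⊓ B)))

/-- `Z^r_{p,s}`: elements of filtration `≤ p` and degree `s` whose differential has filtration
`≤ p - r`, for an increasing filtration and a differential of degree `2`.
`Fil p s` is the part of filtration `≤ p` and degree `s`. -/
def specZ (d : V →ₗ[K] V) (Fil : ℤ → ℤ → Submodule K V) (r p s : ℤ) : Submodule K V :=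
  Fil p s ⊓ (Fil (p - r) (s + 2)).comap d

/-- `Z^{r-1}_{p-1,s} + d Z^{r-1}_{p+r-1,s-2}`, so that `E^r_{p,s} = Z^r_{p,s} / specB`. -/
def specB (d : V →ₗ[K] V) (Fil : ℤ → ℤ → Submodule K V) (r p s : ℤ) : Submodule K V :=
  specZ d Fil (r - 1) (p - 1) s ⊔ (specZ d Fil (r - 1) (p + r - 1) (s - 2)).map d

end LinearAlgebra

/-- The spectral sequence induced by the increasing filtration `Fil` of the complex `(V, d)`, with
`d` of degree `2`: the page `E^r` is identified with `Z^r / (Z^{r-1} + d Z^{r-1})` through the class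
maps `cls`, the differential of bidegree `(-r, 2)` on `E^r` is induced by `d`, and the isomorphism
between the homology of `E^r` and `E^{r+1}` is the identity on representatives.  The index `(p, s)`
consists of the filtration index `p` and the degree `s`. -/
structure InducedSpectralSequence {K V : Type u} [CommRing K] [AddCommGroup V] [Module K V]
    (d : V →ₗ[K] V) (Fil : ℤ → ℤ → Submodule K V) where
  /-- the underlying spectral sequence, starting at the page `E^0` -/
  ss : SpectralSequence (ModuleCat.{u} K) (fun r : ℤ => ComplexShape.up' ((-r, 2) : ℤ × ℤ)) 0
  /-- the class in `E^r_{p,s}` of an element of `Z^r_{p,s}` -/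
  cls : ∀ (r : ℤ) (hr : 0 ≤ r) (p s : ℤ), specZ d Fil r p s →ₗ[K] (ss.page r hr).X (p, s)
  cls_surjective : ∀ r hr p s, Function.Surjective (cls r hr p s)
  cls_eq_zero : ∀ r hr p s (x : specZ d Fil r p s),
    cls r hr p s x = 0 ↔ (x : V) ∈ specB d Fil r p s
  d_cls : ∀ r hr p s (x : specZ d Fil r p s) (y : specZ d Fil r (p - r) (s + 2)),
    (y : V) = d x →
      ((ss.page r hr).d (p, s) (p - r, s + 2)).hom (cls r hr p s x) = cls r hr (p - r) (s + 2) y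
  iso_cls : ∀ r (hr : 0 ≤ r) p s (x : specZ d Fil r p s) (x' : specZ d Fil (r + 1) p s),
    (x : V) = x' → ∀ z : (ss.page r hr).cycles (p, s),
      ((ss.page r hr).iCycles (p, s)).hom z = cls r hr p s x →
        (ss.iso r (r + 1) (p, s) rfl hr).hom.hom (((ss.page r hr).homologyπ (p, s)).hom z) =
          cls (r + 1) (Int.le_add_one hr) p s x'

/-- The functions supported on `{x | P x}`, i.e. the span of the basis vectors `x` with `P x`. -/
def spanOn {ι : Type*} (K : Type*) [CommRing K] (P : ι → Prop) : Submodule K (ι → K) where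
  carrier := {f | ∀ x, ¬ P x → f x = 0}
  add_mem' := by
    intro f g hf hg x hx
    simp [hf x hx, hg x hx]
  zero_mem' := by
    intro x _
    rfl
  smul_mem' := by
    intro k f hf x hx
    simp [hf x hx]

/-! ### Frobenius algebra rules: `true` stands for `v₊`, `false` for `v₋` (and for `v₀`) -/

/-- `v_k` occurs in `μ (v_i ⊗ v_j)`. -/
def muRule : Bool → Bool → Bool → Bool
  | true, true, true => true
  | true, false, false => true
  | false, true, false => true
  | _, _, _ => false

/-- `v_j ⊗ v_k` occurs in `Δ v_i`. -/
def deltaRule : Bool → Bool → Bool → Bool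
  | true, true, false => true
  | true, false, true => true
  | false, false, false => true
  | _, _, _ => false

noncomputable section

open scoped Classical

namespace LinkDiagram

variable {X O F : Type u} [Fintype X] [Fintype O] [Fintype F] (L : LinkDiagram X O F)

/-- The number of right-handed crossings. -/
def nPos : ℤ := (Finset.univ.filter fun c => L.positive c).card

/-- The number of left-handed crossings. -/
def nNeg : ℤ := (Finset.univ.filter fun c => ¬ L.positive c).card

/-! ### Resolutions -/

/-- In the resolution `L_S` the crossing `c` is resolved compatibly with the orientation: this is
the `0`-resolution (`c ∉ S`) of a right-handed and the `1`-resolution of a left-handed crossing. -/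
def Oriented (S : Finset X) (c : X) : Prop := L.positive c ↔ c ∉ S

/-- The arcs `a` and `b` are joined at a crossing by the resolution `L_S`. -/
def Joined (S : Finset X) (a b : DiagramArc X O) : Prop :=
  ∃ c,
    (L.Oriented S c ∧
      ((a = L.inc c false ∧ b = L.out c true) ∨ (a = L.inc c true ∧ b = L.out c false))) ∨
    (¬ L.Oriented S c ∧
      ((a = L.inc c false ∧ b = L.inc c true) ∨ (a = L.out c false ∧ b = L.out c true)))

/-- The circle of `L_S` through the arc `a`, as a set of arcs. -/
def circleOf (S : Finset X) (a : DiagramArc X O) : Finset (DiagramArc X O) :=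
  Finset.univ.filter fun b => Relation.EqvGen (L.Joined S) a b

/-- The set of circles of `L_S`. -/
def circles (S : Finset X) : Finset (Finset (DiagramArc X O)) :=
  Finset.univ.image (L.circleOf S)

/-- The unmarked circles of `L_S`. -/
def unmarked (S : Finset X) : Finset (Finset (DiagramArc X O)) :=
  (L.circles S).filter fun C => L.mark ∉ C

/-- Two faces of `L_S` are adjacent in the complement of the circle `C` of `L_S`: they meet along
an arc that is not in `C`, or they are the two opposite faces at a crossing that are connected by
the resolution (where only the coloured arc separates them). -/
def AdjacentOff (S : Finset X) (C : Finset (DiagramArc X O)) (f g : F) : Prop :=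
  (∃ a, a ∉ C ∧ f = L.left a ∧ g = L.right a) ∨
  ∃ c,
    (L.Oriented S c ∧ f = L.left (L.out c false) ∧ g = L.right (L.inc c false)) ∨
    (¬ L.Oriented S c ∧ f = L.left (L.inc c false) ∧ g = L.right (L.inc c true))

/-- The faces in the interior of an unmarked circle `C` of `L_S`, i.e. not in the component of the
complement of `C` which contains the marked point. -/
def interior (S : Finset X) (C : Finset (DiagramArc X O)) : Finset F :=
  Finset.univ.filter fun f => ¬ Relation.EqvGen (L.AdjacentOff S C) (L.left L.mark) f

/-- The polynomial ring over `ℤ/2` with one variable for each face. -/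
abbrev faceRing (_L : LinkDiagram X O F) : Type u := MvPolynomial F (ZMod 2)

/-- The field of fractions of the polynomial ring on the faces. -/
abbrev faceField (_L : LinkDiagram X O F) : Type u := FractionRing (MvPolynomial F (ZMod 2))

/-- The formal area of an unmarked circle of `L_S`. -/
def area (S : Finset X) (C : Finset (DiagramArc X O)) : L.faceRing :=
  ∑ f ∈ L.interior S C, MvPolynomial.X f

/-! ### The Khovanov complex and the totally twisted complex -/

/-- Pure states: a resolution `L_S` and the set of those unmarked circles which carry `v₊`.  The
other unmarked circles carry `v₋` and the marked circle carries `v₀`. -/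
abbrev PureState : Type u :=
  {x : Finset X × Finset (Finset (DiagramArc X O)) // x.2 ⊆ L.unmarked x.1}

/-- The (shifted) homological grading. -/
def hDeg (x : L.PureState) : ℤ := x.1.1.card - L.nNeg

/-- The (shifted) `q`-grading. -/
def qDeg (x : L.PureState) : ℤ :=
  x.1.2.card - (L.unmarked x.1.1 \ x.1.2).card + x.1.1.card + (L.nPos - 2 * L.nNeg)

/-- The `δ`-grading. -/
def deltaDeg (x : L.PureState) : ℤ := 2 * L.hDeg x - L.qDeg x

/-- The circles of `L_S` that pass through the crossing `c`. -/
def circlesAt (S : Finset X) (c : X) : Finset (Finset (DiagramArc X O)) :=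
  (L.circles S).filter fun C => ∃ a ∈ C, L.Touches c a

/-- The pure state `y` occurs in the Khovanov differential of `x`: the resolution changes at one
crossing `c`, the labels of the circles not passing through `c` are unchanged, and the labels of the
circles through `c` are related by `μ` (two circles merge) or by `Δ` (one circle divides). -/
def KhovanovIncident (x y : L.PureState) : Prop :=
  ∃ c, c ∉ x.1.1 ∧ y.1.1 = insert c x.1.1 ∧
    x.1.2 \ L.circlesAt x.1.1 c = y.1.2 \ L.circlesAt y.1.1 c ∧
    ((∃ C₁ C₂ C, C₁ ≠ C₂ ∧ L.circlesAt x.1.1 c = {C₁, C₂} ∧ L.circlesAt y.1.1 c = {C} ∧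
        muRule (decide (C₁ ∈ x.1.2)) (decide (C₂ ∈ x.1.2)) (decide (C ∈ y.1.2)) = true) ∨
     (∃ C C₁ C₂, C₁ ≠ C₂ ∧ L.circlesAt x.1.1 c = {C} ∧ L.circlesAt y.1.1 c = {C₁, C₂} ∧
        deltaRule (decide (C ∈ x.1.2)) (decide (C₁ ∈ y.1.2)) (decide (C₂ ∈ y.1.2)) = true))

/-- The Khovanov differential `∂_KH`, over any coefficient ring of characteristic 2. -/
def khovanovDiff (K : Type*) [CommRing K] : (L.PureState → K) →ₗ[K] (L.PureState → K) :=
  Matrix.mulVecLin (Matrix.of fun y x => if L.KhovanovIncident x y then 1 else 0)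

/-- The Koszul differential `∂_𝒱 = ∑_C ∂_C`, where `∂_C` maps the label `v₊` of the unmarked circle
`C` to `[C] v₋`. -/
def koszulDiff (K : Type*) [CommRing K] [Algebra L.faceRing K] :
    (L.PureState → K) →ₗ[K] (L.PureState → K) :=
  Matrix.mulVecLin (Matrix.of fun y x => ∑ C ∈ x.1.2,
    if y.1.1 = x.1.1 ∧ y.1.2 = x.1.2.erase C then algebraMap L.faceRing K (L.area x.1.1 C) else 0)

/-- The differential of the totally twisted Khovanov complex. -/
def twistedDiff (K : Type*) [CommRing K] [Algebra L.faceRing K] :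
    (L.PureState → K) →ₗ[K] (L.PureState → K) :=
  L.khovanovDiff K + L.koszulDiff K

/-- The part of homological grading `h` and `q`-grading `q`. -/
def bigradedPart (K : Type*) [CommRing K] (h q : ℤ) : Submodule K (L.PureState → K) :=
  spanOn K fun x => L.hDeg x = h ∧ L.qDeg x = q

/-- The part of `δ`-grading `s`. -/
def deltaPart (K : Type*) [CommRing K] (s : ℤ) : Submodule K (L.PureState → K) :=
  spanOn K fun x => L.deltaDeg x = s

/-- The filtration by the `q`-grading: the part of `q`-grading at most `p` and `δ`-grading `s`. -/
def qFiltration (K : Type*) [CommRing K] (p s : ℤ) : Submodule K (L.PureState → K) :=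
  spanOn K fun x => L.qDeg x ≤ p ∧ L.deltaDeg x = s

/-- Bigraded reduced Khovanov homology `KH^{h,q}` with coefficients in `K` of characteristic 2. -/
abbrev KH (K : Type*) [CommRing K] (h q : ℤ) : Type _ :=
  pieceHomology (L.khovanovDiff K) (L.bigradedPart K (h - 1) q) (L.bigradedPart K h q)

/-- `δ`-graded reduced Khovanov homology `KH_s` with coefficients in `K` of characteristic 2. -/
abbrev deltaKH (K : Type*) [CommRing K] (s : ℤ) : Type _ :=
  pieceHomology (L.khovanovDiff K) (L.deltaPart K (s - 2)) (L.deltaPart K s)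

/-- The homology of the totally twisted complex over `K` in `δ`-grading `s`. -/
abbrev twistedHomology (K : Type*) [CommRing K] [Algebra L.faceRing K] (s : ℤ) : Type _ :=
  pieceHomology (L.twistedDiff K) (L.deltaPart K (s - 2)) (L.deltaPart K s)

/-- The filtration on the homology of the totally twisted complex induced by the `q`-filtration. -/
abbrev twistedHomologyFil (K : Type*) [CommRing K] [Algebra L.faceRing K] (p s : ℤ) :
    Submodule K (L.twistedHomology K s) :=
  homologyFiltration (L.twistedDiff K) (L.deltaPart K (s - 2)) (L.deltaPart K s)
    (L.qFiltration K p s)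

/-! ### The spanning tree complex -/

/-- The resolutions which consist of a single circle. -/
abbrev TreeState : Type u := {T : Finset X // (L.circles T).card = 1}

/-- The formal area, in the field of fractions, of the region not containing the marked point that
is cleaved off in a resolution with one unmarked circle. -/
def cleavedArea (S : Finset X) : L.faceField :=
  ∑ C ∈ L.unmarked S, algebraMap L.faceRing L.faceField (L.area S C)

/-- The differential of the spanning tree complex: for `T ⊂ T'` with `T' = T ∪ {c₁, c₂}`, the
coefficient of `T'` in `∂ T` is `1 / [B] + 1 / [W]`, where `B` and `W` are the regions cleaved off
in the resolutions `T ∪ {c₁}` and `T ∪ {c₂}`. -/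
def treeDiff : (L.TreeState → L.faceField) →ₗ[L.faceField] (L.TreeState → L.faceField) :=
  Matrix.mulVecLin (Matrix.of fun T' T =>
    if T.1 ⊆ T'.1 ∧ (T'.1 \ T.1).card = 2 then
      ∑ c ∈ T'.1 \ T.1, (L.cleavedArea (insert c T.1))⁻¹ else 0)

/-- The part of (shifted) grading `s` of the spanning tree complex. -/
def treePart (s : ℤ) : Submodule L.faceField (L.TreeState → L.faceField) :=
  spanOn L.faceField fun T => (T.1.card : ℤ) - L.nPos = s

/-- The spanning tree homology `HT_s(L)`. -/
abbrev HT (s : ℤ) : Type _ :=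
  pieceHomology L.treeDiff (L.treePart (s - 2)) (L.treePart s)

end LinkDiagram

end

/-! Two algebraic mechanisms carry the theorem. With respect to the `q`-filtration the twisted
differential is `∂_KH` plus a part that strictly lowers `q`, so `E⁰` and `E¹` see only `∂_KH`. On
the other hand `∂_𝒱` has invertible coefficients over the field of fractions, and cancelling along
it leaves only the resolutions with a single circle.

The topological input is that the sphere has no first homology mod 2. Euler's formula and a
dimension count show that every mod 2 cycle of arcs bounds a function on the faces
(`exists_potential`). This has two consequences. First, two paths of a resolution cannot cross at a
removed crossing (`not_crossing`), so that changing the resolution at one crossing either merges two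
circles or divides one (`merges_or_merges`). Second, every circle separates the faces into two
sides, and its area is a sum of weights of its arcs which do not depend on the resolution
(`area_eq_sum_weight`).

All differentials are expressed through the operators `dot a`, multiplication by the nilpotent
generator of the circle through the arc `a`. Arcs are common to all resolutions, so these operators
act on the whole cube. They commute with the edge maps (`edge_comm_dot`), and they generate the
complex from the vectors with all unmarked circles labelled `v₊`. Squares of the cube need to be
compared only on these vectors (`edge_edge_top`). By the additivity of areas, `∂_𝒱` is a fixed
linear combination of the operators `dot a` (`koszulDiff_eq_sum`); hence it squares to zero and
commutes with `∂_KH`. In characteristic 2 this gives `∂² = 0`.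

The spectral sequence is built from the explicit quotients `Z^r / B^r`. The filtration is bounded,
so from some page on `Z^r` consists of cycles and `B^r` contains all boundaries; this is
convergence. The rank inequality is proved without the pages: for a perturbation that lowers a
bounded filtration, the rank of the differential cannot drop (`finrank_map_le`).

For the spanning tree complex, one unmarked circle is chosen in every resolution that has one. The
component of `∂` from `v₊` to `v₋` on the chosen circle is the nonzero area, and the component of
`∂` from all plus states to all minus states is triangular with respect to `|S|` (`isTriangular`).
Gaussian elimination replaces the complex by the reduced elements `w`, for which neither `w` nor `∂
w` has a minus component. A reduced element is determined by its values on the single-circle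
resolutions. Solving the vanishing of `∂ w` on the two-circle resolutions between `T` and `T'`
produces the inverse areas, so that restriction carries `∂` to the tree differential
(`restrictTree_twistedDiff`). This also explains why the tree differential squares to zero. -/

/-! ### Equivalence closures and orbits of two involutions -/

theorem Relation.EqvGen.mem_iff {α : Type*} {r : α → α → Prop} {p : α → Prop}
    (h : ∀ a b, r a b → (p a ↔ p b)) {a b : α} (hab : Relation.EqvGen r a b) : p a ↔ p b := by
  induction hab with
  | rel a b hab => exact h a b hab
  | refl => rfl
  | symm a b _ ih => exact ih.symm
  | trans a b c _ _ ih₁ ih₂ => exact ih₁.trans ih₂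

theorem Relation.EqvGen.le_of_equivalence {α : Type*} {r s : α → α → Prop} (hs : Equivalence s)
    (h : ∀ a b, r a b → s a b) {a b : α} (hab : Relation.EqvGen r a b) : s a b := by
  induction hab with
  | rel a b hab => exact h a b hab
  | refl a => exact hs.refl a
  | symm a b _ ih => exact hs.symm ih
  | trans a b c _ _ ih₁ ih₂ => exact hs.trans ih₁ ih₂

/-- A group of permutations generated by two involutions, one of them without fixed points used,
acts on the fixed points of `β` in any orbit of `β * α` with at most two elements. -/
theorem Equiv.Perm.eq_of_zpow_fixed {E : Type*} [Finite E] (α β : Equiv.Perm E)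
    (hα : α * α = 1) (hβ : β * β = 1) {e : E} (he : β e = e) {i j : ℤ}
    (hi : β (((β * α) ^ i) e) = ((β * α) ^ i) e) (hj : β (((β * α) ^ j) e) = ((β * α) ^ j) e)
    (hie : ((β * α) ^ i) e ≠ e) (hje : ((β * α) ^ j) e ≠ e) :
    ((β * α) ^ i) e = ((β * α) ^ j) e := by
  have hαi : α⁻¹ = α := inv_eq_of_mul_eq_one_left hα
  have hβi : β⁻¹ = β := inv_eq_of_mul_eq_one_left hβ
  -- Conjugation by `β` inverts `β * α`, and `e` is fixed by `β`.
  have key : ∀ k : ℤ, β (((β * α) ^ k) e) = ((β * α) ^ (-k)) e := by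
    intro k
    have : β * (β * α) ^ k * β⁻¹ = (β * α) ^ (-k) := by
      rw [← conj_zpow, zpow_neg, ← inv_zpow, mul_inv_rev, hαi, hβi, ← mul_assoc, hβ, one_mul]
    rw [← this, hβi]
    simp [he]
  have dvd : ∀ k : ℤ, ((β * α) ^ k) e = e ↔ (Function.minimalPeriod ((β * α) • ·) e : ℤ) ∣ k := by
    intro k
    rw [← MulAction.zpow_smul_eq_iff_minimalPeriod_dvd]
    rfl
  -- A point of the orbit fixed by `β` has index `k` with `k ≡ -k` modulo the period.
  have two : ∀ k : ℤ, β (((β * α) ^ k) e) = ((β * α) ^ k) e →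
      (Function.minimalPeriod ((β * α) • ·) e : ℤ) ∣ 2 * k := by
    intro k hk
    rw [← dvd, two_mul, zpow_add, Equiv.Perm.mul_apply, ← hk, key, ← Equiv.Perm.mul_apply,
      ← zpow_add]
    simp
  have h1 := two i hi
  have h2 := two j hj
  rw [Ne, dvd] at hie hje
  -- The period divides `2 * i` but not `i`, so `2 * i` is an odd multiple of it. The same holds for
  -- `j`, and the difference of two odd multiples is an even one.
  have h3 : (Function.minimalPeriod ((β * α) • ·) e : ℤ) ∣ i - j := by
    obtain ⟨u, hu⟩ := h1
    obtain ⟨v, hv⟩ := h2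
    generalize (Function.minimalPeriod ((β * α) • ·) e : ℤ) = n at *
    rcases Int.even_or_odd' u with ⟨u', rfl | rfl⟩
    · exact absurd ⟨u', by linarith⟩ hie
    rcases Int.even_or_odd' v with ⟨v', rfl | rfl⟩
    · exact absurd ⟨v', by linarith⟩ hje
    exact ⟨u' - v', by linarith⟩
  rw [← dvd, sub_eq_neg_add, zpow_add, Equiv.Perm.mul_apply] at h3
  have := congrArg ((β * α) ^ j) h3
  rwa [← Equiv.Perm.mul_apply, ← zpow_add, add_neg_cancel, zpow_zero, Equiv.Perm.one_apply] at this

set_option linter.unusedSectionVars false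

noncomputable section

open scoped Classical

namespace LinkDiagram

variable {X O F : Type u} [Fintype X] [Fintype O] [Fintype F] (L : LinkDiagram X O F)

/-! ### Potentials of cycles: the first homology of the sphere -/

/-- The sum of a mod 2 chain over the four ends of arcs at a crossing. -/
def boundarySum (ψ : DiagramArc X O → ZMod 2) (c : X) : ZMod 2 :=
  ∑ i : Bool, (ψ (L.out c i) + ψ (L.inc c i))

/-- Every arc that meets a crossing has two ends, so it is counted twice; `next` reindexes the
incoming ends by the outgoing ones. -/
theorem sum_boundarySum (ψ : DiagramArc X O → ZMod 2) : ∑ c, L.boundarySum ψ c = 0 := by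
  unfold boundarySum
  rw [← Fintype.sum_prod_type' (f := fun c i => ψ (L.out c i) + ψ (L.inc c i)),
    Finset.sum_add_distrib]
  have : ∑ x : X × Bool, ψ (L.inc x.1 x.2) = ∑ x : X × Bool, ψ (L.out x.1 x.2) :=
    Equiv.sum_comp L.next.symm fun x => ψ (Sum.inl x)
  rw [this]
  exact CharTwo.add_self_eq_zero _

/-- The coboundary of a mod 2 cochain on the faces. -/
def coboundary (φ : F → ZMod 2) (a : DiagramArc X O) : ZMod 2 := φ (L.left a) + φ (L.right a)

/-- Each of the four corners at the crossing lies between two consecutive ends, so its face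
contributes twice. -/
theorem boundarySum_coboundary (φ : F → ZMod 2) (c : X) :
    L.boundarySum (L.coboundary φ) c = 0 := by
  simp only [boundarySum, coboundary, Fintype.sum_bool, L.south, L.north, L.west, L.east]
  have := fun x : ZMod 2 => CharTwo.add_self_eq_zero x
  grind

theorem eq_of_coboundary_eq_zero {φ : F → ZMod 2} (h : ∀ a, L.coboundary φ a = 0) (f g : F) :
    φ f = φ g := by
  refine Relation.EqvGen.le_of_equivalence (s := fun f g => φ f = φ g)
    ⟨fun _ => rfl, Eq.symm, Eq.trans⟩ ?_ (L.connected f g)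
  rintro _ _ ⟨a, rfl, rfl⟩
  exact CharTwo.add_eq_zero.1 (h a)

def boundaryMap : (DiagramArc X O → ZMod 2) →ₗ[ZMod 2] (X → ZMod 2) where
  toFun := L.boundarySum
  map_add' ψ ψ' := by
    funext c
    simp only [boundarySum, Fintype.sum_bool, Pi.add_apply]
    ring
  map_smul' k ψ := by
    funext c
    simp only [boundarySum, Fintype.sum_bool, Pi.smul_apply, smul_eq_mul, RingHom.id_apply]
    ring

def coboundaryMap : (F → ZMod 2) →ₗ[ZMod 2] (DiagramArc X O → ZMod 2) where
  toFun := L.coboundary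
  map_add' ψ ψ' := by
    funext c
    simp only [coboundary, Pi.add_apply]
    ring
  map_smul' k ψ := by
    funext c
    simp only [coboundary, Pi.smul_apply, smul_eq_mul, RingHom.id_apply]
    ring

/-- The faces are connected through arcs, so the kernel contains only constants. -/
theorem finrank_range_coboundaryMap_ge :
    Fintype.card F ≤ Module.finrank (ZMod 2) (LinearMap.range L.coboundaryMap) + 1 := by
  have h := L.coboundaryMap.finrank_range_add_finrank_ker
  rw [Module.finrank_fintype_fun_eq_card] at h
  have h1 : Module.finrank (ZMod 2) (LinearMap.ker L.coboundaryMap) ≤ 1 := by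
    refine finrank_le_one (⟨fun _ => 1, ?_⟩ : LinearMap.ker L.coboundaryMap) fun w => ?_
    · rw [LinearMap.mem_ker]
      funext a
      exact CharTwo.add_self_eq_zero (1 : ZMod 2)
    · refine ⟨w.1 (L.left L.mark), Subtype.ext (funext fun f => ?_)⟩
      have := L.eq_of_coboundary_eq_zero (φ := w.1) (fun a => congrFun w.2 a) (L.left L.mark) f
      simp [this]
  omega

/-- The class function of the components of the projection defined by a function on the crossings
that is constant along arcs and a function on the crossingless components. -/
def componentFun (g : {g : X → ZMod 2 // ∀ x i, g (L.next.symm (x, i)).1 = g x})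
    (h : O → ZMod 2) :
    (Quot fun a b : DiagramArc X O => ∃ c, L.Touches c a ∧ L.Touches c b) → ZMod 2 :=
  Quot.lift (Sum.elim (fun x => g.1 x.1) h) <| by
    have key : ∀ c a, L.Touches c a → Sum.elim (fun x : X × Bool => g.1 x.1) h a = g.1 c := by
      rintro c a ⟨i, rfl | rfl⟩
      · rfl
      · exact g.2 c i
    rintro a b ⟨c, ha, hb⟩
    rw [key c a ha, key c b hb]

/-- The kernel of the transpose consists of functions on the crossings that are constant along arcs.
Together with arbitrary functions on the crossingless components they embed into the functions on
the components of the projection. This bounds the rank from below, and rank-nullity bounds the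
kernel from above. -/
theorem finrank_ker_boundaryMap_le :
    Module.finrank (ZMod 2) (LinearMap.ker L.boundaryMap) ≤ Fintype.card X + L.componentCount := by
  -- the transpose of the boundary map
  have ht : L.boundaryMap.toMatrix'.rank + Fintype.card O +
      Module.finrank (ZMod 2) (LinearMap.ker L.boundaryMap.toMatrix'.transpose.mulVecLin) =
      Fintype.card X + Fintype.card O := by
    have := L.boundaryMap.toMatrix'.transpose.mulVecLin.finrank_range_add_finrank_ker
    rw [Module.finrank_fintype_fun_eq_card, ← Matrix.rank, Matrix.rank_transpose] at this
    omega
  have hr : L.boundaryMap.toMatrix'.rank +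
      Module.finrank (ZMod 2) (LinearMap.ker L.boundaryMap) =
      2 * Fintype.card X + Fintype.card O := by
    have := L.boundaryMap.finrank_range_add_finrank_ker
    rw [Module.finrank_fintype_fun_eq_card] at this
    rw [Matrix.rank, ← Matrix.toLin'_apply', Matrix.toLin'_toMatrix', this]
    simp [mul_comm]
  have hk : Fintype.card O +
      Module.finrank (ZMod 2) (LinearMap.ker L.boundaryMap.toMatrix'.transpose.mulVecLin) ≤
      L.componentCount := by
    -- The transposed equation at an arc says that the values of `g` at its two ends add up to zero.
    have hmem : ∀ g ∈ LinearMap.ker L.boundaryMap.toMatrix'.transpose.mulVecLin,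
        ∀ x i, g (L.next.symm (x, i)).1 = g x := by
      intro g hg x i
      have h : ∑ c, L.boundaryMap.toMatrix' c (L.inc x i) * g c = 0 :=
        congrFun (LinearMap.mem_ker.1 hg) (L.inc x i)
      have e : ∑ c, L.boundarySum (Pi.single (L.inc x i) 1) c * g c = 0 := by
        simpa [LinearMap.toMatrix'_apply, boundaryMap] using h
      have e' : ∀ c, L.boundarySum (Pi.single (L.inc x i) 1) c * g c =
          ∑ j, ((if (c, j) = L.next.symm (x, i) then g c else 0) +
            if (c, j) = (x, i) then g c else 0) := by
        intro c
        rw [boundarySum, Finset.sum_mul]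
        refine Finset.sum_congr rfl fun j _ => ?_
        simp only [add_mul, Pi.single_apply, DiagramData.out, DiagramData.inc, Sum.inl.injEq,
          EmbeddingLike.apply_eq_iff_eq, ite_mul, one_mul, zero_mul]
      simp only [e'] at e
      rw [← Fintype.sum_prod_type' (f := fun c j =>
        ((if (c, j) = L.next.symm (x, i) then g c else 0) +
            if (c, j) = (x, i) then g c else 0))] at e
      simp only [Prod.mk.eta, Finset.sum_add_distrib, Finset.sum_ite_eq', Finset.mem_univ,
        if_true] at e
      exact CharTwo.add_eq_zero.1 e
    let Φ : (LinearMap.ker L.boundaryMap.toMatrix'.transpose.mulVecLin × (O → ZMod 2)) →ₗ[ZMod 2]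
        ((Quot fun a b : DiagramArc X O => ∃ c, L.Touches c a ∧ L.Touches c b) → ZMod 2) :=
      { toFun := fun p => L.componentFun ⟨p.1.1, hmem _ p.1.2⟩ p.2
        map_add' := fun p q => by
          funext z
          induction z using Quot.ind with | mk a => cases a <;> rfl
        map_smul' := fun k p => by
          funext z
          induction z using Quot.ind with | mk a => cases a <;> rfl }
    have hinj : Function.Injective Φ := by
      intro p q hpq
      refine Prod.ext (Subtype.ext (funext fun c => ?_)) (funext fun o => ?_)
      · exact congrFun hpq (Quot.mk _ (Sum.inl (c, true)))
      · exact congrFun hpq (Quot.mk _ (Sum.inr o))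
    have := Fintype.ofFinite
      (Quot fun a b : DiagramArc X O => ∃ c, L.Touches c a ∧ L.Touches c b)
    have := LinearMap.finrank_le_finrank_of_injective hinj
    rw [Module.finrank_prod, Module.finrank_fintype_fun_eq_card,
      Module.finrank_fintype_fun_eq_card] at this
    rw [DiagramData.componentCount, Nat.card_eq_fintype_card]
    omega
  omega

/-- Every mod 2 cycle on the sphere is a coboundary. -/
theorem exists_potential {ψ : DiagramArc X O → ZMod 2} (h : ∀ c, L.boundarySum ψ c = 0) :
    ∃ φ : F → ZMod 2, ∀ a, ψ a = φ (L.left a) + φ (L.right a) := by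
  have hle : LinearMap.range L.coboundaryMap ≤ LinearMap.ker L.boundaryMap := by
    rintro _ ⟨φ, rfl⟩
    exact funext fun c => L.boundarySum_coboundary φ c
  -- Euler's formula is exactly what makes the lower bound for coboundaries meet the upper bound for
  -- cycles.
  have heq := Submodule.eq_of_le_of_finrank_le hle <| by
    have h1 := L.finrank_range_coboundaryMap_ge
    have h2 := L.finrank_ker_boundaryMap_le
    have h3 := L.euler
    omega
  have : ψ ∈ LinearMap.range L.coboundaryMap := by
    rw [heq]
    exact funext h
  obtain ⟨φ, hφ⟩ := this
  exact ⟨φ, fun a => (congrFun hφ a).symm⟩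

end LinkDiagram
end

noncomputable section

open scoped Classical

namespace LinkDiagram

variable {X O F : Type u} [Fintype X] [Fintype O] [Fintype F] (L : LinkDiagram X O F)

/-! ### Paths of a resolution with one crossing removed -/

/-- The arcs `a` and `b` are joined by the resolution `L_S` at the crossing `c`. -/
def JoinedAt (S : Finset X) (c : X) (a b : DiagramArc X O) : Prop :=
  (L.Oriented S c ∧
      ((a = L.inc c false ∧ b = L.out c true) ∨ (a = L.inc c true ∧ b = L.out c false))) ∨
    (¬ L.Oriented S c ∧
      ((a = L.inc c false ∧ b = L.inc c true) ∨ (a = L.out c false ∧ b = L.out c true)))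

/-- The arcs `a` and `b` lie on one circle of `L_S`. -/
def Rel (S : Finset X) : DiagramArc X O → DiagramArc X O → Prop := Relation.EqvGen (L.Joined S)

/-- The arcs `a` and `b` are connected in `L_S` with the crossing `c` removed. -/
def RelOff (S : Finset X) (c : X) : DiagramArc X O → DiagramArc X O → Prop :=
  Relation.EqvGen fun a b => ∃ x, x ≠ c ∧ L.JoinedAt S x a b

theorem rel_equivalence (S : Finset X) : Equivalence (L.Rel S) := Relation.EqvGen.is_equivalence _

theorem relOff_equivalence (S : Finset X) (c : X) : Equivalence (L.RelOff S c) :=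
  Relation.EqvGen.is_equivalence _

theorem JoinedAt.rel {S : Finset X} {c : X} {a b : DiagramArc X O} (h : L.JoinedAt S c a b) :
    L.Rel S a b := Relation.EqvGen.rel _ _ ⟨c, h⟩

theorem RelOff.rel {S : Finset X} {c : X} {a b : DiagramArc X O} (h : L.RelOff S c a b) :
    L.Rel S a b :=
  Relation.EqvGen.le_of_equivalence (L.rel_equivalence S) (fun _ _ ⟨_, _, h⟩ => JoinedAt.rel L h) h

/-- The arc of an end `((c, i), o)`, which lies at the crossing `c` on the strand `i` and is
outgoing when `o = true`. -/
def endArc (e : (X × Bool) × Bool) : DiagramArc X O :=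
  bif e.2 then L.out e.1.1 e.1.2 else L.inc e.1.1 e.1.2

/-- The other end of the arc of an end. -/
def otherEnd : Equiv.Perm ((X × Bool) × Bool) where
  toFun e := bif e.2 then (L.next e.1, false) else (L.next.symm e.1, true)
  invFun e := bif e.2 then (L.next e.1, false) else (L.next.symm e.1, true)
  left_inv := by rintro ⟨x, _ | _⟩ <;> simp
  right_inv := by rintro ⟨x, _ | _⟩ <;> simp

/-- The end that is joined to a given end in `L_S`; the ends at the crossing `c` are fixed. -/
def partnerOff (S : Finset X) (c : X) : Equiv.Perm ((X × Bool) × Bool) :=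
  Function.Involutive.toPerm
    (fun e => if e.1.1 = c then e else
      ((e.1.1, !e.1.2), if L.Oriented S e.1.1 then !e.2 else e.2)) <| by
    rintro ⟨⟨x, i⟩, o⟩
    by_cases hx : x = c <;> by_cases ho : L.Oriented S x <;> simp [hx, ho]

theorem otherEnd_mul_self : L.otherEnd * L.otherEnd = 1 :=
  Equiv.ext fun e => L.otherEnd.left_inv e

theorem partnerOff_mul_self (S : Finset X) (c : X) :
    L.partnerOff S c * L.partnerOff S c = 1 :=
  Equiv.ext fun e => (L.partnerOff S c).left_inv e

theorem partnerOff_apply (S : Finset X) (c : X) (e : (X × Bool) × Bool) :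
    L.partnerOff S c e = if e.1.1 = c then e else
      ((e.1.1, !e.1.2), if L.Oriented S e.1.1 then !e.2 else e.2) := rfl

theorem endArc_eq_iff (e f : (X × Bool) × Bool) :
    L.endArc e = L.endArc f ↔ f = e ∨ f = L.otherEnd e := by
  obtain ⟨x, _ | _⟩ := e <;> obtain ⟨y, _ | _⟩ := f <;>
    simp [endArc, otherEnd, DiagramData.inc, DiagramData.out, eq_comm, Equiv.eq_symm_apply]

theorem JoinedAt.exists_end {S : Finset X} {c x : X} {a b : DiagramArc X O}
    (h : L.JoinedAt S x a b) (hx : x ≠ c) :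
    ∃ e, a = L.endArc e ∧ b = L.endArc (L.partnerOff S c e) := by
  rcases h with ⟨ho, ⟨rfl, rfl⟩ | ⟨rfl, rfl⟩⟩ | ⟨ho, ⟨rfl, rfl⟩ | ⟨rfl, rfl⟩⟩
  · exact ⟨((x, false), false), by simp [endArc, partnerOff_apply, ho, hx]⟩
  · exact ⟨((x, true), false), by simp [endArc, partnerOff_apply, ho, hx]⟩
  · exact ⟨((x, false), false), by simp [endArc, partnerOff_apply, ho, hx]⟩
  · exact ⟨((x, false), true), by simp [endArc, partnerOff_apply, ho, hx]⟩

/-- The path that starts at an end `e` at the crossing `c` has only one further end at `c`. -/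
theorem relOff_unique (S : Finset X) {e e' e'' : (X × Bool) × Bool} (h' : e'.1.1 = e.1.1)
    (h'' : e''.1.1 = e.1.1) (hr' : L.RelOff S e.1.1 (L.endArc e) (L.endArc e'))
    (hr'' : L.RelOff S e.1.1 (L.endArc e) (L.endArc e'')) (hne' : e' ≠ e) (hne'' : e'' ≠ e) :
    e' = e'' := by
  set c := e.1.1 with hc
  have hfix : ∀ f : (X × Bool) × Bool, f.1.1 = c → L.partnerOff S c f = f := by
    intro f hf
    rw [partnerOff_apply, if_pos hf]
  have hα := L.otherEnd_mul_self
  have hβ := L.partnerOff_mul_self S c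
  set β := L.partnerOff S c with hβdef
  have hβi : β⁻¹ = β := inv_eq_of_mul_eq_one_left hβ
  have hαi : L.otherEnd⁻¹ = L.otherEnd := inv_eq_of_mul_eq_one_left hα
  have hneg : ∀ k : ℤ, β (((β * L.otherEnd) ^ k) e) = ((β * L.otherEnd) ^ (-k)) e := by
    intro k
    have : β * (β * L.otherEnd) ^ k * β⁻¹ = (β * L.otherEnd) ^ (-k) := by
      rw [← conj_zpow, zpow_neg, ← inv_zpow, mul_inv_rev, hαi, hβi, ← mul_assoc, hβ, one_mul]
    rw [← this, hβi]
    simp [hfix e rfl]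
  have hsucc : ∀ k : ℤ, β (L.otherEnd (((β * L.otherEnd) ^ k) e)) =
      ((β * L.otherEnd) ^ (1 + k)) e := fun k => by
    rw [zpow_add, zpow_one]
    rfl
  -- An arc carries two ends. Applying `β` to one of them runs backwards through the orbit of `e`,
  -- to the other one forwards.
  have step : ∀ f, (∃ k : ℤ, L.endArc (((β * L.otherEnd) ^ k) e) = L.endArc f) →
      ∃ k : ℤ, L.endArc (((β * L.otherEnd) ^ k) e) = L.endArc (β f) := by
    rintro f ⟨k, hk⟩
    rcases (L.endArc_eq_iff _ _).1 hk with rfl | rfl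
    · exact ⟨-k, by rw [hneg]⟩
    · exact ⟨1 + k, by rw [hsucc]⟩
  -- Following the path from `e` alternates between the other end of the arc and the partner at the
  -- next crossing, so it stays in one orbit of `β * L.otherEnd`.
  have orbit : ∀ a, L.RelOff S c (L.endArc e) a →
      ∃ k : ℤ, L.endArc (((β * L.otherEnd) ^ k) e) = a := by
    intro a ha
    refine (Relation.EqvGen.mem_iff (r := fun a b => ∃ x, x ≠ c ∧ L.JoinedAt S x a b)
      (p := fun a => ∃ k : ℤ, L.endArc (((β * L.otherEnd) ^ k) e) = a) ?_ ha).1 ⟨0, rfl⟩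
    rintro _ _ ⟨x, hx, hab⟩
    obtain ⟨f, rfl, rfl⟩ := JoinedAt.exists_end L hab hx
    refine ⟨step f, fun h => ?_⟩
    have hf : β (β f) = f := congrFun (congrArg DFunLike.coe hβ) f
    have := step (β f) h
    rwa [hf] at this
  -- If the orbit meets the arc of `f` at its other end, one more step arrives at `f` itself because
  -- `β` fixes the ends at `c`.
  have fixed : ∀ f : (X × Bool) × Bool, f.1.1 = c → L.RelOff S c (L.endArc e) (L.endArc f) →
      ∃ k : ℤ, ((β * L.otherEnd) ^ k) e = f := by
    intro f hf hr
    obtain ⟨k, hk⟩ := orbit _ hr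
    rcases (L.endArc_eq_iff _ _).1 hk with h | h
    · exact ⟨k, h.symm⟩
    · exact ⟨1 + k, by rw [← hsucc, ← h, hfix f hf]⟩
  obtain ⟨i, rfl⟩ := fixed e' h' hr'
  obtain ⟨j, rfl⟩ := fixed e'' h'' hr''
  exact Equiv.Perm.eq_of_zpow_fixed L.otherEnd β hα hβ (hfix e rfl) (hfix _ h') (hfix _ h'')
    hne' hne''

/-- A function that is constant along the paths off `c` has even sum over the ends at `c`. -/
theorem boundarySum_of_relOff (S : Finset X) (c : X) {ψ : DiagramArc X O → ZMod 2}
    (h : ∀ a b, L.RelOff S c a b → ψ a = ψ b) (x : X) : L.boundarySum ψ x = 0 := by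
  have key : ∀ x, x ≠ c → L.boundarySum ψ x = 0 := by
    intro x hx
    have h' : ∀ a b, L.JoinedAt S x a b → ψ a = ψ b := fun a b hab =>
      h a b (Relation.EqvGen.rel _ _ ⟨x, hx, hab⟩)
    have t := fun z : ZMod 2 => CharTwo.add_self_eq_zero z
    by_cases ho : L.Oriented S x
    · have h1 := h' _ _ (Or.inl ⟨ho, Or.inl ⟨rfl, rfl⟩⟩)
      have h2 := h' _ _ (Or.inl ⟨ho, Or.inr ⟨rfl, rfl⟩⟩)
      simp only [boundarySum, Fintype.sum_bool, h1, h2]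
      grind
    · have h1 := h' _ _ (Or.inr ⟨ho, Or.inl ⟨rfl, rfl⟩⟩)
      have h2 := h' _ _ (Or.inr ⟨ho, Or.inr ⟨rfl, rfl⟩⟩)
      simp only [boundarySum, Fintype.sum_bool, h1, h2]
      grind
  -- At `c` itself nothing is known locally; there the sum vanishes because the total over all
  -- crossings does.
  by_cases hx : x = c
  · subst hx
    rw [← L.sum_boundarySum ψ]
    exact (Fintype.sum_eq_single x key).symm
  · exact key x hx

theorem indicator_relOff (S : Finset X) (c : X) (u a b : DiagramArc X O) (h : L.RelOff S c a b) :
    (if L.RelOff S c u a then (1 : ZMod 2) else 0) = if L.RelOff S c u b then 1 else 0 := by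
  have e := L.relOff_equivalence S c
  have : L.RelOff S c u a ↔ L.RelOff S c u b := ⟨fun k => e.trans k h, fun k => e.trans k (e.symm h)⟩
  simp only [this]

/-- On the sphere two paths off `c` do not cross at `c`. -/
theorem not_crossing (S : Finset X) (c : X)
    (h1 : L.RelOff S c (L.inc c false) (L.out c false))
    (h2 : ¬ L.RelOff S c (L.out c true) (L.inc c false)) : False := by
  have e := L.relOff_equivalence S c
  -- The path through `out c true` is a mod 2 cycle, so some `φ` changes exactly across it.
  obtain ⟨φ, hφ⟩ := L.exists_potential (L.boundarySum_of_relOff S c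
    (L.indicator_relOff S c (L.out c true)))
  -- Along a path disjoint from that cycle the value of `φ` on the left side is constant. The left
  -- faces at the two ends of this path at `c` are the west and the north face, which the arc `out c
  -- true` separates: a contradiction.
  have key := Relation.EqvGen.mem_iff (r := fun a b => ∃ x, x ≠ c ∧ L.JoinedAt S x a b)
    (p := fun a => ¬ L.RelOff S c (L.out c true) a ∧ φ (L.left a) = φ (L.left (L.inc c false)))
    (a := L.inc c false) (b := L.out c false) ?_ h1
  · have h3 := (key.1 ⟨h2, rfl⟩).2
    have h4 := hφ (L.out c true)
    rw [if_pos (e.refl _), ← L.west, ← L.north, h3, CharTwo.add_self_eq_zero] at h4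
    exact one_ne_zero h4
  · rintro a b ⟨x, hx, hab⟩
    have hr : L.RelOff S c a b := Relation.EqvGen.rel _ _ ⟨x, hx, hab⟩
    have hiff : L.RelOff S c (L.out c true) a ↔ L.RelOff S c (L.out c true) b :=
      ⟨fun k => e.trans k hr, fun k => e.trans k (e.symm hr)⟩
    rw [hiff]
    refine and_congr_right fun hb => ?_
    have ha := hφ a
    rw [if_neg (hiff.not.2 hb)] at ha
    replace ha := CharTwo.add_eq_zero.1 ha.symm
    have hb' := hφ b
    rw [if_neg hb] at hb'
    replace hb' := CharTwo.add_eq_zero.1 hb'.symm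
    have : φ (L.left a) = φ (L.left b) := by
      rcases hab with ⟨_, ⟨rfl, rfl⟩ | ⟨rfl, rfl⟩⟩ | ⟨_, ⟨rfl, rfl⟩ | ⟨rfl, rfl⟩⟩
      · rw [L.west]
      · rw [ha, hb', L.east]
      · rw [ha, L.south]
      · rw [hb', L.north]
    rw [this]

/-- The two paths off `c` that end at `c`. -/
theorem relOff_pairing (S : Finset X) (c : X) :
    (L.RelOff S c (L.inc c false) (L.out c true) ∧ L.RelOff S c (L.inc c true) (L.out c false) ∧
      ¬ L.RelOff S c (L.inc c false) (L.inc c true)) ∨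
    (L.RelOff S c (L.inc c false) (L.inc c true) ∧ L.RelOff S c (L.out c true) (L.out c false) ∧
      ¬ L.RelOff S c (L.inc c false) (L.out c true)) := by
  have e := L.relOff_equivalence S c
  -- The indicator of any path meets `c` in an even number of ends. Together with `relOff_unique`
  -- this pairs the four ends; only the crossing pairing has to be excluded by the topology.
  have parity : ∀ u, (if L.RelOff S c u (L.inc c false) then (1 : ZMod 2) else 0) +
      (if L.RelOff S c u (L.inc c true) then 1 else 0) +
      (if L.RelOff S c u (L.out c false) then 1 else 0) +
      (if L.RelOff S c u (L.out c true) then 1 else 0) = 0 := by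
    intro u
    have h := L.boundarySum_of_relOff S c (L.indicator_relOff S c u) c
    rw [boundarySum, Fintype.sum_bool] at h
    linear_combination h
  have u1 : ¬ (L.RelOff S c (L.inc c false) (L.inc c true) ∧
      L.RelOff S c (L.inc c false) (L.out c true)) := fun h => by
    simpa using L.relOff_unique S (e := ((c, false), false)) (e' := ((c, true), false))
      (e'' := ((c, true), true)) rfl rfl h.1 h.2 (by simp) (by simp)
  have p1 := parity (L.inc c false)
  rw [if_pos (e.refl _)] at p1
  by_cases hSE : L.RelOff S c (L.inc c false) (L.inc c true)
  · have hNW : ¬ L.RelOff S c (L.inc c false) (L.out c true) := fun h => u1 ⟨hSE, h⟩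
    have hNW' : ¬ L.RelOff S c (L.out c true) (L.inc c false) := fun h => hNW (e.symm h)
    have hNW'' : ¬ L.RelOff S c (L.out c true) (L.inc c true) := fun h =>
      hNW (e.trans hSE (e.symm h))
    have p2 := parity (L.out c true)
    rw [if_pos (e.refl _), if_neg hNW', if_neg hNW''] at p2
    refine Or.inr ⟨hSE, ?_, hNW⟩
    by_contra h
    rw [if_neg h] at p2
    exact absurd p2 (by decide)
  · rw [if_neg hSE] at p1
    by_cases hNW : L.RelOff S c (L.inc c false) (L.out c true)
    · have hSE' : ¬ L.RelOff S c (L.inc c true) (L.inc c false) := fun h => hSE (e.symm h)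
      have hSE'' : ¬ L.RelOff S c (L.inc c true) (L.out c true) := fun h =>
        hSE (e.trans hNW (e.symm h))
      have p2 := parity (L.inc c true)
      rw [if_pos (e.refl _), if_neg hSE', if_neg hSE''] at p2
      refine Or.inl ⟨hNW, ?_, hSE⟩
      by_contra h
      rw [if_neg h] at p2
      exact absurd p2 (by decide)
    -- By parity this is the one pairing that is left, in which the two paths would cross.
    · have hNE : L.RelOff S c (L.inc c false) (L.out c false) := by
        by_contra h
        rw [if_neg h, if_neg hNW] at p1
        exact absurd p1 (by decide)
      exact (L.not_crossing S c hNE fun h => hNW (e.symm h)).elim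

/-! ### Merging and dividing circles -/

/-- The resolutions `L_S` and `L_{S'}` differ at the crossing `c`, where two circles of `L_S`,
namely those of the arcs `a` and `b`, are replaced by one circle of `L_{S'}`. -/
structure Merges (c : X) (S S' : Finset X) (a b : DiagramArc X O) : Prop where
  touches_left : L.Touches c a
  touches_right : L.Touches c b
  not_rel : ¬ L.Rel S a b
  rel_or_rel : ∀ x, L.Touches c x → L.Rel S a x ∨ L.Rel S b x
  rel_iff : ∀ x y, L.Rel S' x y ↔
    L.Rel S x y ∨ ((L.Rel S a x ∨ L.Rel S b x) ∧ (L.Rel S a y ∨ L.Rel S b y))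

/-- Here `L_S` reconnects at `c` only ends that already lie on the same path, so the paths `u₁–u₂`
and `v₁–v₂` close up to two circles. `L_{S'}` connects the `u`-ends to the `v`-ends and fuses them.
-/
theorem merges_of_relOff {c : X} {S S' : Finset X} {u₁ v₁ u₂ v₂ : DiagramArc X O}
    (hoff : L.RelOff S' c = L.RelOff S c) (hS : ∀ a b, L.JoinedAt S c a b → L.RelOff S c a b)
    (hu : L.RelOff S c u₁ u₂) (hv : L.RelOff S c v₁ v₂) (huv : ¬ L.RelOff S c u₁ v₁)
    (hS' : ∀ a b, L.JoinedAt S' c a b → (a = u₁ ∧ b = v₁) ∨ (a = u₂ ∧ b = v₂) ∨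
      (a = v₂ ∧ b = u₂))
    (hj : L.JoinedAt S' c u₁ v₁) (tu : L.Touches c u₁) (tv : L.Touches c v₁)
    (ht : ∀ x, L.Touches c x → x = u₁ ∨ x = v₁ ∨ x = u₂ ∨ x = v₂) : L.Merges c S S' u₁ v₁ := by
  have e := L.relOff_equivalence S c
  have e' := L.rel_equivalence S'
  -- The connections of `L_S` at `c` are redundant.
  have hrel : L.Rel S = L.RelOff S c := by
    funext a b
    refine propext ⟨fun h => Relation.EqvGen.le_of_equivalence e ?_ h, RelOff.rel L⟩
    rintro a b ⟨x, hx⟩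
    by_cases hxc : x = c
    · subst hxc
      exact hS a b hx
    · exact Relation.EqvGen.rel _ _ ⟨x, hxc, hx⟩
  have hle : ∀ a b, L.RelOff S c a b → L.Rel S' a b := fun a b h => RelOff.rel L (hoff ▸ h)
  refine ⟨tu, tv, hrel ▸ huv, ?_, ?_⟩
  · intro x hx
    rw [hrel]
    rcases ht x hx with rfl | rfl | rfl | rfl
    · exact Or.inl (e.refl _)
    · exact Or.inr (e.refl _)
    · exact Or.inl hu
    · exact Or.inr hv
  · intro x y
    rw [hrel]
    constructor
    -- The right-hand side is an equivalence relation that contains every connection of `L_{S'}`.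
    · refine Relation.EqvGen.le_of_equivalence (s := fun x y => L.RelOff S c x y ∨
        ((L.RelOff S c u₁ x ∨ L.RelOff S c v₁ x) ∧ (L.RelOff S c u₁ y ∨ L.RelOff S c v₁ y)))
        ⟨fun x => Or.inl (e.refl x), ?_, ?_⟩ ?_
      · rintro x y (h | ⟨h1, h2⟩)
        exacts [Or.inl (e.symm h), Or.inr ⟨h2, h1⟩]
      · rintro x y z (h | ⟨h1, h2⟩) (h' | ⟨h1', h2'⟩)
        · exact Or.inl (e.trans h h')
        · exact Or.inr ⟨h1'.imp (fun k => e.trans k (e.symm h)) (fun k => e.trans k (e.symm h)), h2'⟩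
        · exact Or.inr ⟨h1, h2.imp (fun k => e.trans k h') (fun k => e.trans k h')⟩
        · exact Or.inr ⟨h1, h2'⟩
      · rintro a b ⟨x, hx⟩
        by_cases hxc : x = c
        · subst hxc
          rcases hS' a b hx with ⟨rfl, rfl⟩ | ⟨rfl, rfl⟩ | ⟨rfl, rfl⟩
          · exact Or.inr ⟨Or.inl (e.refl _), Or.inr (e.refl _)⟩
          · exact Or.inr ⟨Or.inl hu, Or.inr hv⟩
          · exact Or.inr ⟨Or.inr hv, Or.inl hu⟩
        · exact Or.inl (hoff ▸ Relation.EqvGen.rel _ _ ⟨x, hxc, hx⟩)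
    · have hj' := JoinedAt.rel L hj
      have hx : ∀ x, L.RelOff S c u₁ x ∨ L.RelOff S c v₁ x → L.Rel S' u₁ x := by
        rintro x (h | h)
        exacts [hle _ _ h, e'.trans hj' (hle _ _ h)]
      rintro (h | ⟨h1, h2⟩)
      · exact hle _ _ h
      · exact e'.trans (e'.symm (hx x h1)) (hx y h2)

theorem touches_cases {c : X} {x : DiagramArc X O} (h : L.Touches c x) :
    x = L.inc c false ∨ x = L.inc c true ∨ x = L.out c false ∨ x = L.out c true := by
  obtain ⟨_ | _, rfl | rfl⟩ := h <;> simp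

/-- Off `c` both resolutions consist of the same paths. If these pair the ends at `c` as the
oriented resolution does, then the oriented side has two circles there and the other side one; for
the other planar pairing the roles are exchanged. -/
theorem merges_or_of_oriented {c : X} {S S' : Finset X} (hS : L.Oriented S c)
    (hS' : ¬ L.Oriented S' c) (h : ∀ x, x ≠ c → (L.Oriented S x ↔ L.Oriented S' x)) :
    (∃ a b, L.Merges c S S' a b) ∨ ∃ a b, L.Merges c S' S a b := by
  have hoff : L.RelOff S' c = L.RelOff S c := by
    unfold RelOff
    congr 1
    funext a b
    refine propext (exists_congr fun x => and_congr_right fun hx => ?_)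
    simp only [JoinedAt, h x hx]
  have e := L.relOff_equivalence S c
  have t1 : L.Touches c (L.inc c false) := ⟨false, Or.inr rfl⟩
  have t2 : L.Touches c (L.inc c true) := ⟨true, Or.inr rfl⟩
  have t3 : L.Touches c (L.out c true) := ⟨true, Or.inl rfl⟩
  rcases L.relOff_pairing S c with ⟨h1, h2, h3⟩ | ⟨h1, h2, h3⟩
  · refine Or.inl ⟨L.inc c false, L.inc c true, L.merges_of_relOff (u₂ := L.out c true)
      (v₂ := L.out c false) hoff ?_ h1 h2 h3 ?_ (Or.inr ⟨hS', Or.inl ⟨rfl, rfl⟩⟩) t1 t2 ?_⟩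
    · rintro a b (⟨_, ⟨rfl, rfl⟩ | ⟨rfl, rfl⟩⟩ | ⟨h, _⟩)
      exacts [h1, h2, absurd hS h]
    · rintro a b (⟨h, _⟩ | ⟨_, ⟨rfl, rfl⟩ | ⟨rfl, rfl⟩⟩)
      exacts [absurd h hS', Or.inl ⟨rfl, rfl⟩, Or.inr (Or.inr ⟨rfl, rfl⟩)]
    · intro x hx
      have := L.touches_cases hx
      tauto
  · refine Or.inr ⟨L.inc c false, L.out c true, L.merges_of_relOff (u₂ := L.inc c true)
      (v₂ := L.out c false) hoff.symm ?_ (hoff ▸ h1) (hoff ▸ h2) (hoff ▸ h3) ?_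
      (Or.inl ⟨hS, Or.inl ⟨rfl, rfl⟩⟩) t1 t3 ?_⟩
    · rw [hoff]
      rintro a b (⟨h, _⟩ | ⟨_, ⟨rfl, rfl⟩ | ⟨rfl, rfl⟩⟩)
      exacts [absurd h hS', h1, e.symm h2]
    · rintro a b (⟨_, ⟨rfl, rfl⟩ | ⟨rfl, rfl⟩⟩ | ⟨h, _⟩)
      exacts [Or.inl ⟨rfl, rfl⟩, Or.inr (Or.inl ⟨rfl, rfl⟩), absurd hS h]
    · intro x hx
      have := L.touches_cases hx
      tauto

/-- Changing a resolution at a crossing merges two circles or divides a circle. -/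
theorem merges_or_merges {c : X} {S : Finset X} (hc : c ∉ S) :
    (∃ a b, L.Merges c S (insert c S) a b) ∨ ∃ a b, L.Merges c (insert c S) S a b := by
  have h : ∀ x, x ≠ c → (L.Oriented S x ↔ L.Oriented (insert c S) x) := by
    intro x hx
    simp [Oriented, hx]
  by_cases hp : L.positive c
  · exact L.merges_or_of_oriented (by simp [Oriented, hp, hc]) (by simp [Oriented, hp]) h
  · exact (L.merges_or_of_oriented (by simp [Oriented, hp]) (by simp [Oriented, hp, hc])
      fun x hx => (h x hx).symm).symm

end LinkDiagram
end

noncomputable section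

open scoped Classical

namespace LinkDiagram

variable {X O F : Type u} [Fintype X] [Fintype O] [Fintype F] (L : LinkDiagram X O F)

/-! ### Circles -/

theorem mem_circleOf {S : Finset X} {a b : DiagramArc X O} : b ∈ L.circleOf S a ↔ L.Rel S a b := by
  simp [circleOf, Rel]

theorem self_mem_circleOf (S : Finset X) (a : DiagramArc X O) : a ∈ L.circleOf S a :=
  (L.mem_circleOf).2 ((L.rel_equivalence S).refl a)

theorem circleOf_eq_iff {S : Finset X} {a b : DiagramArc X O} :
    L.circleOf S a = L.circleOf S b ↔ L.Rel S a b := by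
  have e := L.rel_equivalence S
  constructor
  · intro h
    rw [← mem_circleOf, h]
    exact L.self_mem_circleOf S b
  · intro h
    ext x
    rw [mem_circleOf, mem_circleOf]
    exact ⟨fun k => e.trans (e.symm h) k, fun k => e.trans h k⟩

theorem circleOf_mem_circles (S : Finset X) (a : DiagramArc X O) : L.circleOf S a ∈ L.circles S :=
  Finset.mem_image_of_mem _ (Finset.mem_univ a)

theorem mem_circles {S : Finset X} {C : Finset (DiagramArc X O)} :
    C ∈ L.circles S ↔ ∃ a, L.circleOf S a = C := by
  simp [circles]

theorem circleOf_eq_of_mem {S : Finset X} {C : Finset (DiagramArc X O)} (hC : C ∈ L.circles S)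
    {a : DiagramArc X O} (ha : a ∈ C) : L.circleOf S a = C := by
  obtain ⟨b, rfl⟩ := L.mem_circles.1 hC
  exact L.circleOf_eq_iff.2 ((L.rel_equivalence S).symm (L.mem_circleOf.1 ha))

theorem mem_iff_circleOf_eq {S : Finset X} {C : Finset (DiagramArc X O)} (hC : C ∈ L.circles S)
    {a : DiagramArc X O} : a ∈ C ↔ L.circleOf S a = C :=
  ⟨L.circleOf_eq_of_mem hC, fun h => h ▸ L.self_mem_circleOf S a⟩

theorem mem_unmarked {S : Finset X} {C : Finset (DiagramArc X O)} :
    C ∈ L.unmarked S ↔ C ∈ L.circles S ∧ L.mark ∉ C := by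
  simp [unmarked]

theorem circleOf_mem_unmarked {S : Finset X} {a : DiagramArc X O} :
    L.circleOf S a ∈ L.unmarked S ↔ ¬ L.Rel S a L.mark := by
  simp [mem_unmarked, circleOf_mem_circles, mem_circleOf]

/-! ### Areas -/

/-- A chain of adjacent faces leads from the marked point to `f`, and `n` counts mod 2 how often it
crosses each arc; the formula telescopes along the chain. -/
theorem exists_dualPath (f : F) : ∃ n : DiagramArc X O → ZMod 2, ∀ φ : F → ZMod 2,
    φ f = φ (L.left L.mark) + ∑ a, n a * (φ (L.left a) + φ (L.right a)) := by
  refine Relation.EqvGen.le_of_equivalence (s := fun g f => ∃ n : DiagramArc X O → ZMod 2,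
    ∀ φ : F → ZMod 2, φ f = φ g + ∑ a, n a * (φ (L.left a) + φ (L.right a))) ⟨?_, ?_, ?_⟩ ?_
    (L.connected (L.left L.mark) f)
  · exact fun f => ⟨0, by simp⟩
  · rintro f g ⟨n, hn⟩
    refine ⟨n, fun φ => ?_⟩
    rw [hn φ, add_assoc, CharTwo.add_self_eq_zero, add_zero]
  · rintro f g h ⟨n, hn⟩ ⟨m, hm⟩
    refine ⟨n + m, fun φ => ?_⟩
    rw [hm φ, hn φ]
    simp only [Pi.add_apply, add_mul, Finset.sum_add_distrib, add_assoc]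
  · rintro _ _ ⟨a, rfl, rfl⟩
    refine ⟨Pi.single a 1, fun φ => ?_⟩
    simp only [Pi.single_apply, ite_mul, one_mul, zero_mul, Finset.sum_ite_eq', Finset.mem_univ,
      if_true, ← add_assoc, CharTwo.add_self_eq_zero, zero_add]

/-- The parity with which a chosen path from the marked point to the face `f` crosses an arc. -/
def dualPath (f : F) : DiagramArc X O → ZMod 2 := (L.exists_dualPath f).choose

theorem dualPath_spec (f : F) (φ : F → ZMod 2) :
    φ f = φ (L.left L.mark) + ∑ a, L.dualPath f a * (φ (L.left a) + φ (L.right a)) :=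
  (L.exists_dualPath f).choose_spec φ

/-- The contribution of an arc to the area of the circles which pass through it. -/
def weight (a : DiagramArc X O) : L.faceRing :=
  ∑ f, MvPolynomial.C (L.dualPath f a) * MvPolynomial.X f

/-- The indicator function of the interior of a circle. -/
theorem exists_sideFunction {S : Finset X} {C : Finset (DiagramArc X O)} (hC : C ∈ L.circles S) :
    ∃ φ : F → ZMod 2, φ (L.left L.mark) = 0 ∧
      ∀ a, φ (L.left a) + φ (L.right a) = if a ∈ C then 1 else 0 := by
  -- The resolution pairs the four ends at every crossing, and paired ends lie on the same circle;
  -- hence the indicator of `C` is a cycle.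
  obtain ⟨φ, hφ⟩ := L.exists_potential (ψ := fun a => if a ∈ C then 1 else 0) <| by
    intro c
    have h : ∀ a b, L.JoinedAt S c a b → (a ∈ C ↔ b ∈ C) := by
      intro a b hab
      rw [L.mem_iff_circleOf_eq hC, L.mem_iff_circleOf_eq hC, L.circleOf_eq_iff.2 (hab.rel L)]
    have t := fun z : ZMod 2 => CharTwo.add_self_eq_zero z
    by_cases ho : L.Oriented S c
    · have h1 := h _ _ (Or.inl ⟨ho, Or.inl ⟨rfl, rfl⟩⟩)
      have h2 := h _ _ (Or.inl ⟨ho, Or.inr ⟨rfl, rfl⟩⟩)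
      simp only [boundarySum, Fintype.sum_bool, h1, h2]
      grind
    · have h1 := h _ _ (Or.inr ⟨ho, Or.inl ⟨rfl, rfl⟩⟩)
      have h2 := h _ _ (Or.inr ⟨ho, Or.inr ⟨rfl, rfl⟩⟩)
      simp only [boundarySum, Fintype.sum_bool, h1, h2]
      grind
  -- A potential is unique only up to a constant, which is fixed by the face at the marked point.
  refine ⟨fun f => φ f + φ (L.left L.mark), CharTwo.add_self_eq_zero _, fun a => ?_⟩
  rw [hφ a]
  have := CharTwo.add_self_eq_zero (φ (L.left L.mark))
  linear_combination this

/-- This is the Jordan curve theorem for circles of a resolution. The potential is constant on the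
components of the complement, it differs on the two sides of `C`, and there are no further
components. -/
theorem mem_interior_iff {S : Finset X} {C : Finset (DiagramArc X O)} (hC : C ∈ L.circles S)
    {φ : F → ZMod 2} (hmark : φ (L.left L.mark) = 0)
    (hφ : ∀ a, φ (L.left a) + φ (L.right a) = if a ∈ C then 1 else 0) (f : F) :
    f ∈ L.interior S C ↔ φ f = 1 := by
  have e : Equivalence (Relation.EqvGen (L.AdjacentOff S C)) := Relation.EqvGen.is_equivalence _
  have off : ∀ a, a ∉ C → φ (L.left a) = φ (L.right a) := by
    intro a ha
    have := hφ a
    rw [if_neg ha] at this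
    exact CharTwo.add_eq_zero.1 this
  have same : ∀ a b, a ∈ C → b ∈ C → φ (L.left a) + φ (L.right a) = φ (L.left b) + φ (L.right b) := by
    intro a b ha hb
    rw [hφ, hφ, if_pos ha, if_pos hb]
  have joined : ∀ a b, L.Joined S a b → (a ∈ C ↔ b ∈ C) := by
    intro a b hab
    rw [L.mem_iff_circleOf_eq hC, L.mem_iff_circleOf_eq hC,
      L.circleOf_eq_iff.2 (Relation.EqvGen.rel _ _ hab)]
  have inv : ∀ f g, Relation.EqvGen (L.AdjacentOff S C) f g → φ f = φ g := by
    intro f g h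
    refine Relation.EqvGen.le_of_equivalence (s := fun f g => φ f = φ g)
      ⟨fun _ => rfl, Eq.symm, Eq.trans⟩ ?_ h
    have crossing : ∀ a b, L.Joined S a b →
        φ (L.left a) + φ (L.right a) = φ (L.left b) + φ (L.right b) := by
      intro a b hab
      rw [hφ, hφ]
      simp only [joined a b hab]
    rintro _ _ (⟨a, ha, rfl, rfl⟩ | ⟨c, ⟨ho, rfl, rfl⟩ | ⟨ho, rfl, rfl⟩⟩)
    · exact off a ha
    · have := crossing (L.inc c false) (L.out c true) ⟨c, Or.inl ⟨ho, Or.inl ⟨rfl, rfl⟩⟩⟩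
      rw [L.west, ← L.north] at this
      exact (add_left_cancel this).symm
    · have := crossing (L.inc c false) (L.inc c true) ⟨c, Or.inr ⟨ho, Or.inl ⟨rfl, rfl⟩⟩⟩
      rw [L.south, add_comm] at this
      exact add_left_cancel this
  obtain ⟨a₀, rfl⟩ := L.mem_circles.1 hC
  -- Moving along the circle from arc to arc, each of its two sides continues into itself. At a
  -- crossing this uses the adjacency of the two opposite faces that the resolution connects. Left
  -- and right are interchanged when the circle traverses an arc against its orientation.
  have sides : ∀ a, a ∈ L.circleOf S a₀ →
      (Relation.EqvGen (L.AdjacentOff S (L.circleOf S a₀)) (L.left a₀) (L.left a) ∧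
        Relation.EqvGen (L.AdjacentOff S (L.circleOf S a₀)) (L.right a₀) (L.right a)) ∨
      (Relation.EqvGen (L.AdjacentOff S (L.circleOf S a₀)) (L.left a₀) (L.right a) ∧
        Relation.EqvGen (L.AdjacentOff S (L.circleOf S a₀)) (L.right a₀) (L.left a)) := by
    intro a ha
    rw [mem_circleOf] at ha
    refine (Relation.EqvGen.mem_iff (r := L.Joined S) (p := fun a =>
      (Relation.EqvGen (L.AdjacentOff S (L.circleOf S a₀)) (L.left a₀) (L.left a) ∧
        Relation.EqvGen (L.AdjacentOff S (L.circleOf S a₀)) (L.right a₀) (L.right a)) ∨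
      (Relation.EqvGen (L.AdjacentOff S (L.circleOf S a₀)) (L.left a₀) (L.right a) ∧
        Relation.EqvGen (L.AdjacentOff S (L.circleOf S a₀)) (L.right a₀) (L.left a))) ?_ ha).1
      (Or.inl ⟨e.refl _, e.refl _⟩)
    generalize L.circleOf S a₀ = C at *
    have trans_iff : ∀ f g h, Relation.EqvGen (L.AdjacentOff S C) g h →
        (Relation.EqvGen (L.AdjacentOff S C) f g ↔ Relation.EqvGen (L.AdjacentOff S C) f h) :=
      fun f g h k => ⟨fun l => e.trans l k, fun l => e.trans l (e.symm k)⟩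
    rintro _ _ ⟨c, ⟨ho, ⟨rfl, rfl⟩ | ⟨rfl, rfl⟩⟩ | ⟨ho, ⟨rfl, rfl⟩ | ⟨rfl, rfl⟩⟩⟩
    · have h : Relation.EqvGen (L.AdjacentOff S C) (L.left (L.out c false))
        (L.right (L.inc c false)) := Relation.EqvGen.rel _ _ (Or.inr ⟨c, Or.inl ⟨ho, rfl, rfl⟩⟩)
      rw [L.west, ← L.north, trans_iff _ _ _ (e.symm h), trans_iff _ _ _ (e.symm h)]
    · have h : Relation.EqvGen (L.AdjacentOff S C) (L.left (L.out c false))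
        (L.right (L.inc c false)) := Relation.EqvGen.rel _ _ (Or.inr ⟨c, Or.inl ⟨ho, rfl, rfl⟩⟩)
      rw [L.east, ← L.south, trans_iff _ _ _ h, trans_iff _ _ _ h]
    · have h : Relation.EqvGen (L.AdjacentOff S C) (L.left (L.inc c false))
        (L.right (L.inc c true)) := Relation.EqvGen.rel _ _ (Or.inr ⟨c, Or.inr ⟨ho, rfl, rfl⟩⟩)
      rw [L.south, trans_iff _ _ _ h, trans_iff _ _ _ h]
      tauto
    · have h : Relation.EqvGen (L.AdjacentOff S C) (L.left (L.inc c false))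
        (L.right (L.inc c true)) := Relation.EqvGen.rel _ _ (Or.inr ⟨c, Or.inr ⟨ho, rfl, rfl⟩⟩)
      rw [L.west, ← L.east] at h
      rw [L.north, trans_iff _ _ _ h, trans_iff _ _ _ h]
      tauto
  -- From any face, walking through arcs reaches the circle, and so one of its two sides.
  have two : ∀ g, Relation.EqvGen (L.AdjacentOff S (L.circleOf S a₀)) (L.left a₀) g ∨
      Relation.EqvGen (L.AdjacentOff S (L.circleOf S a₀)) (L.right a₀) g := by
    intro g
    refine (Relation.EqvGen.mem_iff (r := fun f g => ∃ a, f = L.left a ∧ g = L.right a)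
      (p := fun g => Relation.EqvGen (L.AdjacentOff S (L.circleOf S a₀)) (L.left a₀) g ∨
      Relation.EqvGen (L.AdjacentOff S (L.circleOf S a₀)) (L.right a₀) g) ?_
      (L.connected (L.left a₀) g)).1 (Or.inl (e.refl _))
    rintro _ _ ⟨a, rfl, rfl⟩
    by_cases ha : a ∈ L.circleOf S a₀
    · have := sides a ha
      tauto
    · have h : Relation.EqvGen (L.AdjacentOff S (L.circleOf S a₀)) (L.left a) (L.right a) :=
        Relation.EqvGen.rel _ _ (Or.inl ⟨a, ha, rfl, rfl⟩)
      exact ⟨Or.imp (fun k => e.trans k h) (fun k => e.trans k h),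
        Or.imp (fun k => e.trans k (e.symm h)) (fun k => e.trans k (e.symm h))⟩
  have h01 : ∀ z : ZMod 2, z ≠ 1 → z = 0 := by decide
  have hne : φ (L.left a₀) ≠ φ (L.right a₀) := by
    intro h
    have := hφ a₀
    rw [if_pos (L.self_mem_circleOf S a₀), h, CharTwo.add_self_eq_zero] at this
    exact zero_ne_one this
  simp only [interior, Finset.mem_filter, Finset.mem_univ, true_and]
  constructor
  · intro h
    by_contra hf
    have hf := h01 _ hf
    apply h
    rcases two f with h1 | h1 <;> rcases two (L.left L.mark) with h2 | h2
    · exact e.trans (e.symm h2) h1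
    · exact absurd ((inv _ _ h1).trans (hf.trans (hmark.symm.trans (inv _ _ h2).symm))) hne
    · exact absurd ((inv _ _ h2).trans (hmark.trans (hf.symm.trans (inv _ _ h1).symm))) hne
    · exact e.trans (e.symm h2) h1
  · intro h1 h
    have := inv _ _ h
    rw [hmark, h1] at this
    exact zero_ne_one this

/-- The path to the face `f` crosses `C` an odd number of times exactly if `f` is inside. The
weights do not refer to `S`, so areas automatically add when circles merge; this is what makes `∂_𝒱`
compatible with the edge maps. -/
theorem area_eq_sum_weight {S : Finset X} {C : Finset (DiagramArc X O)} (hC : C ∈ L.circles S) :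
    L.area S C = ∑ a ∈ C, L.weight a := by
  obtain ⟨φ, hmark, hφ⟩ := L.exists_sideFunction hC
  have h1 : ∀ f, ∑ a ∈ C, L.dualPath f a = φ f := by
    intro f
    rw [L.dualPath_spec f φ, hmark, zero_add]
    simp only [hφ, mul_ite, mul_one, mul_zero]
    rw [Finset.sum_ite_mem, Finset.univ_inter]
  have h01 : ∀ z : ZMod 2, z ≠ 1 → z = 0 := by decide
  simp only [weight]
  rw [Finset.sum_comm]
  simp only [← Finset.sum_mul, ← map_sum, h1]
  rw [area, ← Finset.sum_subset (Finset.subset_univ (L.interior S C))]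
  · refine Finset.sum_congr rfl fun f hf => ?_
    rw [(L.mem_interior_iff hC hmark hφ f).1 hf, map_one, one_mul]
  · intro f _ hf
    rw [h01 _ (fun h => hf ((L.mem_interior_iff hC hmark hφ f).2 h)), map_zero, zero_mul]

/-- The potential takes the value `1` on one side of any arc of `C`, so some face variable occurs in
the area with coefficient `1`. Gaussian elimination divides by these areas. -/
theorem area_ne_zero {S : Finset X} {C : Finset (DiagramArc X O)} (hC : C ∈ L.circles S) :
    L.area S C ≠ 0 := by
  obtain ⟨φ, hmark, hφ⟩ := L.exists_sideFunction hC
  obtain ⟨a, rfl⟩ := L.mem_circles.1 hC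
  have h01 : ∀ z w : ZMod 2, z + w = 1 → z = 1 ∨ w = 1 := by decide
  have ha := hφ a
  rw [if_pos (L.self_mem_circleOf S a)] at ha
  obtain ⟨f, hf⟩ : ∃ f, f ∈ L.interior S (L.circleOf S a) := by
    rcases h01 _ _ ha with h | h
    exacts [⟨_, (L.mem_interior_iff hC hmark hφ _).2 h⟩, ⟨_, (L.mem_interior_iff hC hmark hφ _).2 h⟩]
  intro h
  have := congrArg (MvPolynomial.coeff (Finsupp.single f 1)) h
  simp only [area, MvPolynomial.coeff_sum, MvPolynomial.coeff_X, MvPolynomial.coeff_zero,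
    Finsupp.single_left_inj one_ne_zero] at this
  rw [Finset.sum_ite_eq', if_pos hf] at this
  exact one_ne_zero this

end LinkDiagram
end

noncomputable section

open scoped Classical

namespace LinkDiagram

variable {X O F : Type u} [Fintype X] [Fintype O] [Fintype F] (L : LinkDiagram X O F)

/-! ### The circles at a crossing -/

section Merges

variable {L} {c : X} {S S' : Finset X} {a b : DiagramArc X O} (h : L.Merges c S S' a b)
include h

theorem Merges.circleOf_eq (x : DiagramArc X O) (ha : ¬ L.Rel S a x) (hb : ¬ L.Rel S b x) :
    L.circleOf S' x = L.circleOf S x := by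
  ext y
  rw [mem_circleOf, mem_circleOf, h.rel_iff]
  tauto

theorem Merges.rel_of_rel {x y : DiagramArc X O} (hxy : L.Rel S x y) : L.Rel S' x y :=
  (h.rel_iff x y).2 (Or.inl hxy)

theorem Merges.rel_merged {x : DiagramArc X O} : L.Rel S' a x ↔ L.Rel S a x ∨ L.Rel S b x := by
  have e := L.rel_equivalence S
  rw [h.rel_iff]
  have := e.refl a
  tauto

theorem Merges.circleOf_right : L.circleOf S' b = L.circleOf S' a :=
  L.circleOf_eq_iff.2 ((L.rel_equivalence S').symm (h.rel_merged.2 (Or.inr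
    ((L.rel_equivalence S).refl b))))

theorem Merges.circlesAt_fine : L.circlesAt S c = {L.circleOf S a, L.circleOf S b} := by
  ext C
  simp only [circlesAt, Finset.mem_filter, Finset.mem_insert, Finset.mem_singleton]
  constructor
  · rintro ⟨hC, x, hx, ht⟩
    rw [← L.circleOf_eq_of_mem hC hx, L.circleOf_eq_iff, L.circleOf_eq_iff]
    exact (h.rel_or_rel x ht).imp (L.rel_equivalence S).symm (L.rel_equivalence S).symm
  · rintro (rfl | rfl)
    · exact ⟨L.circleOf_mem_circles S a, a, L.self_mem_circleOf S a, h.touches_left⟩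
    · exact ⟨L.circleOf_mem_circles S b, b, L.self_mem_circleOf S b, h.touches_right⟩

theorem Merges.rel_coarse {x y : DiagramArc X O} (hx : L.Touches c x) (hy : L.Touches c y) :
    L.Rel S' x y :=
  (h.rel_iff x y).2 (Or.inr ⟨h.rel_or_rel x hx, h.rel_or_rel y hy⟩)

theorem Merges.circlesAt_coarse : L.circlesAt S' c = {L.circleOf S' a} := by
  ext C
  simp only [circlesAt, Finset.mem_filter, Finset.mem_singleton]
  constructor
  · rintro ⟨hC, x, hx, ht⟩
    rw [← L.circleOf_eq_of_mem hC hx, L.circleOf_eq_iff]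
    exact h.rel_coarse ht h.touches_left
  · rintro rfl
    exact ⟨L.circleOf_mem_circles S' a, a, L.self_mem_circleOf S' a, h.touches_left⟩

theorem Merges.circleOf_ne : L.circleOf S a ≠ L.circleOf S b :=
  fun e => h.not_rel (L.circleOf_eq_iff.1 e)

/-- The circles away from the crossing are the same in both resolutions. -/
theorem Merges.circles_iff (C : Finset (DiagramArc X O)) :
    (C ∈ L.circles S ∧ C ≠ L.circleOf S a ∧ C ≠ L.circleOf S b) ↔
      (C ∈ L.circles S' ∧ C ≠ L.circleOf S' a) := by
  constructor
  · rintro ⟨hC, ha, hb⟩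
    obtain ⟨x, rfl⟩ := L.mem_circles.1 hC
    rw [Ne, eq_comm, L.circleOf_eq_iff] at ha hb
    rw [← h.circleOf_eq x ha hb]
    refine ⟨L.circleOf_mem_circles S' x, ?_⟩
    rw [Ne, eq_comm, L.circleOf_eq_iff, h.rel_merged]
    tauto
  · rintro ⟨hC, ha⟩
    obtain ⟨x, rfl⟩ := L.mem_circles.1 hC
    rw [Ne, eq_comm, L.circleOf_eq_iff, h.rel_merged, not_or] at ha
    rw [h.circleOf_eq x ha.1 ha.2]
    refine ⟨L.circleOf_mem_circles S x, ?_⟩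
    rw [Ne, eq_comm, L.circleOf_eq_iff, Ne, eq_comm, L.circleOf_eq_iff]
    exact ha

theorem Merges.mem_circleOf_coarse {x : DiagramArc X O} :
    x ∈ L.circleOf S' a ↔ x ∈ L.circleOf S a ∨ x ∈ L.circleOf S b := by
  simp only [mem_circleOf, h.rel_merged]

theorem Merges.coarse_notMem_circles : L.circleOf S' a ∉ L.circles S := by
  intro hC
  have h1 := L.circleOf_eq_of_mem hC (L.self_mem_circleOf S' a)
  have h2 := L.circleOf_eq_of_mem hC (h.mem_circleOf_coarse.2 (Or.inr (L.self_mem_circleOf S b)))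
  exact h.circleOf_ne (h1.trans h2.symm)

theorem Merges.left_notMem_circles : L.circleOf S a ∉ L.circles S' := by
  intro hC
  have h1 := L.circleOf_eq_of_mem hC (L.self_mem_circleOf S a)
  have : b ∈ L.circleOf S a := h1 ▸ h.mem_circleOf_coarse.2 (Or.inr (L.self_mem_circleOf S b))
  exact h.not_rel (L.mem_circleOf.1 this)

theorem Merges.right_notMem_circles : L.circleOf S b ∉ L.circles S' := by
  intro hC
  have h1 := L.circleOf_eq_of_mem hC (L.self_mem_circleOf S b)
  rw [h.circleOf_right] at h1
  have : a ∈ L.circleOf S b := h1 ▸ h.mem_circleOf_coarse.2 (Or.inl (L.self_mem_circleOf S a))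
  exact h.not_rel ((L.rel_equivalence S).symm (L.mem_circleOf.1 this))

theorem Merges.coarse_mem_unmarked : L.circleOf S' a ∈ L.unmarked S' ↔
    L.circleOf S a ∈ L.unmarked S ∧ L.circleOf S b ∈ L.unmarked S := by
  simp only [circleOf_mem_unmarked, h.rel_merged, not_or]

/-- The unmarked circles away from the crossing are the same in both resolutions. -/
theorem Merges.unmarked_iff (C : Finset (DiagramArc X O)) :
    (C ∈ L.unmarked S ∧ C ≠ L.circleOf S a ∧ C ≠ L.circleOf S b) ↔
      (C ∈ L.unmarked S' ∧ C ≠ L.circleOf S' a) := by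
  have := h.circles_iff C
  simp only [mem_unmarked]
  tauto

theorem Merges.card_circles : (L.circles S).card = (L.circles S').card + 1 := by
  have h1 : ((L.circles S).erase (L.circleOf S a)).erase (L.circleOf S b) =
      (L.circles S').erase (L.circleOf S' a) := by
    ext C
    have := h.circles_iff C
    simp only [Finset.mem_erase]
    tauto
  have h2 := congrArg Finset.card h1
  have ha := L.circleOf_mem_circles S a
  have hb : L.circleOf S b ∈ (L.circles S).erase (L.circleOf S a) :=
    Finset.mem_erase.2 ⟨h.circleOf_ne.symm, L.circleOf_mem_circles S b⟩
  have ha' := L.circleOf_mem_circles S' a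
  rw [Finset.card_erase_of_mem hb, Finset.card_erase_of_mem ha, Finset.card_erase_of_mem ha'] at h2
  have h3 : 1 < (L.circles S).card :=
    Finset.one_lt_card.2 ⟨_, ha, _, L.circleOf_mem_circles S b, h.circleOf_ne⟩
  have h4 := Finset.card_pos.2 ⟨_, ha'⟩
  omega

end Merges

/-! ### Basis vectors and linear maps -/

variable (K : Type*) [CommRing K]

/-- The basis vector of the resolution `L_S` with the circles in `P` labelled `v₊`. -/
def st (S : Finset X) (P : Finset (Finset (DiagramArc X O))) : L.PureState → K :=
  fun y => if y.1 = (S, P) then 1 else 0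

theorem st_eq_single {S : Finset X} {P : Finset (Finset (DiagramArc X O))}
    (hP : P ⊆ L.unmarked S) : L.st K S P = Pi.single (⟨(S, P), hP⟩ : L.PureState) 1 := by
  funext y
  simp [st, Pi.single_apply, Subtype.ext_iff]

theorem single_eq_st (x : L.PureState) : Pi.single x 1 = L.st K x.1.1 x.1.2 :=
  (L.st_eq_single K x.2).symm

variable {K} in
theorem hom_ext {M : Type*} [AddCommGroup M] [Module K M] {f g : (L.PureState → K) →ₗ[K] M}
    (h : ∀ S P, P ⊆ L.unmarked S → f (L.st K S P) = g (L.st K S P)) : f = g := by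
  refine (Pi.basisFun K L.PureState).ext fun x => ?_
  rw [Pi.basisFun_apply, single_eq_st]
  exact h _ _ x.2

variable {K} in
/-- The linear map with given values on the basis. -/
def ofBasis {M : Type*} [AddCommGroup M] [Module K M] (v : L.PureState → M) :
    (L.PureState → K) →ₗ[K] M := (Pi.basisFun K L.PureState).constr K v

theorem ofBasis_st {M : Type*} [AddCommGroup M] [Module K M] (v : L.PureState → M) {S : Finset X}
    {P : Finset (Finset (DiagramArc X O))} (hP : P ⊆ L.unmarked S) :
    L.ofBasis v (L.st K S P) = v ⟨(S, P), hP⟩ := by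
  rw [st_eq_single L K hP, ← Pi.basisFun_apply, ofBasis, Module.Basis.constr_basis]

/-- Multiplication by the generator of the Frobenius algebra of the circle through the arc `a`:
it changes the label `v₊` of this circle to `v₋`. -/
def dot (a : DiagramArc X O) : (L.PureState → K) →ₗ[K] (L.PureState → K) :=
  L.ofBasis fun x => if L.circleOf x.1.1 a ∈ x.1.2 then
    L.st K x.1.1 (x.1.2.erase (L.circleOf x.1.1 a)) else 0

theorem dot_st (a : DiagramArc X O) {S : Finset X} {P : Finset (Finset (DiagramArc X O))}
    (hP : P ⊆ L.unmarked S) : L.dot K a (L.st K S P) =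
      if L.circleOf S a ∈ P then L.st K S (P.erase (L.circleOf S a)) else 0 :=
  L.ofBasis_st K _ hP

theorem dot_comm (a b : DiagramArc X O) : L.dot K a ∘ₗ L.dot K b = L.dot K b ∘ₗ L.dot K a := by
  refine L.hom_ext fun S P hP => ?_
  have ha : P.erase (L.circleOf S a) ⊆ L.unmarked S := (Finset.erase_subset _ _).trans hP
  have hb : P.erase (L.circleOf S b) ⊆ L.unmarked S := (Finset.erase_subset _ _).trans hP
  simp only [LinearMap.comp_apply, dot_st L K _ hP, apply_ite (L.dot K a), apply_ite (L.dot K b),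
    dot_st L K _ ha, dot_st L K _ hb, map_zero, Finset.mem_erase,
    Finset.erase_right_comm (a := L.circleOf S a) (b := L.circleOf S b)]
  by_cases h : L.circleOf S a = L.circleOf S b
  · simp [h]
  · by_cases h1 : L.circleOf S a ∈ P <;> by_cases h2 : L.circleOf S b ∈ P <;>
      simp [h, h1, h2, Ne.symm h]

theorem dot_dot (a : DiagramArc X O) : L.dot K a ∘ₗ L.dot K a = 0 := by
  refine L.hom_ext fun S P hP => ?_
  have ha : P.erase (L.circleOf S a) ⊆ L.unmarked S := (Finset.erase_subset _ _).trans hP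
  simp [dot_st L K _ hP, apply_ite (L.dot K a), dot_st L K _ ha]

/-- The basis vector of `L_S` with all unmarked circles labelled `v₊`. -/
def top (S : Finset X) : L.PureState → K := L.st K S (L.unmarked S)

theorem dot_top_congr {S : Finset X} {a b : DiagramArc X O} (h : L.Rel S a b) :
    L.dot K a (L.top K S) = L.dot K b (L.top K S) := by
  rw [top, dot_st L K _ subset_rfl, dot_st L K _ subset_rfl, L.circleOf_eq_iff.2 h]

variable {K} in
/-- The basis vectors are obtained from the vectors `top S` by applying the operators `dot`. -/
theorem st_induction {p : Finset X → (L.PureState → K) → Prop} {S : Finset X}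
    (htop : p S (L.top K S))
    (hdot : ∀ a P, P ⊆ L.unmarked S → L.circleOf S a ∈ P → p S (L.st K S P) →
      p S (L.dot K a (L.st K S P)))
    {P : Finset (Finset (DiagramArc X O))} (hP : P ⊆ L.unmarked S) : p S (L.st K S P) := by
  induction hn : (L.unmarked S \ P).card generalizing P with
  | zero =>
    rw [Finset.card_eq_zero, Finset.sdiff_eq_empty_iff_subset] at hn
    rw [hP.antisymm hn]
    exact htop
  | succ n ih =>
    obtain ⟨C, hC⟩ := Finset.card_pos.1 (by omega : 0 < (L.unmarked S \ P).card)
    obtain ⟨hC1, hC2⟩ := Finset.mem_sdiff.1 hC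
    obtain ⟨a, rfl⟩ := L.mem_circles.1 (L.mem_unmarked.1 hC1).1
    have hsub : insert (L.circleOf S a) P ⊆ L.unmarked S := Finset.insert_subset hC1 hP
    have hmem := Finset.mem_insert_self (L.circleOf S a) P
    have := hdot a _ hsub hmem <| ih hsub <| by
      rw [Finset.sdiff_insert, Finset.card_erase_of_mem hC, hn, Nat.add_sub_cancel]
    rwa [dot_st L K a hsub, if_pos hmem, Finset.erase_insert hC2] at this

variable {K} in
-- The complex is generated by the vectors `top S` under the operators `dot`, so operators that
-- commute with these are determined by their values on the `top S`.
theorem hom_ext_top {f g : (L.PureState → K) →ₗ[K] (L.PureState → K)}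
    (hf : ∀ a, f ∘ₗ L.dot K a = L.dot K a ∘ₗ f) (hg : ∀ a, g ∘ₗ L.dot K a = L.dot K a ∘ₗ g)
    (h : ∀ S, f (L.top K S) = g (L.top K S)) : f = g := by
  refine L.hom_ext fun S P hP => L.st_induction (p := fun _ v => f v = g v) (h S) ?_ hP
  intro a P _ _ hPfg
  rw [← LinearMap.comp_apply, hf, ← LinearMap.comp_apply, hg, LinearMap.comp_apply,
    LinearMap.comp_apply, hPfg]

/-! ### The edges of the cube of resolutions -/

/-- The pure state `y` occurs in the Khovanov differential of `x` at the crossing `c`. -/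
def IncidentAt (c : X) (x y : L.PureState) : Prop :=
  c ∉ x.1.1 ∧ y.1.1 = insert c x.1.1 ∧
    x.1.2 \ L.circlesAt x.1.1 c = y.1.2 \ L.circlesAt y.1.1 c ∧
    ((∃ C₁ C₂ C, C₁ ≠ C₂ ∧ L.circlesAt x.1.1 c = {C₁, C₂} ∧ L.circlesAt y.1.1 c = {C} ∧
        muRule (decide (C₁ ∈ x.1.2)) (decide (C₂ ∈ x.1.2)) (decide (C ∈ y.1.2)) = true) ∨
     (∃ C C₁ C₂, C₁ ≠ C₂ ∧ L.circlesAt x.1.1 c = {C} ∧ L.circlesAt y.1.1 c = {C₁, C₂} ∧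
        deltaRule (decide (C ∈ x.1.2)) (decide (C₁ ∈ y.1.2)) (decide (C₂ ∈ y.1.2)) = true))

/-- The part of the Khovanov differential that changes the resolution at the crossing `c`. -/
def edge (c : X) : (L.PureState → K) →ₗ[K] (L.PureState → K) :=
  L.ofBasis fun x y => if L.IncidentAt c x y then 1 else 0

/-- The crossing is recovered from the two resolutions as the one that was added, so at most one
summand contributes to a matrix entry. -/
theorem khovanovDiff_eq_sum : L.khovanovDiff K = ∑ c, L.edge K c := by
  refine L.hom_ext fun S P hP => funext fun y => ?_
  rw [LinearMap.sum_apply, Finset.sum_apply]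
  simp only [edge, ofBasis_st L K _ hP]
  rw [st_eq_single L K hP, khovanovDiff, Matrix.mulVecLin_apply, Matrix.mulVec_single_one]
  simp only [Matrix.col_apply, Matrix.of_apply]
  by_cases h : L.KhovanovIncident ⟨(S, P), hP⟩ y
  · rw [if_pos h]
    obtain ⟨c, hc⟩ := h
    rw [Finset.sum_eq_single_of_mem c (Finset.mem_univ c),
      if_pos (show L.IncidentAt c _ y from hc)]
    intro d _ hd
    refine if_neg fun hd' => hd ?_
    have h1 : insert d S = insert c S := hd'.2.1.symm.trans hc.2.1
    have h2 : d ∈ insert c S := h1 ▸ Finset.mem_insert_self d S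
    exact (Finset.mem_insert.1 h2).resolve_right hd'.1
  · rw [if_neg h]
    exact (Finset.sum_eq_zero fun c _ => if_neg fun hc => h ⟨c, hc⟩).symm

theorem edge_st_of_mem {c : X} {S : Finset X} (hc : c ∈ S)
    {P : Finset (Finset (DiagramArc X O))} (hP : P ⊆ L.unmarked S) :
    L.edge K c (L.st K S P) = 0 := by
  rw [edge, ofBasis_st L K _ hP]
  exact funext fun y => if_neg fun h => h.1 hc

end LinkDiagram
end

/-! ### Explicit formulas for the edge maps -/

noncomputable section

open scoped Classical

namespace LinkDiagram

variable {X O F : Type u} [Fintype X] [Fintype O] [Fintype F] {L : LinkDiagram X O F}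

section Finset

variable {α : Type*} [DecidableEq α] {A B U : α} {P P' : Finset α}

/-- This and the following lemmas solve the incidence conditions for the new label set `P'`. A
circle created at the crossing does not belong to the old label set, which gives the hypotheses of
non-membership. -/
theorem sdiff_eq_and_mem_iff (hU : U ∉ P) :
    (P \ {A, B} = P' \ {U} ∧ U ∈ P') ↔ P' = insert U (P \ {A, B}) := by
  simp only [Finset.ext_iff]
  grind

theorem sdiff_eq_and_notMem_iff (hU : U ∉ P) :
    (P \ {A, B} = P' \ {U} ∧ U ∉ P') ↔ P' = P \ {A, B} := by
  simp only [Finset.ext_iff]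
  grind

theorem sdiff_eq_and_mem_left_iff (hA : A ∉ P) (hB : B ∉ P) (hne : A ≠ B) :
    (P \ {U} = P' \ {A, B} ∧ A ∈ P' ∧ B ∉ P') ↔ P' = insert A (P \ {U}) := by
  simp only [Finset.ext_iff]
  grind

theorem sdiff_eq_and_mem_right_iff (hA : A ∉ P) (hB : B ∉ P) (hne : A ≠ B) :
    (P \ {U} = P' \ {A, B} ∧ A ∉ P' ∧ B ∈ P') ↔ P' = insert B (P \ {U}) := by
  simp only [Finset.ext_iff]
  grind

theorem sdiff_eq_and_notMem_both_iff (hA : A ∉ P) (hB : B ∉ P) :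
    (P \ {U} = P' \ {A, B} ∧ A ∉ P' ∧ B ∉ P') ↔ P' = P \ {U} := by
  simp only [Finset.ext_iff]
  grind

theorem insert_erase_sdiff {T : Finset α} {D : α} (h : D ≠ U) :
    insert U (P.erase D \ T) = (insert U (P \ T)).erase D := by
  simp only [Finset.ext_iff]
  grind

theorem erase_sdiff_eq {T : Finset α} {D : α} : P.erase D \ T = (P \ T).erase D := by
  simp only [Finset.ext_iff]
  grind

theorem erase_sdiff_of_mem {T : Finset α} {D : α} (h : D ∈ T) : P.erase D \ T = P \ T := by
  simp only [Finset.ext_iff]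
  grind

theorem erase_sdiff_eq_erase_sdiff {T : Finset α} {D : α} (h : D ∈ T) (hU : U ∉ P) :
    P.erase D \ T = (P \ T).erase U := by
  simp only [Finset.ext_iff]
  grind

end Finset

/-- The circles at `c` are known, which determines the existentially quantified ones up to the order
of the pair; `muRule` is symmetric. The alternative with `Δ` fails because the number of circles at
`c` is wrong. -/
theorem incidentAt_of_merges {c : X} {a b : DiagramArc X O} {x y : L.PureState} (hc : c ∉ x.1.1)
    (hy : y.1.1 = insert c x.1.1) (h : L.Merges c x.1.1 y.1.1 a b) :
    L.IncidentAt c x y ↔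
      x.1.2 \ {L.circleOf x.1.1 a, L.circleOf x.1.1 b} = y.1.2 \ {L.circleOf y.1.1 a} ∧
      muRule (decide (L.circleOf x.1.1 a ∈ x.1.2)) (decide (L.circleOf x.1.1 b ∈ x.1.2))
        (decide (L.circleOf y.1.1 a ∈ y.1.2)) = true := by
  have symm : ∀ i j k, muRule i j k = muRule j i k := by decide
  have hcard := Finset.card_pair h.circleOf_ne
  simp only [IncidentAt, hc, not_false_eq_true, hy, true_and]
  rw [← hy, h.circlesAt_fine, h.circlesAt_coarse]
  refine and_congr_right fun _ => ⟨?_, fun hr => Or.inl ⟨_, _, _, h.circleOf_ne, rfl, rfl, hr⟩⟩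
  rintro (⟨C₁, C₂, C, hne, h1, h2, hr⟩ | ⟨C, C₁, C₂, hne, h1, h2, hr⟩)
  · rw [← Finset.singleton_injective h2] at hr
    rw [← Finset.coe_inj, Finset.coe_pair, Finset.coe_pair, Set.pair_eq_pair_iff] at h1
    rcases h1 with ⟨h1, h1'⟩ | ⟨h1, h1'⟩
    · rw [h1, h1']
      exact hr
    · rw [h1, h1', symm]
      exact hr
  · rw [h1, Finset.card_singleton] at hcard
    omega

theorem incidentAt_of_divides {c : X} {a b : DiagramArc X O} {x y : L.PureState} (hc : c ∉ x.1.1)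
    (hy : y.1.1 = insert c x.1.1) (h : L.Merges c y.1.1 x.1.1 a b) :
    L.IncidentAt c x y ↔
      x.1.2 \ {L.circleOf x.1.1 a} = y.1.2 \ {L.circleOf y.1.1 a, L.circleOf y.1.1 b} ∧
      deltaRule (decide (L.circleOf x.1.1 a ∈ x.1.2)) (decide (L.circleOf y.1.1 a ∈ y.1.2))
        (decide (L.circleOf y.1.1 b ∈ y.1.2)) = true := by
  have symm : ∀ i j k, deltaRule i j k = deltaRule i k j := by decide
  have hcard := Finset.card_pair h.circleOf_ne
  simp only [IncidentAt, hc, not_false_eq_true, hy, true_and]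
  rw [← hy, h.circlesAt_fine, h.circlesAt_coarse]
  refine and_congr_right fun _ => ⟨?_, fun hr => Or.inr ⟨_, _, _, h.circleOf_ne, rfl, rfl, hr⟩⟩
  rintro (⟨C₁, C₂, C, hne, h1, h2, hr⟩ | ⟨C, C₁, C₂, hne, h1, h2, hr⟩)
  · rw [h2, Finset.card_singleton] at hcard
    omega
  · rw [← Finset.singleton_injective h1] at hr
    rw [← Finset.coe_inj, Finset.coe_pair, Finset.coe_pair, Set.pair_eq_pair_iff] at h2
    rcases h2 with ⟨h2, h2'⟩ | ⟨h2, h2'⟩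
    · rw [h2, h2']
      exact hr
    · rw [h2, h2', symm]
      exact hr

theorem notMem_of_notMem_circles {S : Finset X} {C : Finset (DiagramArc X O)}
    {P : Finset (Finset (DiagramArc X O))} (hP : P ⊆ L.unmarked S) (hC : C ∉ L.circles S) :
    C ∉ P := fun h => hC (L.mem_unmarked.1 (hP h)).1

variable (K : Type*) [CommRing K]

/-- The marked circle never belongs to `P`, so it is treated as `v₋` without a separate case. The
last case is `v₋ ⊗ v₋ ↦ 0`. -/
theorem Merges.edge_st {c : X} {S : Finset X} {a b : DiagramArc X O}
    (h : L.Merges c S (insert c S) a b) (hc : c ∉ S) {P : Finset (Finset (DiagramArc X O))}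
    (hP : P ⊆ L.unmarked S) :
    L.edge K c (L.st K S P) =
      if L.circleOf S a ∈ P ∧ L.circleOf S b ∈ P then
        L.st K (insert c S)
          (insert (L.circleOf (insert c S) a) (P \ {L.circleOf S a, L.circleOf S b}))
      else if L.circleOf S a ∈ P ∨ L.circleOf S b ∈ P then
        L.st K (insert c S) (P \ {L.circleOf S a, L.circleOf S b})
      else 0 := by
  rw [edge, ofBasis_st L K _ hP]
  funext y
  obtain ⟨⟨S', P'⟩, hP'⟩ := y
  by_cases hS' : S' = insert c S
  · subst hS'
    rw [incidentAt_of_merges hc rfl h]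
    have hU := notMem_of_notMem_circles hP h.coarse_notMem_circles
    generalize L.circleOf S a = A at *
    generalize L.circleOf S b = B at *
    generalize L.circleOf (insert c S) a = U at *
    have mu : ∀ i j k, muRule i j k = true ↔ (i = true ∧ j = true) ∧ k = true ∨
      ¬ (i = true ∧ j = true) ∧ (i = true ∨ j = true) ∧ ¬ k = true := by decide
    rw [mu]
    simp only [decide_eq_true_eq]
    by_cases h1 : A ∈ P ∧ B ∈ P
    · simp only [h1, st, not_true_eq_false, false_and, or_false, and_self, true_and, if_true,
        Prod.mk.injEq, sdiff_eq_and_mem_iff hU]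
    · by_cases h2 : A ∈ P ∨ B ∈ P
      · simp only [h1, h2, st, not_false_eq_true, false_and, false_or, true_and, if_true, if_false,
          Prod.mk.injEq, sdiff_eq_and_notMem_iff hU]
      · simp [h1, h2]
  · rw [if_neg fun hi => hS' hi.2.1]
    split_ifs <;> simp [st, hS']

theorem Merges.edge_st_divide {c : X} {S : Finset X} {a b : DiagramArc X O}
    (h : L.Merges c (insert c S) S a b) (hc : c ∉ S) {P : Finset (Finset (DiagramArc X O))}
    (hP : P ⊆ L.unmarked S) :
    L.edge K c (L.st K S P) =
      if L.circleOf S a ∈ P then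
        L.st K (insert c S) (insert (L.circleOf (insert c S) a) (P \ {L.circleOf S a})) +
        L.st K (insert c S) (insert (L.circleOf (insert c S) b) (P \ {L.circleOf S a}))
      else L.st K (insert c S) (P \ {L.circleOf S a}) := by
  rw [edge, ofBasis_st L K _ hP]
  funext y
  obtain ⟨⟨S', P'⟩, hP'⟩ := y
  by_cases hS' : S' = insert c S
  · subst hS'
    rw [incidentAt_of_divides hc rfl h]
    have hA := notMem_of_notMem_circles hP h.left_notMem_circles
    have hB := notMem_of_notMem_circles hP h.right_notMem_circles
    have hne := h.circleOf_ne
    generalize L.circleOf S a = U at *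
    generalize L.circleOf (insert c S) b = B at *
    generalize L.circleOf (insert c S) a = A at *
    have delta : ∀ i j k, deltaRule i j k = true ↔
        i = true ∧ (j = true ∧ ¬ k = true ∨ ¬ j = true ∧ k = true) ∨
        ¬ i = true ∧ ¬ j = true ∧ ¬ k = true := by decide
    rw [delta]
    simp only [decide_eq_true_eq]
    by_cases h1 : U ∈ P
    -- The two terms of `Δ v₊` are different basis vectors, so the indicator of the disjunction is
    -- the sum of the indicators.
    · have hne' : insert A (P \ {U}) ≠ insert B (P \ {U}) := by
        intro e
        have := e ▸ Finset.mem_insert_self A (P \ {U})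
        simp [hne, hA] at this
      simp only [h1, st, not_true_eq_false, false_and, or_false, true_and, if_true,
        Pi.add_apply, Prod.mk.injEq, and_or_left, sdiff_eq_and_mem_left_iff hA hB hne,
        sdiff_eq_and_mem_right_iff hA hB hne]
      by_cases e : P' = insert A (P \ {U})
      · simp [e, hne']
      · simp [e]
    · simp only [h1, st, not_false_eq_true, false_and, false_or, true_and, if_false,
        Prod.mk.injEq, sdiff_eq_and_notMem_both_iff hA hB]
  · rw [if_neg fun hi => hS' hi.2.1]
    split_ifs <;> simp [st, hS']

theorem Merges.sdiff_subset_coarse {c : X} {S S' : Finset X} {a b : DiagramArc X O}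
    (h : L.Merges c S S' a b) {P : Finset (Finset (DiagramArc X O))} (hP : P ⊆ L.unmarked S) :
    P \ {L.circleOf S a, L.circleOf S b} ⊆ L.unmarked S' := by
  intro C hC
  simp only [Finset.mem_sdiff, Finset.mem_insert, Finset.mem_singleton, not_or] at hC
  exact ((h.unmarked_iff C).1 ⟨hP hC.1, hC.2⟩).1

theorem Merges.sdiff_subset_fine {c : X} {S S' : Finset X} {a b : DiagramArc X O}
    (h : L.Merges c S S' a b) {P : Finset (Finset (DiagramArc X O))} (hP : P ⊆ L.unmarked S') :
    P \ {L.circleOf S' a} ⊆ L.unmarked S := by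
  intro C hC
  simp only [Finset.mem_sdiff, Finset.mem_singleton] at hC
  exact ((h.unmarked_iff C).2 ⟨hP hC.1, hC.2⟩).1

/-- The circle through an arc in two resolutions which differ by merging two circles. -/
theorem Merges.circleOf_cases {c : X} {S S' : Finset X} {a b : DiagramArc X O}
    (h : L.Merges c S S' a b) (x : DiagramArc X O) :
    (L.circleOf S x = L.circleOf S a ∧ L.circleOf S' x = L.circleOf S' a) ∨
      (L.circleOf S x = L.circleOf S b ∧ L.circleOf S' x = L.circleOf S' a) ∨
      (L.circleOf S x ≠ L.circleOf S a ∧ L.circleOf S x ≠ L.circleOf S b ∧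
        L.circleOf S x ≠ L.circleOf S' a ∧ L.circleOf S' x = L.circleOf S x) := by
  by_cases ha : L.Rel S a x
  · exact Or.inl ⟨(L.circleOf_eq_iff.2 ha).symm, (L.circleOf_eq_iff.2 (h.rel_of_rel ha)).symm⟩
  by_cases hb : L.Rel S b x
  · refine Or.inr (Or.inl ⟨(L.circleOf_eq_iff.2 hb).symm, ?_⟩)
    rw [← h.circleOf_right]
    exact (L.circleOf_eq_iff.2 (h.rel_of_rel hb)).symm
  · refine Or.inr (Or.inr ⟨?_, ?_, ?_, h.circleOf_eq x ha hb⟩)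
    · exact fun e => ha (L.circleOf_eq_iff.1 e.symm)
    · exact fun e => hb (L.circleOf_eq_iff.1 e.symm)
    · exact fun e => h.coarse_notMem_circles (e ▸ L.circleOf_mem_circles S x)

/-- The product `μ` is linear over the Frobenius algebra. The arc `x` lies on one of the two merging
circles or on a circle away from the crossing. -/
theorem Merges.edge_comm_dot {c : X} {S : Finset X} {a b : DiagramArc X O}
    (h : L.Merges c S (insert c S) a b) (hc : c ∉ S) (x : DiagramArc X O)
    {P : Finset (Finset (DiagramArc X O))} (hP : P ⊆ L.unmarked S) :
    L.edge K c (L.dot K x (L.st K S P)) = L.dot K x (L.edge K c (L.st K S P)) := by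
  have hPx : P.erase (L.circleOf S x) ⊆ L.unmarked S := (Finset.erase_subset _ _).trans hP
  have hQ := h.sdiff_subset_coarse hP
  rw [dot_st L K x hP, apply_ite (L.edge K c), map_zero, h.edge_st K hc hP, h.edge_st K hc hPx]
  have hU := notMem_of_notMem_circles hP h.coarse_notMem_circles
  have hne := h.circleOf_ne
  have hcase := h.circleOf_cases x
  have hins : L.circleOf S a ∈ P → L.circleOf S b ∈ P →
      insert (L.circleOf (insert c S) a) (P \ {L.circleOf S a, L.circleOf S b}) ⊆
        L.unmarked (insert c S) := fun ha hb =>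
    Finset.insert_subset (h.coarse_mem_unmarked.2 ⟨hP ha, hP hb⟩) hQ
  by_cases hA : L.circleOf S a ∈ P <;> by_cases hB : L.circleOf S b ∈ P
  · have hins' := hins hA hB
    simp only [hA, hB, true_and, if_true, dot_st L K x hins']
    clear hins hins'
    generalize L.circleOf S a = A at *
    generalize L.circleOf S b = B at *
    generalize L.circleOf (insert c S) a = U at *
    generalize L.circleOf S x = D at *
    generalize L.circleOf (insert c S) x = D' at *
    rcases hcase with ⟨rfl, rfl⟩ | ⟨rfl, rfl⟩ | ⟨h1, h2, h3, rfl⟩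
    · simp only [Finset.mem_erase, hA, hB, hne, hne.symm, hU, ne_eq, not_true_eq_false, false_and,
        true_and, not_false_eq_true, if_true, if_false, or_true, Finset.mem_insert_self,
        Finset.erase_insert_eq_erase]
      rw [erase_sdiff_eq_erase_sdiff (by simp) hU]
    · simp only [Finset.mem_erase, hA, hB, hne, hne.symm, hU, ne_eq, not_true_eq_false, and_false,
        true_and, not_false_eq_true, if_true, if_false, true_or, Finset.mem_insert_self,
        Finset.erase_insert_eq_erase, false_and]
      rw [erase_sdiff_eq_erase_sdiff (by simp) hU]
    · by_cases hD : D' ∈ P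
      · simp [hA, hB, hD, h1, h2, h3, h1.symm, h2.symm]
        rw [insert_erase_sdiff h3]
      · simp [hD, h3]
  all_goals
    clear hins
    simp only [apply_ite (L.dot K x), map_zero, dot_st L K x hQ]
    generalize L.circleOf S a = A at *
    generalize L.circleOf S b = B at *
    generalize L.circleOf (insert c S) a = U at *
    generalize L.circleOf S x = D at *
    generalize L.circleOf (insert c S) x = D' at *
    rcases hcase with ⟨rfl, rfl⟩ | ⟨rfl, rfl⟩ | ⟨h1, h2, h3, rfl⟩
    · simp [hA, hB, hne, hne.symm, hU]
    · simp [hA, hB, hne, hne.symm, hU]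
    · by_cases hD : D' ∈ P
      · simp [hA, hB, hD, h1, h2, h1.symm, h2.symm, erase_sdiff_eq]
      · simp [hA, hB, hD]

/-- The coproduct `Δ` is a bimodule map, so the generator may act on either of the two new circles.
-/
theorem Merges.edge_comm_dot_divide {c : X} {S : Finset X} {a b : DiagramArc X O}
    (h : L.Merges c (insert c S) S a b) (hc : c ∉ S) (x : DiagramArc X O)
    {P : Finset (Finset (DiagramArc X O))} (hP : P ⊆ L.unmarked S) :
    L.edge K c (L.dot K x (L.st K S P)) = L.dot K x (L.edge K c (L.st K S P)) := by
  have hPx : P.erase (L.circleOf S x) ⊆ L.unmarked S := (Finset.erase_subset _ _).trans hP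
  have hQ := h.sdiff_subset_fine hP
  rw [dot_st L K x hP, apply_ite (L.edge K c), map_zero, h.edge_st_divide K hc hP,
    h.edge_st_divide K hc hPx]
  have hA := notMem_of_notMem_circles hP h.left_notMem_circles
  have hB := notMem_of_notMem_circles hP h.right_notMem_circles
  have hne := h.circleOf_ne
  have hcase := h.circleOf_cases x
  have hins : L.circleOf S a ∈ P →
      insert (L.circleOf (insert c S) a) (P \ {L.circleOf S a}) ⊆ L.unmarked (insert c S) ∧
      insert (L.circleOf (insert c S) b) (P \ {L.circleOf S a}) ⊆ L.unmarked (insert c S) :=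
    fun ha => ⟨Finset.insert_subset (h.coarse_mem_unmarked.1 (hP ha)).1 hQ,
      Finset.insert_subset (h.coarse_mem_unmarked.1 (hP ha)).2 hQ⟩
  by_cases hU : L.circleOf S a ∈ P
  · obtain ⟨hins1, hins2⟩ := hins hU
    simp only [hU, if_true, map_add, dot_st L K x hins1, dot_st L K x hins2]
    clear hins hins1 hins2
    generalize L.circleOf S a = U at *
    generalize L.circleOf (insert c S) b = B at *
    generalize L.circleOf (insert c S) a = A at *
    generalize L.circleOf S x = D at *
    generalize L.circleOf (insert c S) x = D' at *
    rcases hcase with ⟨rfl, rfl⟩ | ⟨rfl, rfl⟩ | ⟨h1, h2, h3, rfl⟩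
    · simp [hA, hB, hne, hU]
      rw [erase_sdiff_of_mem (Finset.mem_singleton_self _)]
    · simp [hA, hB, hne, hne.symm, hU]
      rw [erase_sdiff_of_mem (Finset.mem_singleton_self _)]
    · by_cases hD : D ∈ P
      · simp [hA, hB, hU, hD, h1, h2, h3, h1.symm, h2.symm, h3.symm]
        rw [insert_erase_sdiff h1, insert_erase_sdiff h2]
      · simp [hD, h1, h2, h3]
  · clear hins
    simp only [hU, if_false, dot_st L K x hQ]
    generalize L.circleOf S a = U at *
    generalize L.circleOf (insert c S) b = B at *
    generalize L.circleOf (insert c S) a = A at *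
    generalize L.circleOf S x = D at *
    generalize L.circleOf (insert c S) x = D' at *
    rcases hcase with ⟨rfl, rfl⟩ | ⟨rfl, rfl⟩ | ⟨h1, h2, h3, rfl⟩
    · simp [hA, hU]
    · simp [hB, hU]
    · by_cases hD : D ∈ P
      · simp [hU, hD, h3, erase_sdiff_eq]
      · simp [hU, hD]

theorem edge_comm_dot (c : X) (x : DiagramArc X O) :
    L.edge K c ∘ₗ L.dot K x = L.dot K x ∘ₗ L.edge K c := by
  refine L.hom_ext fun S P hP => ?_
  rw [LinearMap.comp_apply, LinearMap.comp_apply]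
  by_cases hc : c ∈ S
  · have hPx : P.erase (L.circleOf S x) ⊆ L.unmarked S := (Finset.erase_subset _ _).trans hP
    rw [L.edge_st_of_mem K hc hP, map_zero, dot_st L K x hP, apply_ite (L.edge K c), map_zero,
      L.edge_st_of_mem K hc hPx, ite_self]
  · rcases L.merges_or_merges hc with ⟨a, b, h⟩ | ⟨a, b, h⟩
    · exact h.edge_comm_dot K hc x hP
    · exact h.edge_comm_dot_divide K hc x hP

end LinkDiagram
end

/-- In characteristic 2 a symmetric double sum with vanishing diagonal is zero. -/
theorem sum_sum_eq_zero_of_symm {ι M : Type*} [Fintype ι] [AddCommGroup M]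
    (h2 : ∀ m : M, m + m = 0) {f : ι → ι → M} (hs : ∀ i j, f i j = f j i) (hd : ∀ i, f i i = 0) :
    ∑ i, ∑ j, f i j = 0 := by
  classical
  rw [← Fintype.sum_prod_type' (f := f)]
  refine Finset.sum_involution (fun p _ => p.swap) ?_ ?_ ?_ ?_
  · rintro ⟨i, j⟩ _
    simp only [Prod.swap_prod_mk, hs j i, h2]
  · rintro ⟨i, j⟩ _ hne heq
    simp only [Prod.swap_prod_mk, Prod.mk.injEq] at heq
    rw [heq.1] at hne
    exact hne (hd i)
  · simp
  · simp

section Finset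

variable {α : Type*} [DecidableEq α] {A B U : α} {M M' : Finset α}

/-- In this group of lemmas `M` and `M'` are the unmarked circles of the finer and the coarser
resolution, and `h` says that they agree away from the crossing. They express the edge maps on `top
S` without case distinctions about the other circles. -/
theorem eq_insert_sdiff_of_iff (h : ∀ C, (C ∈ M ∧ C ≠ A ∧ C ≠ B) ↔ (C ∈ M' ∧ C ≠ U))
    (hU : U ∈ M') : insert U (M \ {A, B}) = M' := by
  ext C
  have := h C
  grind

theorem eq_sdiff_of_iff (h : ∀ C, (C ∈ M ∧ C ≠ A ∧ C ≠ B) ↔ (C ∈ M' ∧ C ≠ U))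
    (hU : U ∉ M) (hU' : U ∉ M') : M \ {A, B} = M' := by
  ext C
  have := h C
  grind

theorem insert_left_sdiff_of_iff (h : ∀ C, (C ∈ M ∧ C ≠ A ∧ C ≠ B) ↔ (C ∈ M' ∧ C ≠ U))
    (hA : A ∈ M) (hne : A ≠ B) : insert A (M' \ {U}) = M.erase B := by
  ext C
  have := h C
  have := h A
  grind

theorem insert_right_sdiff_of_iff (h : ∀ C, (C ∈ M ∧ C ≠ A ∧ C ≠ B) ↔ (C ∈ M' ∧ C ≠ U))
    (hB : B ∈ M) (hne : A ≠ B) : insert B (M' \ {U}) = M.erase A := by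
  ext C
  have := h C
  have := h B
  grind

theorem sdiff_left_of_iff (h : ∀ C, (C ∈ M ∧ C ≠ A ∧ C ≠ B) ↔ (C ∈ M' ∧ C ≠ U))
    (hB : B ∉ M) : M' \ {U} = M.erase A := by
  ext C
  have := h C
  have := h A
  grind

theorem sdiff_right_of_iff (h : ∀ C, (C ∈ M ∧ C ≠ A ∧ C ≠ B) ↔ (C ∈ M' ∧ C ≠ U))
    (hA : A ∉ M) : M' \ {U} = M.erase B := by
  ext C
  have := h C
  have := h B
  grind

end Finset

/-! ### Commuting edge maps and vanishing squares of the differentials -/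

noncomputable section

open scoped Classical

namespace LinkDiagram

variable {X O F : Type u} [Fintype X] [Fintype O] [Fintype F] {L : LinkDiagram X O F}
variable (K : Type*) [CommRing K]

/-- The vector `top S` plays the role of the unit, and `μ (1 ⊗ 1) = 1`. If one of the circles is
marked, the merged circle is marked too, and the other one acts as the unit on `v₀`. -/
theorem Merges.edge_top {c : X} {S : Finset X} {a b : DiagramArc X O}
    (h : L.Merges c S (insert c S) a b) (hc : c ∉ S) :
    L.edge K c (L.top K S) = L.top K (insert c S) := by
  rw [top, h.edge_st K hc subset_rfl, top]
  have hUm := h.coarse_mem_unmarked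
  have hU := h.unmarked_iff
  have hor : L.circleOf S a ∈ L.unmarked S ∨ L.circleOf S b ∈ L.unmarked S := by
    rw [circleOf_mem_unmarked, circleOf_mem_unmarked, ← not_and_or]
    rintro ⟨h1, h2⟩
    exact h.not_rel ((L.rel_equivalence S).trans h1 ((L.rel_equivalence S).symm h2))
  split_ifs with h1
  · rw [eq_insert_sdiff_of_iff hU (hUm.2 h1)]
  · rw [eq_sdiff_of_iff hU (fun h' => h.coarse_notMem_circles (L.mem_unmarked.1 h').1) (hUm.not.2 h1)]

/-- This is `Δ 1 = x ⊗ 1 + 1 ⊗ x` for the generator `x`. If one of the two new circles is marked,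
its operator `dot` kills `top`, and a single term remains. -/
theorem Merges.edge_top_divide {c : X} {S : Finset X} {a b : DiagramArc X O}
    (h : L.Merges c (insert c S) S a b) (hc : c ∉ S) :
    L.edge K c (L.top K S) = (L.dot K a + L.dot K b) (L.top K (insert c S)) := by
  rw [LinearMap.add_apply, top, top, h.edge_st_divide K hc subset_rfl, dot_st L K a subset_rfl,
    dot_st L K b subset_rfl]
  have hUm := h.coarse_mem_unmarked
  have hU := h.unmarked_iff
  have hne := h.circleOf_ne
  have hnotA := notMem_of_notMem_circles (subset_refl (L.unmarked S)) h.left_notMem_circles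
  have hnotB := notMem_of_notMem_circles (subset_refl (L.unmarked S)) h.right_notMem_circles
  have hnotU := notMem_of_notMem_circles (subset_refl (L.unmarked (insert c S)))
    h.coarse_notMem_circles
  have hor : L.circleOf (insert c S) a ∈ L.unmarked (insert c S) ∨
      L.circleOf (insert c S) b ∈ L.unmarked (insert c S) := by
    rw [circleOf_mem_unmarked, circleOf_mem_unmarked, ← not_and_or]
    rintro ⟨h1, h2⟩
    exact h.not_rel ((L.rel_equivalence _).trans h1 ((L.rel_equivalence _).symm h2))
  generalize L.circleOf S a = U at *
  generalize L.circleOf (insert c S) b = B at *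
  generalize L.circleOf (insert c S) a = A at *
  by_cases h1 : U ∈ L.unmarked S
  · obtain ⟨hA, hB⟩ := hUm.1 h1
    rw [if_pos h1, if_pos hA, if_pos hB, add_comm]
    rw [insert_left_sdiff_of_iff hU hA hne, insert_right_sdiff_of_iff hU hB hne]
  · rw [if_neg h1]
    rcases hor with hA | hB
    · have hB : B ∉ L.unmarked (insert c S) := fun hB => h1 (hUm.2 ⟨hA, hB⟩)
      rw [if_pos hA, if_neg hB, add_zero, sdiff_left_of_iff hU hB]
    · have hA : A ∉ L.unmarked (insert c S) := fun hA => h1 (hUm.2 ⟨hA, hB⟩)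
      rw [if_pos hB, if_neg hA, zero_add, sdiff_right_of_iff hU hA]

variable [CharP K 2]

theorem dot_add_dot_top {S : Finset X} {a b : DiagramArc X O} (h : L.Rel S a b) :
    (L.dot K a + L.dot K b) (L.top K S) = 0 := by
  rw [LinearMap.add_apply, L.dot_top_congr K h]
  exact funext fun _ => CharTwo.add_self_eq_zero _

/-- The sum of the two generators at a crossing does not depend on the choice of arcs. -/
theorem Merges.dot_add_dot_top {c : X} {S S' : Finset X} {a b u v : DiagramArc X O}
    (_h : L.Merges c S S' a b) (huv : ¬ L.Rel S u v) (hu : L.Rel S a u ∨ L.Rel S b u)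
    (hv : L.Rel S a v ∨ L.Rel S b v) :
    (L.dot K u + L.dot K v) (L.top K S) = (L.dot K a + L.dot K b) (L.top K S) := by
  have e := L.rel_equivalence S
  rw [LinearMap.add_apply, LinearMap.add_apply]
  rcases hu with hu | hu <;> rcases hv with hv | hv
  · exact absurd (e.trans (e.symm hu) hv) huv
  · rw [L.dot_top_congr K hu, L.dot_top_congr K hv]
  · rw [L.dot_top_congr K hu, L.dot_top_congr K hv, add_comm]
  · exact absurd (e.trans (e.symm hu) hv) huv

omit [CharP K 2] in
theorem edge_dot (c : X) (a : DiagramArc X O) (v : L.PureState → K) :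
    L.edge K c (L.dot K a v) = L.dot K a (L.edge K c v) :=
  LinearMap.congr_fun (L.edge_comm_dot K c a) v

omit [CharP K 2] in
theorem dot_dot_comm (a b : DiagramArc X O) (v : L.PureState → K) :
    L.dot K a (L.dot K b v) = L.dot K b (L.dot K a v) :=
  LinearMap.congr_fun (L.dot_comm K a b) v

omit [CharP K 2] in
theorem edge_comm_dot_add (c : X) (a b : DiagramArc X O) (v : L.PureState → K) :
    L.edge K c ((L.dot K a + L.dot K b) v) = (L.dot K a + L.dot K b) (L.edge K c v) := by
  rw [LinearMap.add_apply, LinearMap.add_apply, map_add, edge_dot, edge_dot]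

omit [CharP K 2] in
theorem dot_add_comm (a b u v : DiagramArc X O) (w : L.PureState → K) :
    (L.dot K a + L.dot K b) ((L.dot K u + L.dot K v) w) =
      (L.dot K u + L.dot K v) ((L.dot K a + L.dot K b) w) := by
  simp only [LinearMap.add_apply, map_add]
  rw [dot_dot_comm K a u, dot_dot_comm K a v, dot_dot_comm K b u, dot_dot_comm K b v,
    add_add_add_comm]

theorem Merges.dot_add_dot_top_of_touches {c : X} {S S' : Finset X} {a b u v : DiagramArc X O}
    (h : L.Merges c S S' a b) (huv : ¬ L.Rel S u v) (hu : L.Touches c u) (hv : L.Touches c v) :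
    (L.dot K u + L.dot K v) (L.top K S) = (L.dot K a + L.dot K b) (L.top K S) :=
  h.dot_add_dot_top K huv (h.rel_or_rel u hu) (h.rel_or_rel v hv)

omit [CharP K 2] in
-- If merging at `c` fused the two circles created at `d`, then all strands at `c` would lie on
-- these two circles. Undoing the division at `d` makes them one circle, so `c` could not merge two
-- different circles of `L_S`.
theorem Merges.not_rel_of_divides {S S₁ S₂ T : Finset X} {c d : X}
    {a₁ b₁ a₃ b₃ a₄ b₄ : DiagramArc X O} (g1 : L.Merges c S S₁ a₁ b₁)
    (g3 : L.Merges d S₂ S a₃ b₃) (g4 : L.Merges c S₂ T a₄ b₄) : ¬ L.Rel T a₃ b₃ := by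
  have e := L.rel_equivalence S₂
  rw [g4.rel_iff, not_or]
  refine ⟨g3.not_rel, ?_⟩
  rintro ⟨h1, h2⟩
  have key : ∀ x, L.Touches c x → L.Rel S₂ a₃ x ∨ L.Rel S₂ b₃ x := by
    intro x hx
    have h3 := g4.rel_or_rel x hx
    have h4 := g3.not_rel
    have t := fun u v w (huv : L.Rel S₂ u v) (huw : L.Rel S₂ u w) => e.trans (e.symm huv) huw
    rcases h1 with h1 | h1 <;> rcases h2 with h2 | h2
    · exact absurd (t _ _ _ h1 h2) h4
    · exact h3.imp (t _ _ _ h1) (t _ _ _ h2)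
    · exact (h3.imp (t _ _ _ h2) (t _ _ _ h1)).symm
    · exact absurd (t _ _ _ h1 h2) h4
  exact g1.not_rel ((g3.rel_iff _ _).2 (Or.inr ⟨key _ g1.touches_left, key _ g1.touches_right⟩))

/-- Counting circles leaves six combinations of merging and dividing for the two orders. In all of
them both composites are products of sums `dot a + dot b` applied to `top`, and such a sum does not
depend on the arcs that are chosen on the two circles. If both orders divide first and merge
afterwards, the two arcs end up on one circle and both composites vanish in characteristic 2. -/
theorem edge_edge_top {S : Finset X} {c d : X} (hcd : c ≠ d) (hc : c ∉ S) (hd : d ∉ S) :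
    L.edge K d (L.edge K c (L.top K S)) = L.edge K c (L.edge K d (L.top K S)) := by
  have hd' : d ∉ insert c S := by simp [hd, hcd.symm]
  have hc' : c ∉ insert d S := by simp [hc, hcd]
  have hT : insert c (insert d S) = insert d (insert c S) := Finset.insert_comm c d S
  have g1 := L.merges_or_merges hc
  have g2 := L.merges_or_merges hd'
  have g3 := L.merges_or_merges hd
  have g4 := L.merges_or_merges hc'
  rw [hT] at g4
  rcases g1 with ⟨a₁, b₁, g1⟩ | ⟨a₁, b₁, g1⟩ <;> rcases g2 with ⟨a₂, b₂, g2⟩ | ⟨a₂, b₂, g2⟩ <;>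
    rcases g3 with ⟨a₃, b₃, g3⟩ | ⟨a₃, b₃, g3⟩ <;>
    rcases g4 with ⟨a₄, b₄, g4⟩ | ⟨a₄, b₄, g4⟩ <;>
    have n1 := g1.card_circles <;> have n2 := g2.card_circles <;>
    have n3 := g3.card_circles <;> have n4 := g4.card_circles <;> try omega
  all_goals
    have g4' := g4
    rw [← hT] at g4'
  · rw [g1.edge_top K hc, g2.edge_top K hd', g3.edge_top K hd, g4'.edge_top K hc', hT]
  · -- merging, then dividing, in both orders
    have h1 : L.Rel (insert c S) a₄ b₄ := g1.rel_coarse g4.touches_left g4.touches_right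
    rw [g2.rel_iff] at h1
    obtain ⟨h2, h3⟩ := h1.resolve_left g4.not_rel
    rw [g1.edge_top K hc, g2.edge_top_divide K hd', g3.edge_top K hd, g4'.edge_top_divide K hc', hT]
    exact (g2.dot_add_dot_top K g4.not_rel h2 h3).symm
  · -- merging, then dividing, in one order and dividing, then merging, in the other order
    have hab := g1.not_rel_of_divides g3 g4
    rw [g1.edge_top K hc, g2.edge_top_divide K hd', g3.edge_top_divide K hd, edge_comm_dot_add,
      g4'.edge_top K hc', hT]
    exact (g2.dot_add_dot_top_of_touches K hab g3.touches_left g3.touches_right).symm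
  · have hab := g3.not_rel_of_divides g1 g2
    rw [g1.edge_top_divide K hc, edge_comm_dot_add, g2.edge_top K hd', g3.edge_top K hd,
      g4'.edge_top_divide K hc', hT]
    exact g4.dot_add_dot_top_of_touches K hab g1.touches_left g1.touches_right
  · -- dividing, then merging, in both orders
    rw [g1.edge_top_divide K hc, edge_comm_dot_add, g2.edge_top K hd', g3.edge_top_divide K hd,
      edge_comm_dot_add, g4'.edge_top K hc', hT,
      dot_add_dot_top K (g4.rel_coarse g1.touches_left g1.touches_right),
      dot_add_dot_top K (g2.rel_coarse g3.touches_left g3.touches_right)]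
  · have hab : ¬ L.Rel (insert d (insert c S)) a₁ b₁ := fun h => g1.not_rel (g2.rel_of_rel h)
    have hab' : ¬ L.Rel (insert d (insert c S)) a₃ b₃ := fun h => g3.not_rel (g4.rel_of_rel h)
    rw [g1.edge_top_divide K hc, edge_comm_dot_add, g2.edge_top_divide K hd',
      g3.edge_top_divide K hd, edge_comm_dot_add, g4'.edge_top_divide K hc', hT, dot_add_comm,
      g4.dot_add_dot_top_of_touches K hab g1.touches_left g1.touches_right]
    rw [dot_add_comm, ← g2.dot_add_dot_top_of_touches K hab' g3.touches_left g3.touches_right,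
      dot_add_comm]

/-- Both composites commute with `dot`, so it is enough to compare them on `top S`. -/
theorem edge_edge_comm (c d : X) : L.edge K c ∘ₗ L.edge K d = L.edge K d ∘ₗ L.edge K c := by
  have hdot : ∀ c d a, (L.edge K c ∘ₗ L.edge K d) ∘ₗ L.dot K a =
      L.dot K a ∘ₗ (L.edge K c ∘ₗ L.edge K d) := by
    intro c d a
    rw [LinearMap.comp_assoc, edge_comm_dot, ← LinearMap.comp_assoc, edge_comm_dot,
      LinearMap.comp_assoc]
  refine L.hom_ext_top (hdot c d) (hdot d c) fun S => ?_
  rw [LinearMap.comp_apply, LinearMap.comp_apply]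
  by_cases hcd : c = d
  · rw [hcd]
  -- an edge map vanishes on the images of the vectors whose resolution contains the crossing
  have vanish : ∀ c d, c ∈ S → L.edge K c (L.edge K d (L.top K S)) = 0 := by
    intro c d hc
    by_cases hd : d ∈ S
    · rw [top, L.edge_st_of_mem K hd subset_rfl, map_zero]
    · have hc' : c ∈ insert d S := Finset.mem_insert_of_mem hc
      rcases L.merges_or_merges hd with ⟨a, b, h⟩ | ⟨a, b, h⟩
      · rw [h.edge_top K hd, top, L.edge_st_of_mem K hc' subset_rfl]
      · rw [h.edge_top_divide K hd, edge_comm_dot_add, top, L.edge_st_of_mem K hc' subset_rfl,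
          map_zero]
  by_cases hc : c ∈ S
  · rw [vanish c d hc, top, L.edge_st_of_mem K hc subset_rfl, map_zero]
  by_cases hd : d ∈ S
  · rw [vanish d c hd, top, L.edge_st_of_mem K hd subset_rfl, map_zero]
  · exact (edge_edge_top K hcd hc hd).symm

omit [CharP K 2] in
theorem edge_edge_self (c : X) : L.edge K c ∘ₗ L.edge K c = 0 := by
  refine L.hom_ext_top (fun a => ?_) (fun a => ?_) fun S => ?_
  · rw [LinearMap.comp_assoc, edge_comm_dot, ← LinearMap.comp_assoc, edge_comm_dot,
      LinearMap.comp_assoc]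
  · rw [LinearMap.zero_comp, LinearMap.comp_zero]
  rw [LinearMap.comp_apply, LinearMap.zero_apply]
  by_cases hc : c ∈ S
  · rw [top, L.edge_st_of_mem K hc subset_rfl, map_zero]
  have hc' : c ∈ insert c S := Finset.mem_insert_self c S
  rcases L.merges_or_merges hc with ⟨a, b, h⟩ | ⟨a, b, h⟩
  · rw [h.edge_top K hc, top, L.edge_st_of_mem K hc' subset_rfl]
  · rw [h.edge_top_divide K hc, edge_comm_dot_add, top, L.edge_st_of_mem K hc' subset_rfl, map_zero]

theorem end_add_self (f : Module.End K (L.PureState → K)) : f + f = 0 :=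
  LinearMap.ext fun _ => funext fun _ => CharTwo.add_self_eq_zero _

variable (L) in
-- The square is a double sum over crossings, symmetric with zero diagonal; no signs are needed in
-- characteristic 2.
theorem khovanovDiff_comp_self : L.khovanovDiff K ∘ₗ L.khovanovDiff K = 0 := by
  rw [khovanovDiff_eq_sum, ← Module.End.mul_eq_comp, Finset.sum_mul_sum]
  exact sum_sum_eq_zero_of_symm (end_add_self K) (edge_edge_comm K) (edge_edge_self K)

variable [Algebra L.faceRing K]

omit [CharP K 2] in
theorem koszulDiff_st {S : Finset X} {P : Finset (Finset (DiagramArc X O))}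
    (hP : P ⊆ L.unmarked S) : L.koszulDiff K (L.st K S P) =
      ∑ C ∈ P, algebraMap L.faceRing K (L.area S C) • L.st K S (P.erase C) := by
  rw [st_eq_single L K hP, koszulDiff, Matrix.mulVecLin_apply, Matrix.mulVec_single_one]
  funext y
  rw [Finset.sum_apply]
  simp [Matrix.col_apply, st, Prod.ext_iff]

omit [CharP K 2] in
/-- The Koszul differential is multiplication by a fixed element. -/
theorem koszulDiff_eq_sum :
    L.koszulDiff K = ∑ a, algebraMap L.faceRing K (L.weight a) • L.dot K a := by
  refine L.hom_ext fun S P hP => ?_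
  rw [koszulDiff_st K hP, LinearMap.sum_apply]
  simp only [LinearMap.smul_apply, dot_st L K _ hP]
  -- The area of `C` is spread over its arcs. After exchanging the sums, every arc sees exactly one
  -- circle, the one through it.
  have h1 : ∀ C ∈ P, algebraMap L.faceRing K (L.area S C) • L.st K S (P.erase C) =
      ∑ a, if L.circleOf S a = C then algebraMap L.faceRing K (L.weight a) • L.st K S (P.erase C)
        else 0 := by
    intro C hC
    have hC' := (L.mem_unmarked.1 (hP hC)).1
    rw [L.area_eq_sum_weight hC', map_sum, Finset.sum_smul, ← Finset.sum_filter]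
    refine Finset.sum_congr ?_ fun _ _ => rfl
    ext a
    simp [L.mem_iff_circleOf_eq hC']
  rw [Finset.sum_congr rfl h1, Finset.sum_comm]
  refine Finset.sum_congr rfl fun a _ => ?_
  rw [Finset.sum_ite_eq]
  split_ifs <;> simp

theorem koszulDiff_comp_self : L.koszulDiff K ∘ₗ L.koszulDiff K = 0 := by
  rw [koszulDiff_eq_sum, ← Module.End.mul_eq_comp, Finset.sum_mul_sum]
  refine sum_sum_eq_zero_of_symm (end_add_self K) (fun a b => ?_) (fun a => ?_)
  · rw [smul_mul_smul_comm, smul_mul_smul_comm, mul_comm (algebraMap _ _ _), Module.End.mul_eq_comp,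
      Module.End.mul_eq_comp, dot_comm]
  · rw [smul_mul_smul_comm, Module.End.mul_eq_comp, dot_dot, smul_zero]

omit [CharP K 2] in
theorem khovanovDiff_comp_koszulDiff :
    L.khovanovDiff K ∘ₗ L.koszulDiff K = L.koszulDiff K ∘ₗ L.khovanovDiff K := by
  rw [koszulDiff_eq_sum, khovanovDiff_eq_sum, ← Module.End.mul_eq_comp, ← Module.End.mul_eq_comp,
    Finset.sum_mul_sum, Finset.sum_mul_sum, Finset.sum_comm]
  refine Finset.sum_congr rfl fun a _ => Finset.sum_congr rfl fun c _ => ?_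
  rw [mul_smul_comm, smul_mul_assoc, Module.End.mul_eq_comp, Module.End.mul_eq_comp, edge_comm_dot]

variable (L) in
-- The two commuting differentials contribute equal cross terms, which cancel in characteristic 2.
theorem twistedDiff_comp_self : L.twistedDiff K ∘ₗ L.twistedDiff K = 0 := by
  rw [twistedDiff, LinearMap.add_comp, LinearMap.comp_add, LinearMap.comp_add,
    khovanovDiff_comp_self, koszulDiff_comp_self, khovanovDiff_comp_koszulDiff, zero_add, add_zero]
  exact end_add_self K _

end LinkDiagram
end

/-! ### Submodules spanned by basis vectors -/

theorem single_mem_spanOn {ι K : Type*} [DecidableEq ι] [CommRing K] {P : ι → Prop} {x : ι}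
    (hx : P x) (k : K) : Pi.single x k ∈ spanOn K P := by
  intro y hy
  rw [Pi.single_eq_of_ne]
  rintro rfl
  exact hy hx

theorem map_spanOn_le {ι K M : Type*} [Fintype ι] [DecidableEq ι] [CommRing K] [AddCommGroup M]
    [Module K M] {P : ι → Prop} (f : (ι → K) →ₗ[K] M) {W : Submodule K M}
    (h : ∀ x, P x → f (Pi.single x 1) ∈ W) : (spanOn K P).map f ≤ W := by
  rintro _ ⟨v, hv, rfl⟩
  rw [LinearMap.pi_apply_eq_sum_univ f v]
  refine W.sum_mem fun x _ => ?_
  by_cases hx : P x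
  · have e : (fun j => if x = j then (1 : K) else 0) = Pi.single x 1 := by
      funext j
      simp [Pi.single_apply, eq_comm]
    rw [e]
    exact W.smul_mem _ (h x hx)
  · rw [hv x hx, zero_smul]
    exact W.zero_mem

theorem spanOn_mono {ι K : Type*} [CommRing K] {P Q : ι → Prop} (h : ∀ x, P x → Q x) :
    spanOn K P ≤ spanOn K Q := fun _ hf x hx => hf x fun hP => hx (h x hP)

noncomputable section

open scoped Classical

namespace LinkDiagram

variable {X O F : Type u} [Fintype X] [Fintype O] [Fintype F] (L : LinkDiagram X O F)

/-! ### Gradings -/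

theorem card_unmarked (S : Finset X) : (L.unmarked S).card + 1 = (L.circles S).card := by
  have : L.unmarked S = (L.circles S).erase (L.circleOf S L.mark) := by
    ext C
    rw [mem_unmarked, Finset.mem_erase, and_comm]
    refine and_congr_left fun hC => ?_
    rw [L.mem_iff_circleOf_eq hC, eq_comm]
  rw [this, Finset.card_erase_add_one (L.circleOf_mem_circles S L.mark)]

/-- The number of labels `v₋` is replaced by the number of circles, whose change at a crossing is
known to be one. -/
theorem qDeg_eq (x : L.PureState) : L.qDeg x =
    2 * x.1.2.card - (L.circles x.1.1).card + 1 + x.1.1.card + (L.nPos - 2 * L.nNeg) := by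
  have h1 := Finset.card_sdiff_add_card_eq_card x.2
  have h2 := L.card_unmarked x.1.1
  rw [qDeg]
  omega

variable {L} (K : Type*) [CommRing K]

theorem st_mem_bigradedPart {S : Finset X} {P : Finset (Finset (DiagramArc X O))} {h q : ℤ}
    (hh : S.card - L.nNeg = h)
    (hq : 2 * P.card - (L.circles S).card + 1 + S.card + (L.nPos - 2 * L.nNeg) = q) :
    L.st K S P ∈ L.bigradedPart K h q := by
  intro y hy
  refine if_neg fun e => hy ⟨?_, ?_⟩
  · rw [hDeg, e, hh]
  · rw [qDeg_eq, e, hq]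

/-- Since `|S|` grows by one, preserving `q` means losing one `v₊` when two circles merge and
keeping the number of `v₊` when a circle divides. -/
theorem edge_st_mem_bigradedPart (c : X) {S : Finset X} {P : Finset (Finset (DiagramArc X O))}
    (hP : P ⊆ L.unmarked S) : L.edge K c (L.st K S P) ∈ L.bigradedPart K (S.card - L.nNeg + 1)
      (2 * P.card - (L.circles S).card + 1 + S.card + (L.nPos - 2 * L.nNeg)) := by
  by_cases hc : c ∈ S
  · rw [L.edge_st_of_mem K hc hP]
    exact Submodule.zero_mem _
  have hS := Finset.card_insert_of_notMem hc
  rcases L.merges_or_merges hc with ⟨a, b, h⟩ | ⟨a, b, h⟩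
  · have hcard := h.card_circles
    have hU := notMem_of_notMem_circles hP h.coarse_notMem_circles
    have hne := h.circleOf_ne
    rw [h.edge_st K hc hP]
    split_ifs with h1 h2
    · have h3 : (P \ {L.circleOf S a, L.circleOf S b}).card + 2 = P.card := by
        rw [← Finset.card_pair hne]
        exact Finset.card_sdiff_add_card_eq_card (by
          intro C hC
          simp only [Finset.mem_insert, Finset.mem_singleton] at hC
          rcases hC with rfl | rfl
          exacts [h1.1, h1.2])
      have h4 := Finset.card_insert_of_notMem (s := P \ {L.circleOf S a, L.circleOf S b})
        (fun hm => hU (Finset.mem_sdiff.1 hm).1)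
      apply st_mem_bigradedPart <;> omega
    · have h3 : (P \ {L.circleOf S a, L.circleOf S b}).card + 1 = P.card := by
        rcases h2 with h2 | h2
        · have h5 : L.circleOf S b ∉ P := fun h' => h1 ⟨h2, h'⟩
          rw [Finset.sdiff_insert, Finset.sdiff_singleton_eq_erase, Finset.erase_eq_of_notMem h5,
            Finset.card_erase_add_one h2]
        · have h5 : L.circleOf S a ∉ P := fun h' => h1 ⟨h', h2⟩
          rw [Finset.sdiff_insert, Finset.sdiff_singleton_eq_erase, Finset.erase_eq_of_notMem
            (fun hm => h5 (Finset.mem_erase.1 hm).2), Finset.card_erase_add_one h2]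
      apply st_mem_bigradedPart <;> omega
    · exact Submodule.zero_mem _
  · have hcard := h.card_circles
    have hA := notMem_of_notMem_circles hP h.left_notMem_circles
    have hB := notMem_of_notMem_circles hP h.right_notMem_circles
    rw [h.edge_st_divide K hc hP]
    split_ifs with h1
    · have h3 : (P \ {L.circleOf S a}).card + 1 = P.card := by
        rw [Finset.sdiff_singleton_eq_erase, Finset.card_erase_add_one h1]
      have h4 := Finset.card_insert_of_notMem (s := P \ {L.circleOf S a})
        (fun hm => hA (Finset.mem_sdiff.1 hm).1)
      have h5 := Finset.card_insert_of_notMem (s := P \ {L.circleOf S a})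
        (fun hm => hB (Finset.mem_sdiff.1 hm).1)
      refine Submodule.add_mem _ ?_ ?_ <;> apply st_mem_bigradedPart <;> omega
    · rw [Finset.sdiff_singleton_eq_erase, Finset.erase_eq_of_notMem h1]
      apply st_mem_bigradedPart <;> omega

theorem edge_mem_bigradedPart (c : X) (x : L.PureState) :
    L.edge K c (Pi.single x 1) ∈ L.bigradedPart K (L.hDeg x + 1) (L.qDeg x) := by
  rw [single_eq_st, qDeg_eq, hDeg]
  exact edge_st_mem_bigradedPart K c x.2

theorem khovanovDiff_map_le (h q : ℤ) :
    (L.bigradedPart K h q).map (L.khovanovDiff K) ≤ L.bigradedPart K (h + 1) q := by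
  refine map_spanOn_le _ ?_
  rintro x ⟨rfl, rfl⟩
  rw [khovanovDiff_eq_sum, LinearMap.sum_apply]
  exact Submodule.sum_mem _ fun c _ => edge_mem_bigradedPart K c x

theorem koszulDiff_map_le [Algebra L.faceRing K] (h q : ℤ) :
    (L.bigradedPart K h q).map (L.koszulDiff K) ≤ L.bigradedPart K h (q - 2) := by
  refine map_spanOn_le _ ?_
  rintro x ⟨rfl, rfl⟩
  rw [single_eq_st, koszulDiff_st K x.2]
  refine Submodule.sum_mem _ fun C hC => Submodule.smul_mem _ _ ?_
  have := Finset.card_erase_add_one hC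
  apply st_mem_bigradedPart
  · rfl
  · rw [qDeg_eq]
    omega

end LinkDiagram
end

noncomputable section

/-! ### The spectral sequence of a filtered complex -/

section FilteredComplex

variable {K V : Type u} [CommRing K] [AddCommGroup V] [Module K V]

/-- The filtration `Fil` is increasing and preserved by the differential `d` of degree 2. -/
structure IsFilteredComplex (d : V →ₗ[K] V) (Fil : ℤ → ℤ → Submodule K V) : Prop where
  mono : ∀ p p' s, p ≤ p' → Fil p s ≤ Fil p' s
  map_mem : ∀ p s x, x ∈ Fil p s → d x ∈ Fil p (s + 2)
  d_d : ∀ x, d (d x) = 0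

variable {d : V →ₗ[K] V} {Fil : ℤ → ℤ → Submodule K V}

theorem mem_specZ {r p s : ℤ} {x : V} :
    x ∈ specZ d Fil r p s ↔ x ∈ Fil p s ∧ d x ∈ Fil (p - r) (s + 2) := Iff.rfl

theorem mem_specB {r p s : ℤ} {x : V} :
    x ∈ specB d Fil r p s ↔ ∃ y ∈ specZ d Fil (r - 1) (p - 1) s,
      ∃ z ∈ specZ d Fil (r - 1) (p + r - 1) (s - 2), y + d z = x := by
  simp [specB, Submodule.mem_sup]

variable (d Fil) in
/-- The entries of the pages of the spectral sequence. -/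
abbrev specE (r p s : ℤ) : Type u :=
  ↥(specZ d Fil r p s) ⧸ (specB d Fil r p s).submoduleOf (specZ d Fil r p s)

namespace IsFilteredComplex

variable (h : IsFilteredComplex d Fil)
include h

theorem specZ_map {r : ℤ} {i j : ℤ × ℤ} (hij : i + (-r, 2) = j) :
    ∀ x ∈ specZ d Fil r i.1 i.2, d x ∈ specZ d Fil r j.1 j.2 := by
  subst hij
  rintro _ ⟨-, hx⟩
  refine ⟨?_, ?_⟩
  · simpa [sub_eq_add_neg] using hx
  · simp only [SetLike.mem_coe, Submodule.mem_comap, h.d_d]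
    exact Submodule.zero_mem _

theorem specB_map {r : ℤ} {i j : ℤ × ℤ} (hij : i + (-r, 2) = j) {x : V}
    (hx : x ∈ specB d Fil r i.1 i.2) : d x ∈ specB d Fil r j.1 j.2 := by
  subst hij
  obtain ⟨y, hy, z, hz, rfl⟩ := mem_specB.1 hx
  refine mem_specB.2 ⟨0, Submodule.zero_mem _, y, ?_, ?_⟩
  · have e1 : (i + (-r, 2)).1 + r - 1 = i.1 - 1 := by simp
    have e2 : (i + (-r, 2)).2 - 2 = i.2 := by simp
    rwa [e1, e2]
  · rw [map_add, h.d_d, add_zero, zero_add]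

/-- The differential of the page `E^r`. -/
def pageD {r : ℤ} {i j : ℤ × ℤ} (hij : i + (-r, 2) = j) :
    specE d Fil r i.1 i.2 →ₗ[K] specE d Fil r j.1 j.2 :=
  Submodule.mapQ _ _ (d.restrict (h.specZ_map hij)) fun _ hx => h.specB_map hij hx

/-- The page `E^r`. -/
def page (r : ℤ) : HomologicalComplex (ModuleCat.{u} K) (ComplexShape.up' ((-r, 2) : ℤ × ℤ)) where
  X i := ModuleCat.of K (specE d Fil r i.1 i.2)
  d i j := open Classical in if hij : i + (-r, 2) = j then ModuleCat.ofHom (h.pageD hij) else 0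
  shape i j hij := dif_neg hij
  d_comp_d' i j k hij hjk := by
    have hij' : i + (-r, 2) = j := hij
    have hjk' : j + (-r, 2) = k := hjk
    rw [dif_pos hij', dif_pos hjk', ← ModuleCat.ofHom_comp]
    ext x
    have : (d.restrict (h.specZ_map hjk)) (d.restrict (h.specZ_map hij) x) = 0 :=
      Subtype.ext (h.d_d x)
    change Submodule.mkQ _ ((d.restrict (h.specZ_map hjk)) (d.restrict (h.specZ_map hij) x)) = 0
    rw [this, map_zero]

/-- The class map to the page `E^r`. -/
def cls (r p s : ℤ) : specZ d Fil r p s →ₗ[K] (h.page r).X (p, s) := Submodule.mkQ _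

theorem cls_surjective (r p s : ℤ) : Function.Surjective (h.cls r p s) := Submodule.mkQ_surjective _

theorem cls_eq_zero {r p s : ℤ} (x : specZ d Fil r p s) :
    h.cls r p s x = 0 ↔ (x : V) ∈ specB d Fil r p s :=
  Submodule.Quotient.mk_eq_zero _

theorem d_cls {r p s p' s' : ℤ} (hp : p - r = p') (hs : s + 2 = s') (x : specZ d Fil r p s)
    (y : specZ d Fil r p' s') (hy : (y : V) = d x) :
    ((h.page r).d (p, s) (p', s')).hom (h.cls r p s x) = h.cls r p' s' y := by
  have hij : (p, s) + (-r, 2) = (p', s') := by simp [← hp, ← hs, sub_eq_add_neg]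
  have e : (h.page r).d (p, s) (p', s') = ModuleCat.ofHom (h.pageD hij) := dif_pos hij
  rw [e]
  change Submodule.mkQ _ (d.restrict (h.specZ_map hij) x) = Submodule.mkQ _ y
  congr 1
  exact Subtype.ext hy.symm

theorem specZ_succ_le (r p s : ℤ) : specZ d Fil (r + 1) p s ≤ specZ d Fil r p s := fun _ hx =>
  ⟨hx.1, h.mono _ _ _ (by omega) hx.2⟩

theorem d_cls_succ (r p s : ℤ) (x : specZ d Fil (r + 1) p s) :
    ((h.page r).d (p, s) (p - r, s + 2)).hom
      (h.cls r p s (Submodule.inclusion (h.specZ_succ_le r p s) x)) = 0 := by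
  have hz : d (x : V) ∈ Fil (p - r - 1) (s + 2) := by
    have := x.2.2
    rwa [SetLike.mem_coe, Submodule.mem_comap, ← sub_sub] at this
  have hdd : ∀ q t, d (d (x : V)) ∈ Fil q t := fun q t => by
    rw [h.d_d]
    exact Submodule.zero_mem _
  rw [h.d_cls rfl rfl (Submodule.inclusion (h.specZ_succ_le r p s) x)
    ⟨d x, h.mono _ _ _ (by omega) hz, hdd _ _⟩ rfl, cls_eq_zero]
  exact mem_specB.2 ⟨d x, ⟨hz, hdd _ _⟩, 0, Submodule.zero_mem _, by simp⟩

/-- The cycles of the page `E^r` that are represented by elements of `Z^{r+1}`. -/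
def toCycles (r p s : ℤ) :
    ModuleCat.of K (specZ d Fil (r + 1) p s) ⟶ (h.page r).cycles (p, s) :=
  (h.page r).liftCycles (ModuleCat.ofHom
    (h.cls r p s ∘ₗ Submodule.inclusion (h.specZ_succ_le r p s))) (p - r, s + 2)
    ((ComplexShape.up' ((-r, 2) : ℤ × ℤ)).next_eq' (by simp [sub_eq_add_neg])) <| by
      ext x
      exact h.d_cls_succ r p s x

theorem iCycles_toCycles (r p s : ℤ) (x : specZ d Fil (r + 1) p s) :
    ((h.page r).iCycles (p, s)).hom ((h.toCycles r p s).hom x) =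
      h.cls r p s (Submodule.inclusion (h.specZ_succ_le r p s) x) := by
  have e : h.toCycles r p s ≫ (h.page r).iCycles (p, s) = _ :=
    HomologicalComplex.liftCycles_i _ _ _ _ _
  exact congrArg (fun f => f.hom x) e

/-- The classes in the homology of `E^r` that are represented by elements of `Z^{r+1}`. -/
def toHomology (r p s : ℤ) : specZ d Fil (r + 1) p s →ₗ[K] (h.page r).homology (p, s) :=
  (h.toCycles r p s ≫ (h.page r).homologyπ (p, s)).hom

theorem iCycles_injective {c : ComplexShape (ℤ × ℤ)} (C : HomologicalComplex (ModuleCat.{u} K) c)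
    (i : ℤ × ℤ) : Function.Injective (C.iCycles i).hom :=
  (ModuleCat.mono_iff_injective _).1 inferInstance

theorem homologyπ_eq_zero_iff {c : ComplexShape (ℤ × ℤ)}
    (C : HomologicalComplex (ModuleCat.{u} K) c) {i j : ℤ × ℤ} (hij : c.Rel i j) (z : C.cycles j) :
    (C.homologyπ j).hom z = 0 ↔ ∃ w, (C.d i j).hom w = (C.iCycles j).hom z := by
  have hex := (ShortComplex.exact_of_g_is_cokernel
    (ShortComplex.mk (C.toCycles i j) (C.homologyπ j) (C.toCycles_comp_homologyπ i j))
    (C.homologyIsCokernel i j (c.prev_eq' hij)))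
  have hd : ∀ w, (C.d i j).hom w = (C.iCycles j).hom ((C.toCycles i j).hom w) := by
    intro w
    rw [← ModuleCat.comp_apply, HomologicalComplex.toCycles_i]
  constructor
  · intro hz
    obtain ⟨w, hw⟩ := (ShortComplex.moduleCat_exact_iff _).1 hex z hz
    exact ⟨w, by rw [hd]; exact congrArg _ hw⟩
  · rintro ⟨w, hw⟩
    rw [hd] at hw
    rw [← iCycles_injective h C j hw, ← ModuleCat.comp_apply, C.toCycles_comp_homologyπ]
    rfl

/-- If `x` represents a cycle of `E^r`, then `d x = u + d v` with `u` of filtration at most `p - r -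
1` and `v` of filtration at most `p - 1`. Then `x - v` represents the same class and lies in
`Z^{r+1}`. -/
theorem toHomology_surjective (r p s : ℤ) : Function.Surjective (h.toHomology r p s) := by
  intro y
  obtain ⟨z, rfl⟩ := (ModuleCat.epi_iff_surjective ((h.page r).homologyπ (p, s))).1 inferInstance y
  obtain ⟨x, hx⟩ := h.cls_surjective r p s (((h.page r).iCycles (p, s)).hom z)
  have hdx : ((h.page r).d (p, s) (p - r, s + 2)).hom (h.cls r p s x) = 0 := by
    rw [hx, ← ModuleCat.comp_apply, HomologicalComplex.iCycles_d]
    rfl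
  have hij : ((p, s) : ℤ × ℤ) + (-r, 2) = (p - r, s + 2) := by simp [sub_eq_add_neg]
  rw [h.d_cls rfl rfl x ⟨d x, h.specZ_map hij x x.2⟩ rfl, cls_eq_zero] at hdx
  obtain ⟨u, hu, v, hv, huv⟩ := mem_specB.1 hdx
  have e1 : p - r + r - 1 = p - 1 := by ring
  have e2 : s + 2 - 2 = s := by ring
  rw [e1, e2] at hv
  have hx' : (x : V) - v ∈ specZ d Fil (r + 1) p s := by
    refine ⟨Submodule.sub_mem _ x.2.1 (h.mono _ _ _ (by omega) hv.1), ?_⟩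
    have : d ((x : V) - v) = u := by
      rw [map_sub, sub_eq_iff_eq_add]
      exact huv.symm
    simp only [SetLike.mem_coe, Submodule.mem_comap, this]
    exact h.mono _ _ _ (by omega) hu.1
  refine ⟨⟨(x : V) - v, hx'⟩, ?_⟩
  rw [toHomology]
  change ((h.page r).homologyπ (p, s)).hom ((h.toCycles r p s).hom _) = _
  congr 1
  apply h.iCycles_injective
  rw [iCycles_toCycles, ← hx, ← sub_eq_zero, ← map_sub, cls_eq_zero]
  refine mem_specB.2 ⟨-v, Submodule.neg_mem _ hv, 0, Submodule.zero_mem _, ?_⟩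
  simp

/-- A relation `d w - x = a + d b` in the denominator of `E^r` is rearranged to `x = -a + d (w -
b)`, which is the denominator of `E^{r+1}`; the converse reads the same equation backwards. -/
theorem toHomology_eq_zero {r p s : ℤ} (x : specZ d Fil (r + 1) p s) :
    h.toHomology r p s x = 0 ↔ (x : V) ∈ specB d Fil (r + 1) p s := by
  have hij : ((p + r, s - 2) : ℤ × ℤ) + (-r, 2) = (p, s) := by simp
  change ((h.page r).homologyπ (p, s)).hom ((h.toCycles r p s).hom x) = 0 ↔ _
  rw [homologyπ_eq_zero_iff h _ (i := (p + r, s - 2)) (j := (p, s)) hij, iCycles_toCycles]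
  have e1 : r + 1 - 1 = r := by ring
  have e2 : p + (r + 1) - 1 = p + r := by ring
  constructor
  · rintro ⟨w, hw⟩
    obtain ⟨w, rfl⟩ := h.cls_surjective r _ _ w
    rw [h.d_cls (by ring) (by ring) w ⟨d w, h.specZ_map hij w w.2⟩ rfl, ← sub_eq_zero, ← map_sub,
      cls_eq_zero] at hw
    obtain ⟨a, ha, b, hb, hab⟩ := mem_specB.1 hw
    have hx : (x : V) = -a + d (w - b) := by
      have : a + d b = d w - x := hab
      rw [map_sub, eq_comm, ← sub_eq_zero]
      rw [← sub_eq_zero] at this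
      rw [← neg_eq_zero, ← this]
      abel
    -- The element `a` was only known to lie in `Z^{r-1}`; its differential is that of `-x`, and
    -- this gives the better bound.
    have hda : d a = - d (x : V) := by
      rw [hx, map_add, h.d_d, add_zero, map_neg, neg_neg]
    rw [mem_specB, e1, e2]
    refine ⟨-a, Submodule.neg_mem _ ⟨ha.1, ?_⟩, w - b, Submodule.sub_mem _ w.2 ?_, hx.symm⟩
    · rw [SetLike.mem_coe, Submodule.mem_comap, hda]
      refine Submodule.neg_mem _ (h.mono _ _ _ (by omega) x.2.2)
    · refine ⟨h.mono _ _ _ (by omega) hb.1, h.mono _ _ _ (by omega) hb.2⟩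
  · intro hx
    rw [mem_specB, e1, e2] at hx
    obtain ⟨a, ha, w, hw, haw⟩ := hx
    refine ⟨h.cls r _ _ ⟨w, hw⟩, ?_⟩
    rw [h.d_cls (by ring) (by ring) ⟨w, hw⟩ ⟨d w, h.specZ_map hij w hw⟩ rfl, ← sub_eq_zero,
      ← map_sub, cls_eq_zero]
    refine mem_specB.2 ⟨-a, Submodule.neg_mem _ ⟨ha.1, ?_⟩, 0, Submodule.zero_mem _, ?_⟩
    · exact h.mono _ _ _ (by omega) ha.2
    · rw [map_zero, add_zero, neg_eq_iff_add_eq_zero]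
      change a + (d w - (x : V)) = 0
      rw [← haw]
      abel

/-- The isomorphism from `E^{r+1}` to the homology of `E^r`. -/
def homologyEquiv (r p s : ℤ) : specE d Fil (r + 1) p s ≃ₗ[K] (h.page r).homology (p, s) :=
  LinearEquiv.ofBijective
    (Submodule.liftQ _ (h.toHomology r p s) fun x hx => (h.toHomology_eq_zero x).2 hx) <| by
    constructor
    · rw [injective_iff_map_eq_zero]
      intro y hy
      obtain ⟨x, rfl⟩ := Submodule.mkQ_surjective _ y
      exact (Submodule.Quotient.mk_eq_zero _).2 ((h.toHomology_eq_zero x).1 hy)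
    · intro y
      obtain ⟨x, rfl⟩ := h.toHomology_surjective r p s y
      exact ⟨Submodule.mkQ _ x, rfl⟩

theorem homologyEquiv_symm_π {r p s : ℤ} (x : specZ d Fil (r + 1) p s)
    (z : (h.page r).cycles (p, s)) (hz : ((h.page r).iCycles (p, s)).hom z =
      h.cls r p s (Submodule.inclusion (h.specZ_succ_le r p s) x)) :
    (h.homologyEquiv r p s).symm (((h.page r).homologyπ (p, s)).hom z) = h.cls (r + 1) p s x := by
  refine (h.homologyEquiv r p s).symm_apply_eq.2 ?_
  change _ = ((h.page r).homologyπ (p, s)).hom ((h.toCycles r p s).hom x)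
  congr 1
  apply h.iCycles_injective
  rw [iCycles_toCycles]
  exact hz

/-- The spectral sequence of a filtered complex. -/
def spectralSequence :
    SpectralSequence (ModuleCat.{u} K) (fun r : ℤ => ComplexShape.up' ((-r, 2) : ℤ × ℤ)) 0 where
  page r _ := h.page r
  iso r r' ps hrr' _ := by
    subst hrr'
    exact (h.homologyEquiv r ps.1 ps.2).toModuleIso.symm

/-- The spectral sequence of a filtered complex, with its class maps. -/
def inducedSpectralSequence : InducedSpectralSequence d Fil where
  ss := h.spectralSequence
  cls r _ p s := h.cls r p s
  cls_surjective r _ p s := h.cls_surjective r p s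
  cls_eq_zero r _ p s x := h.cls_eq_zero x
  d_cls r _ p s x y hy := h.d_cls rfl rfl x y hy
  iso_cls r _ p s _ x' hx z hz := h.homologyEquiv_symm_π x' z (hz.trans (congrArg _ (Subtype.ext hx)))

end IsFilteredComplex

end FilteredComplex

end

/-! ### Graded perturbations of a differential -/

/-- Two quotients of a module by the same submodule are isomorphic. -/
theorem exists_linearEquiv_of_ker_eq {R Z A B : Type*} [CommRing R] [AddCommGroup Z] [Module R Z]
    [AddCommGroup A] [Module R A] [AddCommGroup B] [Module R B] (f : Z →ₗ[R] A) (g : Z →ₗ[R] B)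
    (hf : Function.Surjective f) (hg : Function.Surjective g) (h : ∀ z, f z = 0 ↔ g z = 0) :
    ∃ e : A ≃ₗ[R] B, ∀ z, e (f z) = g z := by
  refine ⟨(f.quotKerEquivOfSurjective hf).symm ≪≫ₗ
    Submodule.quotEquivOfEq _ _ (Submodule.ext h : LinearMap.ker f = LinearMap.ker g) ≪≫ₗ g.quotKerEquivOfSurjective hg, fun z => ?_⟩
  have : (f.quotKerEquivOfSurjective hf).symm (f z) = Submodule.Quotient.mk z := by
    rw [LinearEquiv.symm_apply_eq]
    rfl
  rw [LinearEquiv.trans_apply, LinearEquiv.trans_apply, this]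
  rfl

theorem InducedSpectralSequence.cls_eq_cls {K V : Type u} [CommRing K] [AddCommGroup V]
    [Module K V] {d : V →ₗ[K] V} {Fil : ℤ → ℤ → Submodule K V} (E : InducedSpectralSequence d Fil)
    {r : ℤ} (hr : 0 ≤ r) {p s : ℤ} (x y : specZ d Fil r p s) :
    E.cls r hr p s x = E.cls r hr p s y ↔ (x : V) - y ∈ specB d Fil r p s := by
  rw [← sub_eq_zero, ← map_sub, E.cls_eq_zero]
  rfl

section Graded

variable {ι K : Type*} [Fintype ι] [CommRing K] {q δ : ι → ℤ}

variable (K q δ) in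
/-- The functions supported in bidegree `(p, s)`. -/
abbrev gradedPart (p s : ℤ) : Submodule K (ι → K) := spanOn K fun x => q x = p ∧ δ x = s

variable (K q δ) in
/-- The functions supported in filtration at most `p` and degree `s`. -/
abbrev filteredPart (p s : ℤ) : Submodule K (ι → K) := spanOn K fun x => q x ≤ p ∧ δ x = s

variable (K q) in
/-- The projection to the part of degree `p`. -/
noncomputable def gradedProj (p : ℤ) : (ι → K) →ₗ[K] (ι → K) where
  toFun f x := if q x = p then f x else 0
  map_add' f g := by ext x; by_cases h : q x = p <;> simp [h]
  map_smul' k f := by ext x; by_cases h : q x = p <;> simp [h]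

theorem gradedProj_apply (p : ℤ) (f : ι → K) (x : ι) :
    gradedProj K q p f x = if q x = p then f x else 0 := rfl

theorem gradedProj_mem {p s : ℤ} {f : ι → K} (hf : f ∈ spanOn K fun x => δ x = s) :
    gradedProj K q p f ∈ gradedPart K q δ p s := by
  intro x hx
  rw [gradedProj_apply]
  split_ifs with h
  exacts [hf x fun h' => hx ⟨h, h'⟩, rfl]

theorem filteredPart_le (p s : ℤ) : filteredPart K q δ p s ≤ spanOn K fun x => δ x = s :=
  spanOn_mono fun _ h => h.2

theorem gradedPart_le (p s : ℤ) : gradedPart K q δ p s ≤ filteredPart K q δ p s :=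
  spanOn_mono fun _ h => ⟨h.1.le, h.2⟩

theorem sub_gradedProj_mem {p s : ℤ} {f : ι → K} (hf : f ∈ filteredPart K q δ p s) :
    f - gradedProj K q p f ∈ filteredPart K q δ (p - 1) s := by
  intro x hx
  rw [Pi.sub_apply, gradedProj_apply]
  split_ifs with h
  · exact sub_self _
  · rw [sub_zero]
    exact hf x fun h' => hx ⟨by omega, h'.2⟩

theorem gradedProj_eq_zero {p p' s : ℤ} (hp : p' < p) {f : ι → K}
    (hf : f ∈ filteredPart K q δ p' s) : gradedProj K q p f = 0 := by
  ext x
  rw [gradedProj_apply, Pi.zero_apply]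
  split_ifs with h
  exacts [hf x fun h' => by omega, rfl]

theorem gradedProj_eq_self {p s : ℤ} {f : ι → K} (hf : f ∈ gradedPart K q δ p s) :
    gradedProj K q p f = f := by
  ext x
  rw [gradedProj_apply]
  split_ifs with h
  exacts [rfl, (hf x fun h' => h h'.1).symm]

theorem gradedProj_eq_zero_of_ne {p p' s : ℤ} (hp : p' ≠ p) {f : ι → K}
    (hf : f ∈ gradedPart K q δ p' s) : gradedProj K q p f = 0 := by
  ext x
  rw [gradedProj_apply, Pi.zero_apply]
  split_ifs with h
  exacts [hf x fun h' => by omega, rfl]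

theorem sum_gradedProj (f : ι → K) : ∑ p ∈ Finset.univ.image q, gradedProj K q p f = f := by
  ext x
  simp [gradedProj_apply]

variable (q δ) in
/-- The differential `d` is the sum of the homogeneous differential `d₀` and of a part that lowers
the filtration. -/
structure IsPerturbation (d d₀ : (ι → K) →ₗ[K] (ι → K)) : Prop where
  map_gradedPart : ∀ p s, (gradedPart K q δ p s).map d₀ ≤ gradedPart K q δ p (s + 2)
  map_sub_gradedPart : ∀ p s, (gradedPart K q δ p s).map (d - d₀) ≤ filteredPart K q δ (p - 1) (s + 2)
  d_comp_d : d ∘ₗ d = 0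
  d₀_comp_d₀ : d₀ ∘ₗ d₀ = 0

theorem filteredPart_mono {p p' : ℤ} (h : p ≤ p') (s : ℤ) :
    filteredPart K q δ p s ≤ filteredPart K q δ p' s :=
  spanOn_mono fun _ hx => ⟨hx.1.trans h, hx.2⟩

namespace IsPerturbation

variable {d d₀ : (ι → K) →ₗ[K] (ι → K)} (h : IsPerturbation q δ d d₀)
include h

theorem sub_mem {p s : ℤ} {f : ι → K} (hf : f ∈ filteredPart K q δ p s) :
    d f - d₀ f ∈ filteredPart K q δ (p - 1) (s + 2) := by
  classical
  have : (filteredPart K q δ p s).map (d - d₀) ≤ filteredPart K q δ (p - 1) (s + 2) :=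
    map_spanOn_le _ fun x hx => filteredPart_mono (by omega) _
      (h.map_sub_gradedPart (q x) s ⟨_, single_mem_spanOn ⟨rfl, hx.2⟩ 1, rfl⟩)
  exact this ⟨f, hf, rfl⟩

theorem d₀_mem {p s : ℤ} {f : ι → K} (hf : f ∈ filteredPart K q δ p s) :
    d₀ f ∈ filteredPart K q δ p (s + 2) := by
  classical
  have : (filteredPart K q δ p s).map d₀ ≤ filteredPart K q δ p (s + 2) :=
    map_spanOn_le _ fun x hx => filteredPart_mono hx.1 _ (gradedPart_le _ _
      (h.map_gradedPart (q x) s ⟨_, single_mem_spanOn ⟨rfl, hx.2⟩ 1, rfl⟩))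
  exact this ⟨f, hf, rfl⟩

theorem d_mem {p s : ℤ} {f : ι → K} (hf : f ∈ filteredPart K q δ p s) :
    d f ∈ filteredPart K q δ p (s + 2) := by
  rw [← sub_add_cancel (d f) (d₀ f)]
  exact Submodule.add_mem _ (filteredPart_mono (by omega) _ (h.sub_mem hf)) (h.d₀_mem hf)

theorem d₀_gradedProj (p : ℤ) (f : ι → K) :
    d₀ (gradedProj K q p f) = gradedProj K q p (d₀ f) := by
  classical
  suffices d₀ ∘ₗ gradedProj K q p = gradedProj K q p ∘ₗ d₀ from LinearMap.congr_fun this f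
  refine LinearMap.pi_ext' fun x => LinearMap.ext_ring ?_
  change d₀ (gradedProj K q p (Pi.single x 1)) = gradedProj K q p (d₀ (Pi.single x 1))
  have hx : Pi.single x 1 ∈ gradedPart K q δ (q x) (δ x) := single_mem_spanOn ⟨rfl, rfl⟩ 1
  have hd := h.map_gradedPart _ _ ⟨_, hx, rfl⟩
  by_cases hp : q x = p
  · subst hp
    rw [gradedProj_eq_self hx, gradedProj_eq_self hd]
  · rw [gradedProj_eq_zero_of_ne hp hx, gradedProj_eq_zero_of_ne hp hd, map_zero]

end IsPerturbation

end Graded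

/-! ### The pages `E⁰` and `E¹` of a perturbed graded complex -/

section FirstPages

variable {ι K : Type u} [Fintype ι] [CommRing K] {q δ : ι → ℤ}
  {d d₀ : (ι → K) →ₗ[K] (ι → K)}

namespace IsPerturbation

variable (h : IsPerturbation q δ d d₀)
include h

theorem isFilteredComplex : IsFilteredComplex d (filteredPart K q δ) where
  mono _ _ s hp := filteredPart_mono hp s
  map_mem _ _ _ hx := h.d_mem hx
  d_d x := LinearMap.congr_fun h.d_comp_d x

theorem mem_specZ_zero {p s : ℤ} {f : ι → K} :
    f ∈ specZ d (filteredPart K q δ) 0 p s ↔ f ∈ filteredPart K q δ p s := by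
  rw [mem_specZ, sub_zero]
  exact ⟨fun hf => hf.1, fun hf => ⟨hf, h.d_mem hf⟩⟩

/-- For `r = 0` both summands of the denominator have filtration at most `p - 1`, since `d`
preserves the filtration. -/
theorem mem_specB_zero {p s : ℤ} {f : ι → K} :
    f ∈ specB d (filteredPart K q δ) 0 p s ↔ f ∈ filteredPart K q δ (p - 1) s := by
  have hdd : ∀ x, d (d x) = 0 := fun x => LinearMap.congr_fun h.d_comp_d x
  rw [mem_specB]
  constructor
  · rintro ⟨y, hy, z, hz, rfl⟩
    refine Submodule.add_mem _ hy.1 ?_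
    have := h.d_mem hz.1
    rwa [sub_add_cancel, add_zero] at this
  · intro hf
    refine ⟨f, ⟨hf, ?_⟩, 0, Submodule.zero_mem _, by simp⟩
    exact filteredPart_mono (by omega) _ (h.d_mem hf)

variable (E : InducedSpectralSequence d (filteredPart K q δ))

/-- The page `E⁰` is the associated graded complex. -/
theorem exists_gradedPart_equiv (p s : ℤ) :
    ∃ e : gradedPart K q δ p s ≃ₗ[K] (E.ss.page 0 le_rfl).X (p, s),
      ∀ (x : gradedPart K q δ p s) (z : specZ d (filteredPart K q δ) 0 p s),
        (x : ι → K) = z → e x = E.cls 0 le_rfl p s z := by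
  let j : gradedPart K q δ p s →ₗ[K] specZ d (filteredPart K q δ) 0 p s :=
    Submodule.inclusion fun f hf => h.mem_specZ_zero.2 (gradedPart_le _ _ hf)
  refine ⟨LinearEquiv.ofBijective (E.cls 0 le_rfl p s ∘ₗ j) ⟨?_, ?_⟩, ?_⟩
  · rw [injective_iff_map_eq_zero]
    intro x hx
    have hx' := h.mem_specB_zero.1 ((E.cls_eq_zero _ _ _ _ _).1 hx)
    exact Subtype.ext ((gradedProj_eq_self x.2).symm.trans
      (gradedProj_eq_zero (sub_one_lt p) hx'))
  · intro y
    obtain ⟨z, rfl⟩ := E.cls_surjective _ _ _ _ y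
    have hz := h.mem_specZ_zero.1 z.2
    refine ⟨⟨gradedProj K q p z, gradedProj_mem (filteredPart_le _ _ hz)⟩, ?_⟩
    rw [LinearMap.comp_apply, E.cls_eq_cls, h.mem_specB_zero]
    have := Submodule.neg_mem _ (sub_gradedProj_mem hz)
    rwa [neg_sub] at this
  · intro x z hxz
    exact congrArg (E.cls 0 le_rfl p s) (Subtype.ext hxz)

theorem d_gradedPart_equiv {p s t : ℤ} (ht : s + 2 = t)
    (e : gradedPart K q δ p s ≃ₗ[K] (E.ss.page 0 le_rfl).X (p, s))
    (e' : gradedPart K q δ p t ≃ₗ[K] (E.ss.page 0 le_rfl).X (p, t))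
    (he : ∀ (x : gradedPart K q δ p s) (z : specZ d (filteredPart K q δ) 0 p s),
      (x : ι → K) = z → e x = E.cls 0 le_rfl p s z)
    (he' : ∀ (x : gradedPart K q δ p t) (z : specZ d (filteredPart K q δ) 0 p t),
      (x : ι → K) = z → e' x = E.cls 0 le_rfl p t z)
    (x : gradedPart K q δ p s) (y : gradedPart K q δ p t) (hy : (y : ι → K) = d₀ x) :
    ((E.ss.page 0 le_rfl).d (p, s) (p, t)).hom (e x) = e' y := by
  subst ht
  have hx := h.mem_specZ_zero.2 (gradedPart_le _ _ x.2)
  have hy' := h.mem_specZ_zero.2 (gradedPart_le _ _ y.2)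
  have hdx := h.mem_specZ_zero.2 (h.d_mem (gradedPart_le _ _ x.2))
  rw [he x ⟨x, hx⟩ rfl, he' y ⟨y, hy'⟩ rfl]
  -- The spectral sequence has the target index `p - 0`; a variable in its place allows the
  -- substitution by `p`.
  have key : ∀ p', p - 0 = p' → ∀ (v : specZ d (filteredPart K q δ) 0 p' (s + 2)),
      (v : ι → K) = d x → ((E.ss.page 0 le_rfl).d (p, s) (p', s + 2)).hom
        (E.cls 0 le_rfl p s ⟨x, hx⟩) = E.cls 0 le_rfl p' (s + 2) v := by
    rintro _ rfl v hv
    exact E.d_cls 0 le_rfl p s _ v hv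
  rw [key p (sub_zero p) ⟨d x, hdx⟩ rfl, E.cls_eq_cls, h.mem_specB_zero]
  change d x - (y : ι → K) ∈ _
  rw [hy]
  exact h.sub_mem (gradedPart_le _ _ x.2)

/-- The page `E¹` is the homology of the associated graded complex. -/
theorem nonempty_page_one_equiv (p s : ℤ) :
    Nonempty ((E.ss.page 1 zero_le_one).X (p, s) ≃ₗ[K]
      pieceHomology d₀ (gradedPart K q δ p (s - 2)) (gradedPart K q δ p s)) := by
  -- On `Z^1` the leading term of degree `p` is a cycle for `d₀`, because `d x` and `d x - d₀ x`
  -- both lie below `p`. Taking leading terms gives the isomorphism.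
  have hd₀ : ∀ x ∈ specZ d (filteredPart K q δ) 1 p s,
      gradedProj K q p x ∈ LinearMap.ker d₀ ⊓ gradedPart K q δ p s := by
    rintro x ⟨hx, hdx⟩
    refine ⟨?_, gradedProj_mem (filteredPart_le _ _ hx)⟩
    have : d₀ x ∈ filteredPart K q δ (p - 1) (s + 2) := by
      rw [← sub_sub_cancel (d x) (d₀ x)]
      exact Submodule.sub_mem _ hdx (h.sub_mem hx)
    rw [SetLike.mem_coe, LinearMap.mem_ker, h.d₀_gradedProj, gradedProj_eq_zero (sub_one_lt p) this]
  refine (exists_linearEquiv_of_ker_eq (E.cls 1 zero_le_one p s)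
    (Submodule.mkQ _ ∘ₗ (gradedProj K q p).restrict hd₀) (E.cls_surjective _ _ _ _) ?_ ?_).nonempty
  · intro y
    obtain ⟨⟨y, hy, hy'⟩, rfl⟩ := Submodule.mkQ_surjective _ y
    have hyF := gradedPart_le p s hy'
    refine ⟨⟨y, hyF, ?_⟩, ?_⟩
    · have := h.sub_mem hyF
      rw [LinearMap.mem_ker.1 hy, sub_zero] at this
      exact this
    · rw [LinearMap.comp_apply]
      congr 1
      exact Subtype.ext (gradedProj_eq_self hy')
  · intro x
    rw [E.cls_eq_zero, LinearMap.comp_apply, Submodule.mkQ_apply, Submodule.Quotient.mk_eq_zero,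
      mem_specB]
    have e1 : p + 1 - 1 = p := by ring
    have e2 : s - 2 + 2 = s := by ring
    change _ ↔ gradedProj K q p (x : ι → K) ∈ (gradedPart K q δ p (s - 2)).map d₀
    constructor
    · rintro ⟨y, hy, z, hz, hyz⟩
      rw [e1] at hz
      refine ⟨gradedProj K q p z, gradedProj_mem (filteredPart_le _ _ hz.1), ?_⟩
      have h1 := h.sub_mem hz.1
      have h3 : gradedProj K q p y = 0 := gradedProj_eq_zero (sub_one_lt p) hy.1
      rw [← hyz, map_add, h3, zero_add, h.d₀_gradedProj]
      have h2 : gradedProj K q p (d z - d₀ z) = 0 := gradedProj_eq_zero (sub_one_lt p) h1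
      rw [map_sub, sub_eq_zero] at h2
      exact h2.symm
    · rintro ⟨w, hw, hwx⟩
      have hwF := gradedPart_le _ _ hw
      have h1 := h.sub_mem hwF
      rw [e2] at h1
      have h2 : (x : ι → K) - d w ∈ filteredPart K q δ (p - 1) s := by
        have := Submodule.sub_mem _ (sub_gradedProj_mem x.2.1) h1
        rw [← hwx] at this
        convert this using 1
        abel
      refine ⟨x - d w, ⟨h2, ?_⟩, w, ⟨?_, ?_⟩, sub_add_cancel _ _⟩
      · exact filteredPart_mono (by omega) _ (h.d_mem h2)
      · rwa [e1]
      · exact filteredPart_mono (by omega) _ (h.d_mem hwF)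

end IsPerturbation

end FirstPages

/-! ### Convergence -/

section Convergence

variable {K V : Type u} [CommRing K] [AddCommGroup V] [Module K V] {d : V →ₗ[K] V}
  {Fil : ℤ → ℤ → Submodule K V} {D : ℤ → Submodule K V} {a b : ℤ}

namespace IsFilteredComplex

variable (h : IsFilteredComplex d Fil) (E : InducedSpectralSequence d Fil)
  (ha : ∀ p ≤ a, ∀ s, Fil p s = ⊥) (hb : ∀ p ≥ b, ∀ s, Fil p s = D s)

include h hb in
theorem le_of_bounded (p s : ℤ) : Fil p s ≤ D s := by
  rw [← hb (max p b) (le_max_right p b) s]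
  exact h.mono _ _ _ (le_max_left p b)

include h in
theorem d_mem_specZ {r p s : ℤ} {x : V} (hx : x ∈ specZ d Fil r p s) :
    d x ∈ specZ d Fil r (p - r) (s + 2) := by
  refine ⟨hx.2, ?_⟩
  rw [SetLike.mem_coe, Submodule.mem_comap, h.d_d]
  exact Submodule.zero_mem _

include h ha in
theorem d_eq_zero_of_le {r p s : ℤ} (hp : p - r ≤ a) {x : V} (hx : x ∈ specZ d Fil r p s) :
    d x = 0 := by
  have := hx.2
  rwa [SetLike.mem_coe, Submodule.mem_comap, ha _ hp, Submodule.mem_bot] at this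

include h hb in
-- Above the top of the filtration the steps `p - 1` and `p` coincide.
theorem cls_eq_zero_of_gt {r p s : ℤ} (hr : 0 ≤ r) (hp : b < p) (x : specZ d Fil r p s) :
    E.cls r hr p s x = 0 := by
  rw [E.cls_eq_zero, mem_specB]
  refine ⟨x, ⟨?_, ?_⟩, 0, Submodule.zero_mem _, by simp⟩
  · rw [SetLike.mem_coe, hb (p - 1) (by omega)]
    exact h.le_of_bounded hb p s x.2.1
  · rw [sub_sub_sub_cancel_right]
    exact x.2.2

include h ha hb in
-- A differential longer than the filtration either starts above the top, where the page is zero, or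
-- ends at or below the bottom, where `d x` itself is zero.
theorem page_d_eq_zero {r : ℤ} (hr : 0 ≤ r) (hab : b - a ≤ r) (i j : ℤ × ℤ) :
    (E.ss.page r hr).d i j = 0 := by
  by_cases hij : i + (-r, 2) = j
  swap
  · exact (E.ss.page r hr).shape i j hij
  obtain ⟨p, s⟩ := i
  obtain rfl : (p - r, s + 2) = j := by simp [← hij, sub_eq_add_neg]
  refine ModuleCat.hom_ext (LinearMap.ext fun w => ?_)
  obtain ⟨x, rfl⟩ := E.cls_surjective r hr p s w
  change ((E.ss.page r hr).d (p, s) (p - r, s + 2)).hom (E.cls r hr p s x) = 0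
  by_cases hp : b < p
  · rw [h.cls_eq_zero_of_gt E hb hr hp, map_zero]
  · rw [E.d_cls r hr p s x ⟨d x, h.d_mem_specZ x.2⟩ rfl, E.cls_eq_zero]
    have : d (x : V) = 0 := h.d_eq_zero_of_le ha (by omega) x.2
    change d (x : V) ∈ _
    rw [this]
    exact Submodule.zero_mem _

include h ha hb in
-- Both sides are quotients of the cycles in `Fil p s`. For such `r` these cycles already represent
-- all classes of `E^r`, and on both sides the classes that vanish are represented by cycles of
-- lower filtration plus arbitrary boundaries.
theorem exists_page_equiv {r : ℤ} (hr : 0 ≤ r) (hab : b - a + 1 ≤ r) (p s : ℤ) :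
    ∃ ψ : (↥(homologyFiltration d (D (s - 2)) (D s) (Fil p s)) ⧸
        (homologyFiltration d (D (s - 2)) (D s) (Fil (p - 1) s)).submoduleOf
          (homologyFiltration d (D (s - 2)) (D s) (Fil p s))) ≃ₗ[K] (E.ss.page r hr).X (p, s),
      ∀ (z : ↥(LinearMap.ker d ⊓ D s)) (x : specZ d Fil r p s)
        (y : homologyFiltration d (D (s - 2)) (D s) (Fil p s)),
        (z : V) = x → (y : pieceHomology d (D (s - 2)) (D s)) = Submodule.Quotient.mk z →
          ψ (Submodule.Quotient.mk y) = E.cls r hr p s x := by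
  have hle := h.le_of_bounded hb
  have e1 : ∀ t : ℤ, t - 2 + 2 = t := fun t => by ring
  let Z : Submodule K V := LinearMap.ker d ⊓ Fil p s
  have hZ : ∀ z ∈ Z, z ∈ specZ d Fil r p s := by
    rintro z ⟨hz, hz'⟩
    refine ⟨hz', ?_⟩
    rw [SetLike.mem_coe, Submodule.mem_comap, LinearMap.mem_ker.1 hz]
    exact Submodule.zero_mem _
  have hZD : Z ≤ LinearMap.ker d ⊓ D s := inf_le_inf_left _ (hle p s)
  let f₀ : Z →ₗ[K] pieceHomology d (D (s - 2)) (D s) := Submodule.mkQ _ ∘ₗ Submodule.inclusion hZD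
  have hf₀ : ∀ z : Z, f₀ z ∈ homologyFiltration d (D (s - 2)) (D s) (Fil p s) := fun z =>
    ⟨Submodule.inclusion hZD z, z.2.2, rfl⟩
  let f : Z →ₗ[K] ↥(homologyFiltration d (D (s - 2)) (D s) (Fil p s)) ⧸
      (homologyFiltration d (D (s - 2)) (D s) (Fil (p - 1) s)).submoduleOf
        (homologyFiltration d (D (s - 2)) (D s) (Fil p s)) :=
    Submodule.mkQ _ ∘ₗ f₀.codRestrict _ hf₀
  let g : Z →ₗ[K] (E.ss.page r hr).X (p, s) := E.cls r hr p s ∘ₗ Submodule.inclusion hZ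
  have hfs : Function.Surjective f := by
    intro y
    obtain ⟨⟨y, hy⟩, rfl⟩ := Submodule.mkQ_surjective _ y
    obtain ⟨z, hz, rfl⟩ := hy
    exact ⟨⟨z, z.2.1, hz⟩, rfl⟩
  have hgs : Function.Surjective g := by
    intro w
    obtain ⟨x, rfl⟩ := E.cls_surjective r hr p s w
    by_cases hp : b < p
    · exact ⟨0, by rw [map_zero, h.cls_eq_zero_of_gt E hb hr hp]⟩
    · exact ⟨⟨x, h.d_eq_zero_of_le ha (by omega) x.2, x.2.1⟩, rfl⟩
  have hfg : ∀ z, f z = 0 ↔ g z = 0 := by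
    intro z
    have hf : f z = 0 ↔ f₀ z ∈ homologyFiltration d (D (s - 2)) (D s) (Fil (p - 1) s) :=
      Submodule.Quotient.mk_eq_zero _
    have hg : g z = 0 ↔ (z : V) ∈ specB d Fil r p s := E.cls_eq_zero _ _ _ _ _
    rw [hf, hg, mem_specB]
    constructor
    · rintro ⟨w, hw, hwz⟩
      obtain ⟨v, hv, hvw⟩ : w - Submodule.inclusion hZD z ∈
        ((D (s - 2)).map d).submoduleOf (LinearMap.ker d ⊓ D s) := (Submodule.Quotient.eq _).1 hwz
      replace hvw : d v = (w : V) - z := hvw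
      have hw' : (w : V) ∈ Fil (p - 1) s := hw
      have hwd : d (w : V) = 0 := w.2.1
      -- For `p > a` the index `p + r - 1` is at least `b`, so the denominator of `E^r` admits
      -- boundaries of arbitrary elements of the right degree. For `p ≤ a` the element is zero
      -- anyway.
      by_cases hp : p ≤ a
      · have hz := z.2.2
        rw [ha p hp] at hz
        exact ⟨0, Submodule.zero_mem _, 0, Submodule.zero_mem _, by simpa using hz.symm⟩
      · refine ⟨w, ⟨hw', ?_⟩, -v, Submodule.neg_mem _ ⟨?_, ?_⟩, ?_⟩
        · rw [SetLike.mem_coe, Submodule.mem_comap, hwd]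
          exact Submodule.zero_mem _
        · rwa [SetLike.mem_coe, hb _ (by omega)]
        · rw [SetLike.mem_coe, Submodule.mem_comap, hvw, e1]
          have e2 : p + r - 1 - (r - 1) = p := by ring
          rw [e2]
          exact Submodule.sub_mem _ (h.mono _ _ _ (by omega) hw') z.2.2
        · rw [map_neg, hvw, neg_sub, add_sub_cancel]
    · rintro ⟨y, hy, v, hv, hyv⟩
      have hyd : d y = 0 := by
        have : d (y + d v) = 0 := by
          rw [hyv]
          exact z.2.1
        rwa [map_add, h.d_d, add_zero] at this
      refine ⟨⟨y, hyd, hle _ _ hy.1⟩, hy.1, (Submodule.Quotient.eq _).2 ?_⟩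
      refine ⟨-v, Submodule.neg_mem _ (hle _ _ hv.1), ?_⟩
      change d (-v) = y - (z : V)
      rw [← hyv, map_neg]
      abel
  obtain ⟨ψ, hψ⟩ := exists_linearEquiv_of_ker_eq f g hfs hgs hfg
  refine ⟨ψ, fun z x y hzx hyz => ?_⟩
  have hz : (z : V) ∈ Z := ⟨z.2.1, by rw [hzx]; exact x.2.1⟩
  have e2 : Submodule.Quotient.mk y = f ⟨z, hz⟩ := by
    change _ = Submodule.Quotient.mk _
    congr 1
    exact Subtype.ext hyz
  have e3 : E.cls r hr p s x = g ⟨z, hz⟩ := congrArg (E.cls r hr p s) (Subtype.ext hzx.symm)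
  rw [e2, hψ, e3]

theorem homologyFiltration_bot (A B : Submodule K V) : homologyFiltration d A B ⊥ = ⊥ := by
  rw [eq_bot_iff]
  rintro _ ⟨z, hz, rfl⟩
  have : z = 0 := Subtype.ext hz
  rw [this, map_zero]
  exact Submodule.zero_mem _

theorem homologyFiltration_self (A B : Submodule K V) : homologyFiltration d A B B = ⊤ := by
  rw [eq_top_iff]
  rintro y -
  obtain ⟨z, rfl⟩ := Submodule.mkQ_surjective _ y
  exact ⟨z, z.2.2, rfl⟩

end IsFilteredComplex

end Convergence

section Bounds

variable {ι K : Type*} [Fintype ι] [CommRing K] (q δ : ι → ℤ)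

theorem exists_filteredPart_bounds : ∃ a b : ℤ,
    (∀ p ≤ a, ∀ s, filteredPart K q δ p s = ⊥) ∧
      ∀ p ≥ b, ∀ s, filteredPart K q δ p s = spanOn K fun x => δ x = s := by
  obtain ⟨B, hB⟩ := (Set.finite_range q).bddAbove
  obtain ⟨A, hA⟩ := (Set.finite_range q).bddBelow
  -- The value `A` may be attained by `q`, so the filtration is zero only from `A - 1` downwards.
  refine ⟨A - 1, B, fun p hp s => ?_, fun p hp s => ?_⟩
  · rw [eq_bot_iff]
    intro f hf
    ext x
    refine hf x fun hx => ?_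
    have := hA ⟨x, rfl⟩
    omega
  · refine le_antisymm (filteredPart_le p s) (spanOn_mono fun x hx => ⟨?_, hx⟩)
    exact (hB ⟨x, rfl⟩).trans hp

end Bounds

/-! ### The homology of a graded complex -/

section DirectSum

variable {ι K : Type*} [Fintype ι] [CommRing K] {q δ : ι → ℤ}
  {d d₀ : (ι → K) →ₗ[K] (ι → K)} (h : IsPerturbation q δ d d₀)

include h in
-- Since `d₀` preserves `q`, the components of cycles and of boundaries are again cycles and
-- boundaries.
theorem IsPerturbation.nonempty_directSum_equiv (s : ℤ) :
    Nonempty ((DirectSum ℤ fun p =>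
      pieceHomology d₀ (gradedPart K q δ p (s - 2)) (gradedPart K q δ p s)) ≃ₗ[K]
      pieceHomology d₀ (spanOn K fun x => δ x = s - 2) (spanOn K fun x => δ x = s)) := by
  classical
  let Z : Submodule K (ι → K) := LinearMap.ker d₀ ⊓ spanOn K fun x => δ x = s
  have hπ : ∀ p, ∀ z ∈ Z, gradedProj K q p z ∈ LinearMap.ker d₀ ⊓ gradedPart K q δ p s := by
    rintro p z ⟨hz, hz'⟩
    refine ⟨?_, gradedProj_mem hz'⟩
    rw [SetLike.mem_coe, LinearMap.mem_ker, h.d₀_gradedProj, LinearMap.mem_ker.1 hz, map_zero]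
  let φ : ∀ p, Z →ₗ[K] pieceHomology d₀ (gradedPart K q δ p (s - 2)) (gradedPart K q δ p s) :=
    fun p => Submodule.mkQ _ ∘ₗ (gradedProj K q p).restrict (hπ p)
  have hφ : ∀ p (z : Z), φ p z = 0 ↔
      gradedProj K q p (z : ι → K) ∈ (gradedPart K q δ p (s - 2)).map d₀ := fun p z =>
    Submodule.Quotient.mk_eq_zero _
  -- Only the finitely many values of `q` occur, which keeps the map inside the direct sum.
  let f : Z →ₗ[K] DirectSum ℤ fun p =>
      pieceHomology d₀ (gradedPart K q δ p (s - 2)) (gradedPart K q δ p s) :=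
    ∑ p ∈ Finset.univ.image q, DirectSum.lof K ℤ _ p ∘ₗ φ p
  have hf : ∀ z p, f z p = φ p z := by
    intro z p
    have e : f z = ∑ p ∈ Finset.univ.image q, DirectSum.lof K ℤ _ p (φ p z) := by
      simp [f, LinearMap.sum_apply]
    rw [e, DFinsupp.finsetSum_apply]
    by_cases hp : p ∈ Finset.univ.image q
    · rw [Finset.sum_eq_single p]
      · exact DirectSum.lof_apply K p _
      · intro p' _ hp'
        exact DFinsupp.single_eq_of_ne hp'.symm
      · exact fun h' => (h' hp).elim
    · have : φ p z = 0 := by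
        rw [hφ]
        have : gradedProj K q p (z : ι → K) = 0 := by
          ext x
          rw [gradedProj_apply, if_neg]
          · rfl
          · rintro rfl
            exact hp (Finset.mem_image_of_mem q (Finset.mem_univ x))
        rw [this]
        exact Submodule.zero_mem _
      rw [this]
      refine Finset.sum_eq_zero fun p' hp' => DFinsupp.single_eq_of_ne ?_
      rintro rfl
      exact hp hp'
  have hfs : Function.Surjective f := by
    rw [← LinearMap.range_eq_top, eq_top_iff]
    rintro w -
    induction w using DirectSum.induction_on with
    | zero => exact Submodule.zero_mem _
    | add x y hx hy => exact Submodule.add_mem _ hx hy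
    | of p y =>
      obtain ⟨⟨y, hy, hy'⟩, rfl⟩ := Submodule.mkQ_surjective _ y
      refine ⟨⟨y, hy, spanOn_mono (fun _ hx => hx.2) hy'⟩, ?_⟩
      refine DFinsupp.ext fun p' => ?_
      rw [hf]
      by_cases hp : p = p'
      · subst hp
        rw [DirectSum.of_eq_same]
        change Submodule.mkQ _ _ = _
        congr 1
        exact Subtype.ext (gradedProj_eq_self hy')
      · rw [DirectSum.of_eq_of_ne _ _ _ (Ne.symm hp), hφ]
        change gradedProj K q p' y ∈ _
        rw [gradedProj_eq_zero_of_ne hp hy']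
        exact Submodule.zero_mem _
  have hker : ∀ z, f z = 0 ↔ Submodule.mkQ
      (((spanOn K fun x => δ x = s - 2).map d₀).submoduleOf Z) z = 0 := by
    intro z
    have hf0 : f z = 0 ↔ ∀ p, φ p z = 0 := by
      rw [DFinsupp.ext_iff]
      exact forall_congr' fun p => by rw [hf]; rfl
    rw [hf0, Submodule.mkQ_apply, Submodule.Quotient.mk_eq_zero]
    simp only [hφ]
    change _ ↔ (z : ι → K) ∈ (spanOn K fun x => δ x = s - 2).map d₀
    constructor
    · intro hz
      rw [← sum_gradedProj (q := q) (z : ι → K)]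
      exact Submodule.sum_mem _ fun p _ =>
        Submodule.map_mono (spanOn_mono fun _ hx => hx.2) (hz p)
    · rintro ⟨w, hw, hwz⟩ p
      exact ⟨gradedProj K q p w, gradedProj_mem hw, by rw [h.d₀_gradedProj, hwz]⟩
  exact (exists_linearEquiv_of_ker_eq (A := DirectSum ℤ fun p =>
    pieceHomology d₀ (gradedPart K q δ p (s - 2)) (gradedPart K q δ p s)) f _ hfs
    (Submodule.mkQ_surjective _) hker).nonempty

end DirectSum

/-! ### Ranks -/

section Ranks

/-- Rank-nullity reduces the dimension of homology to ranks of `d`. Base change and the rank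
inequality then become statements about ranks. -/
theorem finrank_pieceHomology {K V : Type*} [Field K] [AddCommGroup V] [Module K V]
    [FiniteDimensional K V] (d : V →ₗ[K] V) {A B : Submodule K V} (hAB : A.map d ≤ B)
    (hd : ∀ x ∈ A, d (d x) = 0) :
    Module.finrank K (pieceHomology d A B) + Module.finrank K (A.map d) +
      Module.finrank K (B.map d) = Module.finrank K B := by
  have hle : A.map d ≤ LinearMap.ker d ⊓ B := by
    refine le_inf ?_ hAB
    rintro _ ⟨x, hx, rfl⟩
    exact hd x hx
  have h1 := Submodule.finrank_quotient_add_finrank ((A.map d).submoduleOf (LinearMap.ker d ⊓ B))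
  rw [(Submodule.submoduleOfEquivOfLe hle).finrank_eq] at h1
  change Module.finrank K (pieceHomology d A B) + _ = _ at h1
  have h2 := LinearMap.finrank_range_add_finrank_ker (d.domRestrict B)
  have h3 : LinearMap.ker (d.domRestrict B) = (LinearMap.ker d ⊓ B).submoduleOf B := by
    ext x
    exact ⟨fun hx => ⟨hx, x.2⟩, fun hx => hx.1⟩
  rw [LinearMap.range_domRestrict, h3,
    (Submodule.submoduleOfEquivOfLe (inf_le_right : LinearMap.ker d ⊓ B ≤ B)).finrank_eq] at h2
  omega

theorem spanOn_eq_span {ι K : Type*} [Fintype ι] [DecidableEq ι] [CommRing K] (P : ι → Prop) :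
    spanOn K P = Submodule.span K (Set.range fun x : {x // P x} => (Pi.single x.1 1 : ι → K)) := by
  refine le_antisymm ?_ (Submodule.span_le.2 ?_)
  · have := map_spanOn_le (P := P) (LinearMap.id : (ι → K) →ₗ[K] (ι → K))
      (W := Submodule.span K (Set.range fun x : {x // P x} => (Pi.single x.1 1 : ι → K)))
      fun x hx => Submodule.subset_span ⟨⟨x, hx⟩, rfl⟩
    rwa [Submodule.map_id] at this
  · rintro _ ⟨x, rfl⟩
    exact single_mem_spanOn x.2 1

/-- A maximal independent subfamily over `k` stays independent over `K` and still spans. -/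
theorem finrank_span_algebraMap_comp {ι ι' k K : Type*} [Field k] [Field K] [Algebra k K]
    [Finite ι] [Finite ι'] (v : ι' → ι → k) :
    Module.finrank K (Submodule.span K (Set.range fun i => algebraMap k K ∘ v i)) =
      Module.finrank k (Submodule.span k (Set.range v)) := by
  obtain ⟨κ, a, ha, hspan, hli⟩ := exists_linearIndependent' k v
  have : Finite κ := Finite.of_injective a ha
  have := Fintype.ofFinite κ
  have hli' : LinearIndependent K fun i => algebraMap k K ∘ (v ∘ a) i :=
    linearIndependent_algebraMap_comp_iff.2 hli
  have hspan' : Submodule.span K (Set.range fun i => algebraMap k K ∘ v i) =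
      Submodule.span K (Set.range fun i => algebraMap k K ∘ (v ∘ a) i) := by
    refine le_antisymm (Submodule.span_le.2 ?_) (Submodule.span_mono ?_)
    · have key : ∀ w ∈ Submodule.span k (Set.range (v ∘ a)), algebraMap k K ∘ w ∈
          Submodule.span K (Set.range fun i => algebraMap k K ∘ (v ∘ a) i) := by
        intro w hw
        induction hw using Submodule.span_induction with
        | mem x hx =>
          obtain ⟨j, rfl⟩ := hx
          exact Submodule.subset_span ⟨j, rfl⟩
        | zero =>
          convert Submodule.zero_mem _
          ext x
          simp
        | add x y _ _ hx hy =>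
          convert Submodule.add_mem _ hx hy using 1
          ext i
          simp
        | smul c x _ hx =>
          convert Submodule.smul_mem _ (algebraMap k K c) hx using 1
          ext i
          simp
      rintro _ ⟨i, rfl⟩
      refine key (v i) ?_
      rw [hspan]
      exact Submodule.subset_span ⟨i, rfl⟩
    · rintro _ ⟨i, rfl⟩
      exact ⟨a i, rfl⟩
  rw [hspan', finrank_span_eq_card hli', ← hspan, finrank_span_eq_card hli]

variable {ι : Type*} [Fintype ι]

theorem finrank_map_spanOn {k K : Type*} [Field k] [Field K] [Algebra k K] [DecidableEq ι]
    (f : (ι → k) →ₗ[k] (ι → k)) (g : (ι → K) →ₗ[K] (ι → K))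
    (hfg : ∀ x, g (Pi.single x 1) = algebraMap k K ∘ f (Pi.single x 1)) (P : ι → Prop) :
    Module.finrank K ((spanOn K P).map g) = Module.finrank k ((spanOn k P).map f) := by
  rw [spanOn_eq_span, spanOn_eq_span, Submodule.map_span, Submodule.map_span, ← Set.range_comp,
    ← Set.range_comp, ← finrank_span_algebraMap_comp (k := k) (K := K)]
  exact congrArg (fun v : {x // P x} → ι → K =>
    Module.finrank K (Submodule.span K (Set.range v))) (funext fun x => hfg x.1)

theorem finrank_spanOn {k K : Type*} [Field k] [Field K] [Algebra k K] (P : ι → Prop) :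
    Module.finrank K (spanOn K P) = Module.finrank k (spanOn k P) := by
  classical
  have := finrank_map_spanOn (LinearMap.id : (ι → k) →ₗ[k] (ι → k))
    (LinearMap.id : (ι → K) →ₗ[K] (ι → K)) (fun x => by
      ext y
      by_cases h : y = x
      · subst h
        simp
      · simp [h]) P
  rwa [Submodule.map_id, Submodule.map_id] at this

/-- The homology over an extension field of a complex which is defined over the base field. -/
theorem nonempty_pieceHomology_equiv {k K : Type*} [Field k] [Field K] [Algebra k K]
    [DecidableEq ι] {f : (ι → k) →ₗ[k] (ι → k)} {g : (ι → K) →ₗ[K] (ι → K)}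
    (hfg : ∀ x, g (Pi.single x 1) = algebraMap k K ∘ f (Pi.single x 1)) (hf : f ∘ₗ f = 0)
    (hg : g ∘ₗ g = 0) {P Q : ι → Prop} (hPQ : (spanOn k P).map f ≤ spanOn k Q)
    (hPQ' : (spanOn K P).map g ≤ spanOn K Q) :
    Nonempty (pieceHomology g (spanOn K P) (spanOn K Q) ≃ₗ[K]
      TensorProduct k K (pieceHomology f (spanOn k P) (spanOn k Q))) := by
  -- Over a field only the dimensions have to agree, so no comparison map is constructed.
  refine FiniteDimensional.nonempty_linearEquiv_of_finrank_eq ?_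
  rw [Module.finrank_baseChange]
  have h1 := finrank_pieceHomology g hPQ' fun x _ => LinearMap.congr_fun hg x
  have h2 := finrank_pieceHomology f hPQ fun x _ => LinearMap.congr_fun hf x
  rw [finrank_map_spanOn f g hfg, finrank_map_spanOn f g hfg, finrank_spanOn (k := k)] at h1
  omega

variable {K : Type*} [Field K] {q δ : ι → ℤ} {d d₀ : (ι → K) →ₗ[K] (ι → K)}

namespace IsPerturbation

variable (h : IsPerturbation q δ d d₀)
include h

/-- Passing from filtration `p - 1` to `p` increases the rank of `d₀` by at most its rank on the
graded piece. The rank of `d` increases by at least as much: the leading terms of `d (Fil p)`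
include `d₀` of the graded piece, and `d (Fil (p - 1))` has zero leading term. -/
theorem finrank_map_succ_le {p s : ℤ}
    (hp : Module.finrank K ((filteredPart K q δ (p - 1) s).map d₀) ≤
      Module.finrank K ((filteredPart K q δ (p - 1) s).map d)) :
    Module.finrank K ((filteredPart K q δ p s).map d₀) ≤
      Module.finrank K ((filteredPart K q δ p s).map d) := by
  have h1 : (filteredPart K q δ p s).map d₀ ≤
      (gradedPart K q δ p s).map d₀ ⊔ (filteredPart K q δ (p - 1) s).map d₀ := by
    rw [← Submodule.map_sup]
    refine Submodule.map_mono fun f hf => ?_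
    rw [← add_sub_cancel (gradedProj K q p f) f]
    exact Submodule.add_mem_sup (gradedProj_mem (filteredPart_le _ _ hf)) (sub_gradedProj_mem hf)
  have h2 := (Submodule.finrank_mono h1).trans (Submodule.finrank_add_le_finrank_add_finrank _ _)
  let A := (filteredPart K q δ p s).map d
  have h3 := LinearMap.finrank_range_add_finrank_ker ((gradedProj K q p).domRestrict A)
  have h4 : Module.finrank K ((gradedPart K q δ p s).map d₀) ≤
      Module.finrank K (LinearMap.range ((gradedProj K q p).domRestrict A)) := by
    refine Submodule.finrank_mono ?_
    rintro _ ⟨x, hx, rfl⟩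
    have hxF := gradedPart_le _ _ hx
    refine ⟨⟨d x, x, hxF, rfl⟩, ?_⟩
    have h5 : gradedProj K q p (d x - d₀ x) = 0 :=
      gradedProj_eq_zero (sub_one_lt p) (h.sub_mem hxF)
    rw [map_sub, sub_eq_zero, ← h.d₀_gradedProj, gradedProj_eq_self hx] at h5
    exact h5
  have h6 : Module.finrank K ((filteredPart K q δ (p - 1) s).map d) ≤
      Module.finrank K (LinearMap.ker ((gradedProj K q p).domRestrict A)) := by
    have h7 : (filteredPart K q δ (p - 1) s).map d ≤ A :=
      Submodule.map_mono (filteredPart_mono (by omega) s)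
    rw [← (Submodule.submoduleOfEquivOfLe h7).finrank_eq]
    refine Submodule.finrank_mono ?_
    rintro ⟨_, _⟩ ⟨x, hx, rfl⟩
    exact gradedProj_eq_zero (sub_one_lt p) (h.d_mem hx)
  change _ ≤ Module.finrank K A
  omega

theorem finrank_map_le (s : ℤ) : Module.finrank K ((spanOn K fun x => δ x = s).map d₀) ≤
    Module.finrank K ((spanOn K fun x => δ x = s).map d) := by
  obtain ⟨a, b, ha, hb⟩ := exists_filteredPart_bounds (K := K) q δ
  have key : ∀ p ≥ a, Module.finrank K ((filteredPart K q δ p s).map d₀) ≤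
      Module.finrank K ((filteredPart K q δ p s).map d) := by
    intro p hp
    induction p, hp using Int.leInduction with
    | base => rw [ha a le_rfl, Submodule.map_bot, Submodule.map_bot]
    | succ p _ ih =>
      refine h.finrank_map_succ_le ?_
      rwa [add_sub_cancel_right]
  have := key (max a b) (le_max_left a b)
  rwa [hb _ (le_max_right a b)] at this

/-- The chain spaces are the same for both differentials, so the larger rank of `d` makes its
homology smaller. -/
theorem finrank_pieceHomology_le (s : ℤ) :
    Module.finrank K (pieceHomology d (spanOn K fun x => δ x = s - 2) (spanOn K fun x => δ x = s)) ≤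
    Module.finrank K
      (pieceHomology d₀ (spanOn K fun x => δ x = s - 2) (spanOn K fun x => δ x = s)) := by
  obtain ⟨a, b, ha, hb⟩ := exists_filteredPart_bounds (K := K) q δ
  have e : s - 2 + 2 = s := by ring
  have h1 := finrank_pieceHomology d (A := spanOn K fun x => δ x = s - 2)
    (B := spanOn K fun x => δ x = s) (by
      rintro _ ⟨x, hx, rfl⟩
      rw [SetLike.mem_coe, ← hb b le_rfl] at hx
      have := filteredPart_le _ _ (h.d_mem hx)
      rwa [e] at this) fun x _ => LinearMap.congr_fun h.d_comp_d x
  have h2 := finrank_pieceHomology d₀ (A := spanOn K fun x => δ x = s - 2)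
    (B := spanOn K fun x => δ x = s) (by
      rintro _ ⟨x, hx, rfl⟩
      rw [SetLike.mem_coe, ← hb b le_rfl] at hx
      have := filteredPart_le _ _ (h.d₀_mem hx)
      rwa [e] at this) fun x _ => LinearMap.congr_fun h.d₀_comp_d₀ x
  have h3 := h.finrank_map_le s
  have h4 := h.finrank_map_le (s - 2)
  omega

end IsPerturbation

end Ranks

/-! ### The totally twisted complex as a perturbation of the Khovanov complex -/

noncomputable section

open scoped Classical

namespace LinkDiagram

variable {X O F : Type u} [Fintype X] [Fintype O] [Fintype F] (L : LinkDiagram X O F)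
variable (K : Type*) [CommRing K]

theorem bigradedPart_eq (h p : ℤ) :
    L.bigradedPart K h p = gradedPart K L.qDeg L.deltaDeg p (2 * h - p) := by
  refine congrArg (spanOn K) (funext fun x => propext ?_)
  rw [deltaDeg]
  omega

/-- `∂_KH` raises `h` by one and fixes `q`, whereas `∂_𝒱` fixes `h` and lowers `q` by two; both
raise `δ = 2h - q` by two. -/
theorem isPerturbation [CharP K 2] [Algebra L.faceRing K] :
    IsPerturbation L.qDeg L.deltaDeg (L.twistedDiff K) (L.khovanovDiff K) where
  map_gradedPart p s := by
    refine map_spanOn_le _ ?_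
    rintro x ⟨rfl, rfl⟩
    have := khovanovDiff_map_le K (L.hDeg x) (L.qDeg x) ⟨_, single_mem_spanOn ⟨rfl, rfl⟩ 1, rfl⟩
    rw [bigradedPart_eq] at this
    have e : 2 * (L.hDeg x + 1) - L.qDeg x = L.deltaDeg x + 2 := by
      rw [deltaDeg]
      ring
    rwa [e] at this
  map_sub_gradedPart p s := by
    have e : L.twistedDiff K - L.khovanovDiff K = L.koszulDiff K := add_sub_cancel_left _ _
    rw [e]
    refine map_spanOn_le _ ?_
    rintro x ⟨rfl, rfl⟩
    have := koszulDiff_map_le K (L.hDeg x) (L.qDeg x) ⟨_, single_mem_spanOn ⟨rfl, rfl⟩ 1, rfl⟩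
    refine spanOn_mono (fun y hy => ⟨?_, ?_⟩) this
    · omega
    · rw [deltaDeg, deltaDeg]
      omega
  d_comp_d := L.twistedDiff_comp_self K
  d₀_comp_d₀ := L.khovanovDiff_comp_self K

/-- The sum of the two gradings is `2h`. -/
theorem gradedPart_eq_bot {p s : ℤ} (h : Odd (p + s)) :
    gradedPart K L.qDeg L.deltaDeg p s = ⊥ := by
  rw [eq_bot_iff]
  intro f hf
  funext x
  refine hf x ?_
  rintro ⟨rfl, rfl⟩
  rw [deltaDeg, Int.odd_iff] at h
  omega

theorem khovanovDiff_single (k : Type*) [CommRing k] [Algebra k K] (x : L.PureState) :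
    L.khovanovDiff K (Pi.single x 1) = algebraMap k K ∘ L.khovanovDiff k (Pi.single x 1) := by
  funext y
  simp only [khovanovDiff, Matrix.mulVecLin_apply, Matrix.mulVec_single_one, Matrix.col_apply,
    Matrix.of_apply, Function.comp_apply]
  split_ifs <;> simp

theorem nonempty_KH_equiv (h p : ℤ) :
    Nonempty (pieceHomology (L.khovanovDiff L.faceField)
        (gradedPart L.faceField L.qDeg L.deltaDeg p (2 * h - p - 2))
        (gradedPart L.faceField L.qDeg L.deltaDeg p (2 * h - p)) ≃ₗ[L.faceField]
      TensorProduct (ZMod 2) L.faceField (L.KH (ZMod 2) h p)) := by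
  have e : 2 * h - p - 2 = 2 * (h - 1) - p := by ring
  rw [e, ← bigradedPart_eq, ← bigradedPart_eq]
  refine nonempty_pieceHomology_equiv (khovanovDiff_single L L.faceField (ZMod 2))
    (L.khovanovDiff_comp_self _) (L.khovanovDiff_comp_self _) ?_ ?_
  · have := khovanovDiff_map_le (L := L) (ZMod 2) (h - 1) p
    rwa [sub_add_cancel] at this
  · have := khovanovDiff_map_le (L := L) L.faceField (h - 1) p
    rwa [sub_add_cancel] at this

end LinkDiagram
end

/-! ### Gaussian elimination -/

/-- The basis is divided into `plus` elements, `minus` elements and other elements, and the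
component of `d` from the `plus` to the `minus` elements is triangular with respect to the
bijection `σ`. -/
structure IsTriangular {ι K : Type*} [DecidableEq ι] [CommRing K] (d : (ι → K) →ₗ[K] (ι → K))
    (plus minus : ι → Prop) (σ τ : ι → ι) (lev : ι → ℕ) : Prop where
  plus_τ : ∀ x, minus x → plus (τ x)
  minus_σ : ∀ x, plus x → minus (σ x)
  σ_τ : ∀ x, minus x → σ (τ x) = x
  τ_σ : ∀ x, plus x → τ (σ x) = x
  lev_σ : ∀ x, plus x → lev (σ x) = lev x
  diag : ∀ y, plus y → d (Pi.single y 1) (σ y) ≠ 0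
  lt : ∀ y x, plus y → minus x → d (Pi.single y 1) x ≠ 0 → x = σ y ∨ lev y < lev x

section Triangular

variable {ι K : Type*} [Fintype ι] [DecidableEq ι] [Field K] {d : (ι → K) →ₗ[K] (ι → K)}
  {plus minus : ι → Prop} {σ τ : ι → ι} {lev : ι → ℕ}

theorem apply_eq_sum_single {R M : Type*} [CommRing R] [AddCommGroup M] [Module R M]
    (f : (ι → R) →ₗ[R] M) (u : ι → R) : f u = ∑ y, u y • f (Pi.single y 1) := by
  rw [LinearMap.pi_apply_eq_sum_univ f u]
  refine Finset.sum_congr rfl fun y _ => ?_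
  congr 2
  funext x
  simp [Pi.single_apply, eq_comm]

namespace IsTriangular

variable (h : IsTriangular d plus minus σ τ lev)
include h

/-- By induction on the level: at `σ y` the only plus elements that can contribute to `d u` are `y`
itself and those of lower level, where `u` already vanishes. -/
theorem eq_zero_of_map_eq_zero {u : ι → K} (hu : u ∈ spanOn K plus)
    (hd : ∀ x, minus x → d u x = 0) : u = 0 := by
  have key : ∀ n y, lev y = n → u y = 0 := by
    intro n
    induction n using Nat.strong_induction_on with
    | _ n ih =>
      rintro y rfl
      by_contra hy
      have hp : plus y := by_contra fun hp => hy (hu y hp)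
      have h0 := hd _ (h.minus_σ y hp)
      rw [apply_eq_sum_single, Finset.sum_apply, Finset.sum_eq_single y] at h0
      · rcases mul_eq_zero.1 h0 with h1 | h1
        exacts [hy h1, h.diag y hp h1]
      · intro z _ hzy
        rw [Pi.smul_apply, smul_eq_mul, mul_eq_zero]
        by_contra! hz
        have hpz : plus z := by_contra fun hp => hz.1 (hu z hp)
        rcases h.lt z _ hpz (h.minus_σ y hp) hz.2 with h1 | h1
        · apply hzy
          rw [← h.τ_σ z hpz, ← h1, h.τ_σ y hp]
        · rw [h.lev_σ y hp] at h1
          exact hz.1 (ih _ h1 z rfl)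
      · exact fun h' => (h' (Finset.mem_univ y)).elim
  funext y
  exact key _ y rfl

variable {δ : ι → ℤ} (hδ : ∀ y x, d (Pi.single y 1) x ≠ 0 → δ x = δ y + 2)
include hδ

/-- Back substitution from the highest level downwards. The basis vector `τ x` hits `x` with nonzero
coefficient, and its other minus components have higher level and are removed by induction. The
bounds on level and degree are carried along because the support of the solution is needed for the
tree complex. -/
theorem exists_map_eq_single (x : ι) (hx : minus x) :
    ∃ u ∈ spanOn K fun y => plus y ∧ lev x ≤ lev y ∧ δ y + 2 = δ x,
      ∀ z, minus z → d u z = (Pi.single x 1 : ι → K) z := by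
  classical
  obtain ⟨N, hN⟩ := (Set.finite_range lev).bddAbove
  have key : ∀ n x, minus x → N - lev x = n →
      ∃ u ∈ spanOn K fun y => plus y ∧ lev x ≤ lev y ∧ δ y + 2 = δ x,
        ∀ z, minus z → d u z = (Pi.single x 1 : ι → K) z := by
    intro n
    induction n using Nat.strong_induction_on with
    | _ n ih =>
      rintro x hx rfl
      have hy := h.plus_τ x hx
      have hyx := h.σ_τ x hx
      have hdiag := h.diag _ hy
      have hlev := h.lev_σ _ hy
      rw [hyx] at hdiag hlev
      -- Corrections for the unwanted components of `d (τ x)`, with zero as correction where there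
      -- is nothing to remove.
      have hsub : ∀ z, ∃ u ∈ spanOn K fun y => plus y ∧ lev x ≤ lev y ∧ δ y + 2 = δ x,
          ∀ w, minus w → d u w =
            if minus z ∧ z ≠ x then d (Pi.single (τ x) 1) z * (Pi.single z 1 : ι → K) w else 0 := by
        intro z
        by_cases hz : (minus z ∧ z ≠ x) ∧ d (Pi.single (τ x) 1) z ≠ 0
        · have hlt : lev x < lev z := by
            rcases h.lt _ z hy hz.1.1 hz.2 with h1 | h1
            · exact (hz.1.2 (h1.trans hyx)).elim
            · omega
          have hzN : lev z ≤ N := hN ⟨z, rfl⟩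
          obtain ⟨u, hu, hu'⟩ := ih (N - lev z) (by omega) z hz.1.1 rfl
          refine ⟨d (Pi.single (τ x) 1) z • u, Submodule.smul_mem _ _ (spanOn_mono ?_ hu), ?_⟩
          · rintro y ⟨h1, h2, h3⟩
            refine ⟨h1, by omega, ?_⟩
            rw [h3, hδ _ _ hz.2, hδ _ _ hdiag]
          · intro w hw
            rw [if_pos hz.1, map_smul, Pi.smul_apply, hu' w hw, smul_eq_mul]
        · refine ⟨0, Submodule.zero_mem _, fun w _ => ?_⟩
          rw [map_zero, Pi.zero_apply]
          split_ifs with h1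
          · have : d (Pi.single (τ x) 1) z = 0 := by
              by_contra h2
              exact hz ⟨h1, h2⟩
            rw [this, zero_mul]
          · rfl
      choose u hu hu' using hsub
      refine ⟨(d (Pi.single (τ x) 1) x)⁻¹ • (Pi.single (τ x) 1 - ∑ z, u z),
        Submodule.smul_mem _ _ (Submodule.sub_mem _ (single_mem_spanOn ⟨hy, hlev.le, (hδ _ _ hdiag).symm⟩ 1)
          (Submodule.sum_mem _ fun z _ => hu z)), fun w hw => ?_⟩
      rw [map_smul, map_sub, map_sum, Pi.smul_apply, Pi.sub_apply, Finset.sum_apply,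
        Finset.sum_congr rfl fun z _ => hu' z w hw, Finset.sum_eq_single w]
      · by_cases hwx : w = x
        · subst hwx
          simp [hdiag]
        · simp [hw, hwx]
      · intro z _ hz
        split_ifs
        · rw [Pi.single_eq_of_ne hz.symm, mul_zero]
        · rfl
      · exact fun h' => (h' (Finset.mem_univ w)).elim
  exact key _ x hx rfl

theorem exists_map_eq {v : ι → K} {n : ℕ} {s : ℤ}
    (hv : ∀ x, minus x → v x ≠ 0 → n ≤ lev x ∧ δ x = s + 2) :
    ∃ u ∈ spanOn K fun y => plus y ∧ n ≤ lev y ∧ δ y = s, ∀ z, minus z → d u z = v z := by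
  have hsub : ∀ x, ∃ u ∈ spanOn K fun y => plus y ∧ n ≤ lev y ∧ δ y = s,
      ∀ z, minus z → d u z = v x * (Pi.single x 1 : ι → K) z := by
    intro x
    by_cases hx : minus x ∧ v x ≠ 0
    · obtain ⟨u, hu, hu'⟩ := h.exists_map_eq_single hδ x hx.1
      obtain ⟨h1, h2⟩ := hv x hx.1 hx.2
      refine ⟨v x • u, Submodule.smul_mem _ _ (spanOn_mono ?_ hu), fun z hz => ?_⟩
      · rintro y ⟨h3, h4, h5⟩
        exact ⟨h3, by omega, by omega⟩
      · rw [map_smul, Pi.smul_apply, hu' z hz, smul_eq_mul]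
    · refine ⟨0, Submodule.zero_mem _, fun z hz => ?_⟩
      rw [map_zero, Pi.zero_apply, eq_comm, mul_eq_zero]
      by_cases hxz : x = z
      · subst hxz
        exact Or.inl (by_contra fun h' => hx ⟨hz, h'⟩)
      · exact Or.inr (Pi.single_eq_of_ne (Ne.symm hxz) 1)
  choose u hu hu' using hsub
  refine ⟨∑ x, u x, Submodule.sum_mem _ fun x _ => hu x, fun z hz => ?_⟩
  rw [map_sum, Finset.sum_apply, Finset.sum_congr rfl fun x _ => hu' x z hz,
    Finset.sum_eq_single z]
  · rw [Pi.single_eq_same, mul_one]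
  · intro x _ hx
    rw [Pi.single_eq_of_ne hx.symm, mul_zero]
  · exact fun h' => (h' (Finset.mem_univ z)).elim

end IsTriangular

end Triangular

/-! ### The subcomplex of reduced elements -/

section Elimination

variable {ι K : Type*} [Fintype ι] [DecidableEq ι] [Field K] {d : (ι → K) →ₗ[K] (ι → K)}
  {plus minus : ι → Prop} {σ τ : ι → ι} {lev : ι → ℕ} {δ : ι → ℤ}

theorem exists_single_ne_zero {u : ι → K} {x : ι} (hx : d u x ≠ 0) :
    ∃ y, u y ≠ 0 ∧ d (Pi.single y 1) x ≠ 0 := by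
  rw [apply_eq_sum_single, Finset.sum_apply] at hx
  obtain ⟨y, -, hy⟩ := Finset.exists_ne_zero_of_sum_ne_zero hx
  rw [Pi.smul_apply, smul_eq_mul] at hy
  exact ⟨y, left_ne_zero_of_mul hy, right_ne_zero_of_mul hy⟩

theorem map_mem_spanOn (hδ : ∀ y x, d (Pi.single y 1) x ≠ 0 → δ x = δ y + 2) {s : ℤ} {u : ι → K}
    (hu : u ∈ spanOn K fun x => δ x = s) : d u ∈ spanOn K fun x => δ x = s + 2 := by
  intro x hx
  by_contra h
  obtain ⟨y, hy, hyx⟩ := exists_single_ne_zero h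
  have h1 : δ y = s := by_contra fun h1 => hy (hu y h1)
  exact hx ((hδ _ _ hyx).trans (by rw [h1]))

variable (d minus δ) in
/-- The elements of degree `s` of the subcomplex of the elements `w` such that neither `w` nor
`d w` has a component in the `minus` part. -/
def reducedPart (s : ℤ) : Submodule K (ι → K) where
  carrier := {w | (∀ x, δ x ≠ s → w x = 0) ∧ (∀ x, minus x → w x = 0) ∧
    ∀ x, minus x → d w x = 0}
  zero_mem' := by simp
  add_mem' := by
    rintro v w ⟨h1, h2, h3⟩ ⟨h4, h5, h6⟩
    exact ⟨fun x hx => by simp [h1 x hx, h4 x hx], fun x hx => by simp [h2 x hx, h5 x hx],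
      fun x hx => by simp [h3 x hx, h6 x hx]⟩
  smul_mem' := by
    rintro c w ⟨h1, h2, h3⟩
    exact ⟨fun x hx => by simp [h1 x hx], fun x hx => by simp [h2 x hx],
      fun x hx => by simp [h3 x hx]⟩

theorem reducedPart_le {s : ℤ} : reducedPart d minus δ s ≤ spanOn K fun x => δ x = s :=
  fun _ hw => hw.1

namespace IsTriangular

variable (h : IsTriangular d plus minus σ τ lev)
  (hδ : ∀ y x, d (Pi.single y 1) x ≠ 0 → δ x = δ y + 2) (hd : d ∘ₗ d = 0)
  (hdisj : ∀ x, plus x → ¬ minus x)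
include h hδ hd

omit h in
theorem map_mem_reducedPart {s : ℤ} {w : ι → K} (hw : w ∈ reducedPart d minus δ s) :
    d w ∈ reducedPart d minus δ (s + 2) := by
  refine ⟨map_mem_spanOn hδ (reducedPart_le hw), hw.2.2, fun x _ => ?_⟩
  have : d (d w) = 0 := LinearMap.congr_fun hd w
  rw [this, Pi.zero_apply]

omit hd in
include hdisj in
-- The minus component of `d t` is cancelled by a plus vector `v`. Subtracting `v` creates no minus
-- component in `t`, as plus and minus are disjoint.
theorem exists_sub_mem_reducedPart {s : ℤ} {n : ℕ} {t : ι → K}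
    (ht : t ∈ spanOn K fun x => δ x = s) (ht' : ∀ x, minus x → t x = 0)
    (hn : ∀ x, minus x → d t x ≠ 0 → n ≤ lev x) :
    ∃ v ∈ spanOn K fun y => plus y ∧ n ≤ lev y ∧ δ y = s, t - v ∈ reducedPart d minus δ s := by
  have hdt := map_mem_spanOn hδ ht
  obtain ⟨v, hv, hv'⟩ := h.exists_map_eq hδ (v := d t) (n := n) (s := s) fun x hx hx' =>
    ⟨hn x hx hx', by_contra fun hx'' => hx' (hdt x hx'')⟩
  refine ⟨v, hv, Submodule.sub_mem (spanOn K fun x => δ x = s) ht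
    (spanOn_mono (fun _ hx => hx.2.2) hv), fun x hx => ?_, fun x hx => ?_⟩
  · rw [Pi.sub_apply, ht' x hx, hv x fun hx' => hdisj x hx'.1 hx, sub_zero]
  · rw [map_sub, Pi.sub_apply, hv' x hx, sub_self]

include hdisj in
-- A boundary `d u` first removes the minus component of `x`; the vector `v` then corrects the
-- remainder to a reduced element.
theorem exists_eq_add {s : ℤ} {x : ι → K} (hx : x ∈ spanOn K fun x => δ x = s) :
    ∃ w ∈ reducedPart d minus δ s, ∃ v ∈ spanOn K fun y => plus y ∧ δ y = s,
      ∃ u ∈ spanOn K fun y => δ y = s - 2, x = w + v + d u := by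
  obtain ⟨u, hu, hu'⟩ := h.exists_map_eq hδ (v := x) (n := 0) (s := s - 2) fun y _ hy =>
    ⟨Nat.zero_le _, by_contra fun hy' => hy (hx y fun h' => hy' (by omega))⟩
  have hu2 : u ∈ spanOn K fun y => δ y = s - 2 := spanOn_mono (fun _ hx => hx.2.2) hu
  have hdu := map_mem_spanOn hδ hu2
  rw [sub_add_cancel] at hdu
  obtain ⟨v, hv, hw⟩ := h.exists_sub_mem_reducedPart hδ hdisj (n := 0)
    (Submodule.sub_mem _ hx hdu) (fun y hy => by rw [Pi.sub_apply, hu' y hy, sub_self])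
    fun _ _ _ => Nat.zero_le _
  exact ⟨_, hw, v, spanOn_mono (fun _ hx => ⟨hx.1, hx.2.2⟩) hv, u, hu2, by abel⟩

omit hδ hd in
-- This shows that the plus part in the decomposition disappears as soon as the differential of the
-- sum has no minus component, by injectivity of the triangular block.
theorem eq_zero_of_map_eq {w v : ι → K} (hw : ∀ x, minus x → d w x = 0)
    (hv : v ∈ spanOn K plus) (hdv : ∀ x, minus x → d (w + v) x = 0) : v = 0 := by
  refine h.eq_zero_of_map_eq_zero hv fun x hx => ?_
  have := hdv x hx
  rwa [map_add, Pi.add_apply, hw x hx, zero_add] at this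

include hdisj in
/-- Gaussian elimination: the homology is the homology of a complex which is identified by `ρ` with
the subcomplex of the reduced elements. -/
theorem nonempty_pieceHomology_equiv {U : Type*} [AddCommGroup U] [Module K U] (e : U →ₗ[K] U)
    (T : ℤ → Submodule K U) (ρ : (ι → K) →ₗ[K] U)
    (hρ : ∀ s, ∀ w ∈ reducedPart d minus δ s, ρ w ∈ T s)
    (hρe : ∀ s, ∀ w ∈ reducedPart d minus δ s, ρ (d w) = e (ρ w))
    (hρs : ∀ s, ∀ t ∈ T s, ∃ w ∈ reducedPart d minus δ s, ρ w = t)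
    (hρi : ∀ s, ∀ w ∈ reducedPart d minus δ s, ρ w = 0 → w = 0) (s : ℤ) :
    Nonempty (pieceHomology d (spanOn K fun x => δ x = s - 2) (spanOn K fun x => δ x = s) ≃ₗ[K]
      pieceHomology e (T (s - 2)) (T s)) := by
  have hdd : ∀ x, d (d x) = 0 := fun x => LinearMap.congr_fun hd x
  have hW := fun s w => map_mem_reducedPart (d := d) (minus := minus) (s := s) (w := w) hδ hd
  have e1 : s - 2 + 2 = s := by ring
  -- Both homologies are quotients of the reduced cycles, so it remains to compare the cycles that
  -- become zero.
  let Z : Submodule K (ι → K) := LinearMap.ker d ⊓ reducedPart d minus δ s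
  have hZD : Z ≤ LinearMap.ker d ⊓ spanOn K fun x => δ x = s := inf_le_inf_left _ reducedPart_le
  have hZT : ∀ z ∈ Z, ρ z ∈ LinearMap.ker e ⊓ T s := by
    rintro z ⟨hz, hz'⟩
    refine ⟨?_, hρ s z hz'⟩
    rw [SetLike.mem_coe, LinearMap.mem_ker, ← hρe s z hz', LinearMap.mem_ker.1 hz, map_zero]
  refine (exists_linearEquiv_of_ker_eq (Submodule.mkQ (((spanOn K fun x => δ x = s - 2).map
    d).submoduleOf (LinearMap.ker d ⊓ spanOn K fun x => δ x = s)) ∘ₗ Submodule.inclusion hZD)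
    (Submodule.mkQ (((T (s - 2)).map e).submoduleOf (LinearMap.ker e ⊓ T s)) ∘ₗ ρ.restrict hZT)
    ?_ ?_ ?_).nonempty
  · intro y
    obtain ⟨⟨x, hx, hx'⟩, rfl⟩ := Submodule.mkQ_surjective _ y
    obtain ⟨w, hw, v, hv, u, hu, hwvu⟩ := h.exists_eq_add hδ hd hdisj hx'
    have hdx : d (w + v) = 0 := by
      have : d x = 0 := hx
      rwa [hwvu, map_add, hdd, add_zero] at this
    have hv0 : v = 0 := h.eq_zero_of_map_eq hw.2.2 (spanOn_mono (fun _ hx => hx.1) hv)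
      fun x _ => by rw [hdx, Pi.zero_apply]
    rw [hv0, add_zero] at hdx hwvu
    refine ⟨⟨w, hdx, hw⟩, (Submodule.Quotient.eq _).2 ⟨-u, Submodule.neg_mem _ hu, ?_⟩⟩
    change d (-u) = w - x
    rw [hwvu, map_neg]
    abel
  · intro y
    obtain ⟨⟨t, ht, ht'⟩, rfl⟩ := Submodule.mkQ_surjective _ y
    obtain ⟨w, hw, rfl⟩ := hρs s t ht'
    have hdw : d w = 0 := hρi _ _ (hW s w hw) (by rw [hρe s w hw]; exact ht)
    exact ⟨⟨w, hdw, hw⟩, rfl⟩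
  · rintro ⟨z, hz, hz'⟩
    rw [LinearMap.comp_apply, LinearMap.comp_apply, Submodule.mkQ_apply, Submodule.mkQ_apply,
      Submodule.Quotient.mk_eq_zero, Submodule.Quotient.mk_eq_zero]
    change z ∈ (spanOn K fun x => δ x = s - 2).map d ↔ ρ z ∈ (T (s - 2)).map e
    constructor
    · rintro ⟨y, hy, rfl⟩
      obtain ⟨w, hw, v, hv, u, hu, rfl⟩ := h.exists_eq_add hδ hd hdisj hy
      have hv0 : v = 0 := by
        refine h.eq_zero_of_map_eq hw.2.2 (spanOn_mono (fun _ hx => hx.1) hv) fun x hx => ?_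
        have := hz'.2.1 x hx
        rwa [map_add, hdd, add_zero] at this
      rw [hv0, add_zero, map_add, hdd, add_zero]
      exact ⟨ρ w, hρ _ w hw, (hρe _ w hw).symm⟩
    · rintro ⟨t, ht, htz⟩
      obtain ⟨w, hw, rfl⟩ := hρs _ t ht
      refine ⟨w, reducedPart_le hw, sub_eq_zero.1 (hρi s _ (Submodule.sub_mem _ ?_ hz') ?_)⟩
      · have := hW _ w hw
        rwa [e1] at this
      · rw [map_sub, hρe _ w hw, htz, sub_self]

end IsTriangular

end Elimination

noncomputable section

open scoped Classical

namespace LinkDiagram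

variable {X O F : Type u} [Fintype X] [Fintype O] [Fintype F] (L : LinkDiagram X O F)

/-! ### Matrix entries of the differentials -/

section Entries

variable (K : Type*) [CommRing K]

theorem card_circles_pos (S : Finset X) : 0 < (L.circles S).card :=
  Finset.card_pos.2 ⟨_, L.circleOf_mem_circles S L.mark⟩

theorem unmarked_eq_empty_iff {S : Finset X} : L.unmarked S = ∅ ↔ (L.circles S).card = 1 := by
  rw [← Finset.card_eq_zero, ← L.card_unmarked S]
  omega

theorem st_apply (S : Finset X) (P : Finset (Finset (DiagramArc X O))) (y : L.PureState) :
    L.st K S P y = if y.1 = (S, P) then 1 else 0 := rfl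

theorem edge_single_ne_zero {c : X} {x y : L.PureState} (h : L.edge K c (Pi.single y 1) x ≠ 0) :
    c ∉ y.1.1 ∧ x.1.1 = insert c y.1.1 := by
  rw [single_eq_st, edge, ofBasis_st L K _ y.2] at h
  by_contra h'
  exact h (if_neg fun hi => h' ⟨hi.1, hi.2.1⟩)

theorem khovanovDiff_single_ne_zero {x y : L.PureState}
    (h : L.khovanovDiff K (Pi.single y 1) x ≠ 0) : ∃ c ∉ y.1.1, x.1.1 = insert c y.1.1 := by
  rw [khovanovDiff_eq_sum, LinearMap.sum_apply, Finset.sum_apply] at h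
  obtain ⟨c, -, hc⟩ := Finset.exists_ne_zero_of_sum_ne_zero h
  exact ⟨c, L.edge_single_ne_zero K hc⟩

theorem koszulDiff_single_ne_zero [Algebra L.faceRing K] {x y : L.PureState}
    (h : L.koszulDiff K (Pi.single y 1) x ≠ 0) : ∃ C ∈ y.1.2, x.1 = (y.1.1, y.1.2.erase C) := by
  rw [single_eq_st, koszulDiff_st K y.2, Finset.sum_apply] at h
  obtain ⟨C, hC, hx⟩ := Finset.exists_ne_zero_of_sum_ne_zero h
  refine ⟨C, hC, by_contra fun hne => hx ?_⟩
  rw [Pi.smul_apply, st_apply, if_neg hne, smul_zero]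

theorem twistedDiff_single_ne_zero [Algebra L.faceRing K] {x y : L.PureState}
    (h : L.twistedDiff K (Pi.single y 1) x ≠ 0) :
    (∃ c ∉ y.1.1, x.1.1 = insert c y.1.1) ∨ ∃ C ∈ y.1.2, x.1 = (y.1.1, y.1.2.erase C) := by
  by_cases h1 : L.khovanovDiff K (Pi.single y 1) x = 0
  · refine Or.inr (L.koszulDiff_single_ne_zero K fun h2 => h ?_)
    rw [twistedDiff, LinearMap.add_apply, Pi.add_apply, h1, h2, add_zero]
  · exact Or.inl (L.khovanovDiff_single_ne_zero K h1)

theorem edge_apply_eq_zero {c : X} {x : L.PureState} {w : L.PureState → K}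
    (h : c ∈ x.1.1 → ∀ y : L.PureState, y.1.1 = x.1.1.erase c → w y = 0) :
    L.edge K c w x = 0 := by
  rw [apply_eq_sum_single, Finset.sum_apply]
  refine Finset.sum_eq_zero fun y _ => ?_
  rw [Pi.smul_apply, smul_eq_mul]
  by_cases hy : L.edge K c (Pi.single y 1) x = 0
  · rw [hy, mul_zero]
  · obtain ⟨hc, hx⟩ := L.edge_single_ne_zero K hy
    rw [h (by rw [hx]; exact Finset.mem_insert_self _ _) y (by rw [hx, Finset.erase_insert hc]),
      zero_mul]

/-- The coefficient of a state with a single circle. -/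
theorem edge_apply_tree {T : Finset X} (hT : (L.circles T).card = 1) {c : X} (hc : c ∈ T)
    (w : L.PureState → K) :
    L.edge K c w ⟨(T, ∅), Finset.empty_subset _⟩ =
      w ⟨(T.erase c, L.unmarked (T.erase c)), Finset.Subset.rfl⟩ := by
  suffices h : LinearMap.proj (R := K) (φ := fun _ : L.PureState => K)
      ⟨(T, ∅), Finset.empty_subset _⟩ ∘ₗ L.edge K c =
      LinearMap.proj ⟨(T.erase c, L.unmarked (T.erase c)), Finset.Subset.rfl⟩ from
    LinearMap.congr_fun h w
  refine L.hom_ext fun S P hP => ?_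
  rw [LinearMap.comp_apply, LinearMap.proj_apply, LinearMap.proj_apply]
  by_cases hS : c ∉ S ∧ T = insert c S
  swap
  · have h1 : L.edge K c (L.st K S P) ⟨(T, ∅), Finset.empty_subset _⟩ = 0 := by
      by_contra h
      rw [L.st_eq_single K hP] at h
      exact hS (L.edge_single_ne_zero K h)
    rw [h1, st_apply, if_neg]
    rintro h
    have hS' : T.erase c = S := congrArg Prod.fst h
    refine hS ⟨?_, ?_⟩
    · rw [← hS']
      exact Finset.notMem_erase c T
    · rw [← hS', Finset.insert_erase hc]
  obtain ⟨hcS, rfl⟩ := hS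
  simp only [st_apply, Finset.erase_insert hcS]
  have hU := L.card_unmarked S
  -- A resolution with a single circle can only arise by a merge. Then `S` has one marked and one
  -- unmarked circle, and only `v₊ ⊗ v₀ ↦ v₀` contributes.
  rcases L.merges_or_merges hcS with ⟨a, b, h⟩ | ⟨a, b, h⟩
  · have hcard := h.card_circles
    have hne := h.circleOf_ne
    have hcirc : L.circles S = {L.circleOf S a, L.circleOf S b} := by
      refine (Finset.eq_of_subset_of_card_le ?_ ?_).symm
      · intro C hC
        simp only [Finset.mem_insert, Finset.mem_singleton] at hC
        rcases hC with rfl | rfl <;> exact L.circleOf_mem_circles S _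
      · rw [Finset.card_pair hne]
        omega
    have hsub : ∀ Q ⊆ L.unmarked S, Q ⊆ {L.circleOf S a, L.circleOf S b} := fun Q hQ C hC => by
      rw [← hcirc]
      exact (L.mem_unmarked.1 (hQ hC)).1
    have hPU : P.Nonempty → P = L.unmarked S := fun hne => by
      refine Finset.eq_of_subset_of_card_le hP ?_
      have := Finset.card_pos.2 hne
      omega
    rw [h.edge_st K hcS hP]
    have h1 : ¬ (L.circleOf S a ∈ P ∧ L.circleOf S b ∈ P) := fun h1 => by
      have := Finset.card_le_card (Finset.insert_subset h1.1 (Finset.singleton_subset_iff.2 h1.2))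
      rw [Finset.card_pair hne] at this
      have := Finset.card_le_card hP
      omega
    rw [if_neg h1]
    by_cases h2 : L.circleOf S a ∈ P ∨ L.circleOf S b ∈ P
    · rw [if_pos h2, st_apply, Finset.sdiff_eq_empty_iff_subset.2 (hsub P hP), if_pos rfl, if_pos]
      rw [← hPU (h2.elim (fun h => ⟨_, h⟩) fun h => ⟨_, h⟩)]
    · rw [if_neg h2, Pi.zero_apply, if_neg]
      intro h3
      have hUP : L.unmarked S = P := congrArg Prod.snd h3
      obtain ⟨C, hC⟩ : (L.unmarked S).Nonempty := by
        rw [← Finset.card_pos]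
        omega
      have hC' := hsub _ Finset.Subset.rfl hC
      rw [hUP] at hC
      simp only [Finset.mem_insert, Finset.mem_singleton] at hC'
      rcases hC' with rfl | rfl
      exacts [h2 (Or.inl hC), h2 (Or.inr hC)]
  · have hcard := h.card_circles
    have := L.card_circles_pos S
    omega

/-- The coefficient of a state with two circles in the boundary of a state with a single circle. -/
theorem edge_apply_of_tree {S : Finset X} {c : X} (hc : c ∈ S)
    (hT : (L.circles (S.erase c)).card = 1) (w : L.PureState → K) :
    L.edge K c w ⟨(S, ∅), Finset.empty_subset _⟩ =
      w ⟨(S.erase c, ∅), Finset.empty_subset _⟩ := by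
  suffices h : LinearMap.proj (R := K) (φ := fun _ : L.PureState => K)
      ⟨(S, ∅), Finset.empty_subset _⟩ ∘ₗ L.edge K c =
      LinearMap.proj ⟨(S.erase c, ∅), Finset.empty_subset _⟩ from
    LinearMap.congr_fun h w
  refine L.hom_ext fun T P hP => ?_
  rw [LinearMap.comp_apply, LinearMap.proj_apply, LinearMap.proj_apply]
  by_cases hS : c ∉ T ∧ S = insert c T
  swap
  · have h1 : L.edge K c (L.st K T P) ⟨(S, ∅), Finset.empty_subset _⟩ = 0 := by
      by_contra h
      rw [L.st_eq_single K hP] at h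
      exact hS (L.edge_single_ne_zero K h)
    rw [h1, st_apply, if_neg]
    rintro h
    have hS' : S.erase c = T := congrArg Prod.fst h
    refine hS ⟨?_, ?_⟩
    · rw [← hS']
      exact Finset.notMem_erase c S
    · rw [← hS', Finset.insert_erase hc]
  obtain ⟨hcT, rfl⟩ := hS
  rw [Finset.erase_insert hcT] at hT
  simp only [st_apply, Finset.erase_insert hcT]
  have hP0 : P = ∅ := by
    rw [L.unmarked_eq_empty_iff.2 hT] at hP
    exact Finset.subset_empty.1 hP
  subst hP0
  rcases L.merges_or_merges hcT with ⟨a, b, h⟩ | ⟨a, b, h⟩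
  · have hcard := h.card_circles
    have := L.card_circles_pos (insert c T)
    omega
  · rw [h.edge_st_divide K hcT hP, if_neg (Finset.notMem_empty _), Finset.empty_sdiff, st_apply,
      if_pos rfl, if_pos rfl]

theorem card_circles_erase {T : Finset X} (hT : (L.circles T).card = 1) {c : X} (hc : c ∈ T) :
    (L.circles (T.erase c)).card = 2 := by
  have hi := Finset.insert_erase hc
  rcases L.merges_or_merges (Finset.notMem_erase c T) with ⟨a, b, h⟩ | ⟨a, b, h⟩
  · have := h.card_circles
    rw [hi] at this
    omega
  · have := h.card_circles
    have := L.card_circles_pos (T.erase c)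
    rw [hi] at *
    omega

/-- The Koszul part does not reach a resolution without unmarked circles. -/
theorem twistedDiff_apply_tree [Algebra L.faceRing K] {T : Finset X}
    (hT : (L.circles T).card = 1) (w : L.PureState → K) :
    L.twistedDiff K w ⟨(T, ∅), Finset.empty_subset _⟩ =
      ∑ c ∈ T, w ⟨(T.erase c, L.unmarked (T.erase c)), Finset.Subset.rfl⟩ := by
  have h1 : L.koszulDiff K w ⟨(T, ∅), Finset.empty_subset _⟩ = 0 := by
    by_contra h
    obtain ⟨y, hy⟩ : ∃ y, L.koszulDiff K (Pi.single y 1) ⟨(T, ∅), Finset.empty_subset _⟩ ≠ 0 := by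
      by_contra! h'
      refine h ?_
      rw [apply_eq_sum_single, Finset.sum_apply]
      refine Finset.sum_eq_zero fun y _ => ?_
      rw [Pi.smul_apply, h', smul_zero]
    obtain ⟨C, hC, hx⟩ := L.koszulDiff_single_ne_zero K hy
    have hTy : T = y.1.1 := congrArg Prod.fst hx
    have := y.2 hC
    rw [← hTy, L.unmarked_eq_empty_iff.2 hT] at this
    exact Finset.notMem_empty C this
  rw [twistedDiff, LinearMap.add_apply, Pi.add_apply, h1, add_zero, khovanovDiff_eq_sum,
    LinearMap.sum_apply, Finset.sum_apply, ← Finset.sum_subset (Finset.subset_univ T)]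
  · exact Finset.sum_congr rfl fun c hc => L.edge_apply_tree K hT hc w
  · exact fun c _ hc => L.edge_apply_eq_zero K fun hc' => (hc hc').elim

theorem koszulDiff_apply_empty [Algebra L.faceRing K] {S : Finset X}
    {C : Finset (DiagramArc X O)} (hS : L.unmarked S = {C}) (w : L.PureState → K) :
    L.koszulDiff K w ⟨(S, ∅), Finset.empty_subset _⟩ =
      algebraMap L.faceRing K (L.area S C) * w ⟨(S, L.unmarked S), Finset.Subset.rfl⟩ := by
  suffices h : LinearMap.proj (R := K) (φ := fun _ : L.PureState => K)
      ⟨(S, ∅), Finset.empty_subset _⟩ ∘ₗ L.koszulDiff K = algebraMap L.faceRing K (L.area S C) •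
      LinearMap.proj ⟨(S, L.unmarked S), Finset.Subset.rfl⟩ from
    LinearMap.congr_fun h w
  refine L.hom_ext fun S' P hP => ?_
  rw [LinearMap.comp_apply, LinearMap.proj_apply, LinearMap.smul_apply, LinearMap.proj_apply,
    koszulDiff_st K hP, Finset.sum_apply]
  by_cases hS' : S = S'
  swap
  · rw [st_apply, if_neg fun h => hS' (congrArg Prod.fst h), smul_zero]
    refine Finset.sum_eq_zero fun D _ => ?_
    rw [Pi.smul_apply, st_apply, if_neg fun h => hS' (congrArg Prod.fst h), smul_zero]
  subst hS'
  have hP' := hP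
  rw [hS, Finset.subset_singleton_iff] at hP'
  rcases hP' with rfl | rfl
  · rw [Finset.sum_empty, st_apply, if_neg, smul_zero]
    intro h
    have : L.unmarked S = ∅ := congrArg Prod.snd h
    rw [hS] at this
    exact Finset.singleton_ne_empty C this
  · rw [Finset.sum_singleton, Pi.smul_apply, st_apply, st_apply, if_pos, if_pos]
    · rw [← hS]
    · rw [Finset.erase_singleton]

end Entries

end LinkDiagram
end

/-- Sums over the ways of removing two elements from a finite set, one after the other. -/
theorem sum_erase_erase {X M : Type*} [Fintype X] [DecidableEq X] [AddCommMonoid M]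
    (T' : Finset X) (f : Finset X → Finset X → M) :
    ∑ c ∈ T', ∑ c' ∈ T'.erase c, f (T'.erase c) ((T'.erase c).erase c') =
      ∑ T : Finset X, if T ⊆ T' ∧ (T' \ T).card = 2 then
        ∑ c ∈ T' \ T, f (insert c T) T else 0 := by
  rw [← Finset.sum_filter, Finset.sum_sigma', Finset.sum_sigma']
  -- The crossing `c` is removed before `c'`; restoring `c'` to the final set gives the intermediate
  -- set `T'.erase c`.
  refine Finset.sum_bij (fun p _ => ⟨(T'.erase p.1).erase p.2, p.2⟩) ?_ ?_ ?_ ?_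
  · rintro ⟨c, c'⟩ hc
    simp only [Finset.mem_sigma, Finset.mem_erase] at hc
    simp only [Finset.mem_sigma, Finset.mem_filter, Finset.mem_univ, true_and, Finset.mem_sdiff,
      Finset.mem_erase, ne_eq, not_true_eq_false, false_and, not_false_eq_true, and_true]
    refine ⟨⟨fun x hx => ?_, ?_⟩, hc.2.2⟩
    · simp only [Finset.mem_erase] at hx
      exact hx.2.2
    · have : T' \ (T'.erase c).erase c' = {c, c'} := by
        ext x
        simp only [Finset.mem_sdiff, Finset.mem_erase, Finset.mem_insert, Finset.mem_singleton]
        constructor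
        · rintro ⟨h1, h2⟩
          by_contra! h3
          exact h2 ⟨h3.2, h3.1, h1⟩
        · rintro (rfl | rfl)
          exacts [⟨hc.1, by tauto⟩, ⟨hc.2.2, by tauto⟩]
      rw [this, Finset.card_pair hc.2.1.symm]
  · rintro ⟨c, c'⟩ hc ⟨d, d'⟩ hd h
    simp only [Finset.mem_sigma, Finset.mem_erase] at hc hd
    simp only [Sigma.mk.injEq, heq_eq_eq] at h
    obtain ⟨h, rfl⟩ := h
    have : c = d := by
      by_contra hne
      have h1 : c ∈ (T'.erase d).erase c' := by
        simp only [Finset.mem_erase]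
        exact ⟨hc.2.1.symm, hne, hc.1⟩
      rw [← h] at h1
      simp at h1
    rw [this]
  · rintro ⟨T, c'⟩ h
    simp only [Finset.mem_sigma, Finset.mem_filter, Finset.mem_univ, true_and,
      Finset.mem_sdiff] at h
    obtain ⟨⟨hT, h2⟩, hc', hc'T⟩ := h
    have h1 : ((T' \ T).erase c').card = 1 := by
      rw [Finset.card_erase_of_mem (Finset.mem_sdiff.2 ⟨hc', hc'T⟩), h2]
    obtain ⟨c, hc⟩ := Finset.card_eq_one.1 h1
    have hx : ∀ x, (x ≠ c' ∧ x ∈ T' ∧ x ∉ T) ↔ x = c := fun x => by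
      rw [← Finset.mem_singleton, ← hc, Finset.mem_erase, Finset.mem_sdiff]
    have hcc := (hx c).2 rfl
    refine ⟨⟨c, c'⟩, ?_, ?_⟩
    · simp only [Finset.mem_sigma, Finset.mem_erase]
      exact ⟨hcc.2.1, hcc.1.symm, hc'⟩
    · have : (T'.erase c).erase c' = T := by
        ext x
        simp only [Finset.mem_erase]
        constructor
        · rintro ⟨h3, h4, h5⟩
          by_contra h6
          exact h4 ((hx x).1 ⟨h3, h5, h6⟩)
        · intro h3
          refine ⟨?_, ?_, hT h3⟩
          · rintro rfl
            exact hc'T h3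
          · rintro rfl
            exact hcc.2.2 h3
      rw [this]
  · rintro ⟨c, c'⟩ hc
    simp only [Finset.mem_sigma] at hc
    simp only [Finset.insert_erase hc.2]

noncomputable section

open scoped Classical

namespace LinkDiagram

variable {X O F : Type u} [Fintype X] [Fintype O] [Fintype F] (L : LinkDiagram X O F)

/-! ### Elimination of the states with several circles -/

/-- A chosen unmarked circle of a resolution. -/
def chosen (S : Finset X) : Finset (DiagramArc X O) :=
  if h : (L.unmarked S).Nonempty then h.choose else ∅

theorem chosen_mem {S : Finset X} (h : (L.unmarked S).Nonempty) : L.chosen S ∈ L.unmarked S := by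
  rw [chosen, dif_pos h]
  exact h.choose_spec

/-- The chosen circle carries `v₊`. -/
def IsPlus (x : L.PureState) : Prop := L.chosen x.1.1 ∈ x.1.2

/-- The chosen circle carries `v₋`. -/
def IsMinus (x : L.PureState) : Prop := (L.unmarked x.1.1).Nonempty ∧ L.chosen x.1.1 ∉ x.1.2

/-- The label of the chosen circle is changed to `v₋`. -/
def lowerChosen (x : L.PureState) : L.PureState :=
  ⟨(x.1.1, x.1.2.erase (L.chosen x.1.1)), (Finset.erase_subset _ _).trans x.2⟩

/-- The label of the chosen circle is changed to `v₊`. -/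
def raiseChosen (x : L.PureState) : L.PureState :=
  if h : (L.unmarked x.1.1).Nonempty then
    ⟨(x.1.1, insert (L.chosen x.1.1) x.1.2), Finset.insert_subset (L.chosen_mem h) x.2⟩
  else x

variable {L} in
theorem IsPlus.nonempty {x : L.PureState} (h : L.IsPlus x) : (L.unmarked x.1.1).Nonempty :=
  ⟨_, x.2 h⟩

theorem not_isMinus_of_isPlus (x : L.PureState) (h : L.IsPlus x) : ¬ L.IsMinus x :=
  fun h' => h'.2 h

/-- The diagonal entries are areas and hence nonzero. Every Khovanov term enlarges `S`. A Koszul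
term keeps `S` and can only turn a plus state into a minus state by lowering the chosen circle. -/
theorem isTriangular : IsTriangular (L.twistedDiff L.faceField) L.IsPlus L.IsMinus L.lowerChosen
    L.raiseChosen fun x => x.1.1.card where
  plus_τ x h := by
    rw [raiseChosen, dif_pos h.1]
    exact Finset.mem_insert_self _ _
  minus_σ x h := ⟨h.nonempty, Finset.notMem_erase _ _⟩
  σ_τ x h := by
    rw [raiseChosen, dif_pos h.1]
    exact Subtype.ext (Prod.ext rfl (Finset.erase_insert h.2))
  τ_σ x h := by
    rw [raiseChosen, dif_pos (show (L.unmarked (L.lowerChosen x).1.1).Nonempty from h.nonempty)]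
    exact Subtype.ext (Prod.ext rfl (Finset.insert_erase h))
  lev_σ x _ := rfl
  diag y hy := by
    have h1 : L.khovanovDiff L.faceField (Pi.single y 1) (L.lowerChosen y) = 0 := by
      by_contra h
      obtain ⟨c, hc, h'⟩ := L.khovanovDiff_single_ne_zero _ h
      have h'' : y.1.1 = insert c y.1.1 := h'
      rw [h''] at hc
      exact hc (Finset.mem_insert_self _ _)
    rw [twistedDiff, LinearMap.add_apply, Pi.add_apply, h1, zero_add, single_eq_st,
      koszulDiff_st _ y.2, Finset.sum_apply, Finset.sum_eq_single_of_mem (L.chosen y.1.1) hy]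
    · rw [Pi.smul_apply, st_apply, if_pos (show (L.lowerChosen y).1 = (y.1.1, y.1.2.erase (L.chosen y.1.1)) from rfl), smul_eq_mul, mul_one,
        ne_eq, FaithfulSMul.algebraMap_eq_zero_iff]
      exact L.area_ne_zero (L.mem_unmarked.1 (y.2 hy)).1
    · intro C hC hne
      rw [Pi.smul_apply, st_apply, if_neg, smul_zero]
      intro h
      have h2 : y.1.2.erase (L.chosen y.1.1) = y.1.2.erase C := congrArg Prod.snd h
      have h3 : C ∈ y.1.2.erase (L.chosen y.1.1) := Finset.mem_erase.2 ⟨hne, hC⟩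
      rw [h2] at h3
      exact Finset.notMem_erase _ _ h3
  lt y x hy hx h := by
    rcases L.twistedDiff_single_ne_zero _ h with ⟨c, hc, h1⟩ | ⟨C, hC, h1⟩
    · right
      rw [h1, Finset.card_insert_of_notMem hc]
      exact Nat.lt_succ_self _
    · left
      have h2 : x.1.1 = y.1.1 := by rw [h1]
      have h3 : x.1.2 = y.1.2.erase C := by rw [h1]
      have h4 : L.chosen y.1.1 = C := by
        by_contra hne
        have h5 := hx.2
        rw [h2, h3] at h5
        exact h5 (Finset.mem_erase.2 ⟨hne, hy⟩)
      refine Subtype.ext ?_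
      rw [h1, ← h4]
      rfl

theorem deltaDeg_of_twistedDiff_ne_zero (y x : L.PureState)
    (h : L.twistedDiff L.faceField (Pi.single y 1) x ≠ 0) : L.deltaDeg x = L.deltaDeg y + 2 := by
  by_contra hne
  have h1 : Pi.single y 1 ∈ filteredPart L.faceField L.qDeg L.deltaDeg (L.qDeg y) (L.deltaDeg y) :=
    single_mem_spanOn ⟨le_rfl, rfl⟩ 1
  exact h ((L.isPerturbation L.faceField).d_mem h1 x fun h2 => hne h2.2)

theorem deltaDeg_eq_of_unmarked_eq_empty {x : L.PureState} (h : L.unmarked x.1.1 = ∅) :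
    L.deltaDeg x = x.1.1.card - L.nPos := by
  have hx : x.1.2 = ∅ := Finset.subset_empty.1 (h ▸ x.2)
  rw [deltaDeg, hDeg, qDeg, h, hx]
  simp only [Finset.card_empty, Finset.empty_sdiff]
  push_cast
  ring

/-- The state with a single circle. -/
def treeState (T : Finset X) : L.PureState := ⟨(T, ∅), Finset.empty_subset _⟩

theorem eq_treeState {x : L.PureState} (h : L.unmarked x.1.1 = ∅) : x = L.treeState x.1.1 :=
  Subtype.ext (Prod.ext rfl (Finset.subset_empty.1 (h ▸ x.2)))

theorem deltaDeg_treeState {T : Finset X} (h : L.unmarked T = ∅) :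
    L.deltaDeg (L.treeState T) = T.card - L.nPos :=
  L.deltaDeg_eq_of_unmarked_eq_empty (x := L.treeState T) h

theorem deltaDeg_eq (S : Finset X) (P : Finset (Finset (DiagramArc X O)))
    (hP : P ⊆ L.unmarked S) : L.deltaDeg ⟨(S, P), hP⟩ =
      S.card - 2 * P.card + (L.circles S).card - 1 - L.nPos := by
  rw [deltaDeg, hDeg, qDeg_eq]
  ring

/-- The restriction of a function to the states with a single circle. -/
def restrictTree : (L.PureState → L.faceField) →ₗ[L.faceField] (L.TreeState → L.faceField) :=
  LinearMap.funLeft _ _ fun T => L.treeState T.1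

/-- The reduced elements of the totally twisted complex. -/
abbrev twistedReducedPart (s : ℤ) : Submodule L.faceField (L.PureState → L.faceField) :=
  reducedPart (L.twistedDiff L.faceField) L.IsMinus L.deltaDeg s

variable {L} {s : ℤ} {w : L.PureState → L.faceField}

theorem restrictTree_mem (hw : w ∈ L.twistedReducedPart s) : L.restrictTree w ∈ L.treePart s := by
  intro T hT
  refine hw.1 _ fun h => hT ?_
  exact (L.deltaDeg_treeState (L.unmarked_eq_empty_iff.2 T.2)).symm.trans h

/-- A state is plus, minus or a single circle, so such a `w` is supported on plus states, where the
triangular block is injective. -/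
theorem eq_zero_of_restrictTree_eq_zero (hw : w ∈ L.twistedReducedPart s)
    (h : ∀ T, L.unmarked T = ∅ → w (L.treeState T) = 0) : w = 0 := by
  refine L.isTriangular.eq_zero_of_map_eq_zero (fun x hx => ?_) hw.2.2
  rcases (L.unmarked x.1.1).eq_empty_or_nonempty with h1 | h1
  · rw [L.eq_treeState h1]
    exact h _ h1
  · exact hw.2.1 x ⟨h1, hx⟩

/-- A function on the resolutions with a single circle, in one degree, extends to a reduced element
whose other components lie on larger resolutions. -/
theorem exists_reduced_extension (t : Finset X → L.faceField)
    (ht : ∀ T, L.unmarked T = ∅ → t T ≠ 0 → T.card - L.nPos = s) :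
    ∃ w ∈ L.twistedReducedPart s, (∀ T, L.unmarked T = ∅ → w (L.treeState T) = t T) ∧
      ∀ x : L.PureState, (L.unmarked x.1.1).Nonempty → x.1.1.card - L.nPos ≤ s → w x = 0 := by
  let t' : L.PureState → L.faceField := fun x => if L.unmarked x.1.1 = ∅ then t x.1.1 else 0
  have ht' : ∀ y, t' y ≠ 0 → L.unmarked y.1.1 = ∅ ∧ y.1.1.card - L.nPos = s := fun y hy => by
    have h1 : L.unmarked y.1.1 = ∅ := by_contra fun h1 => hy (if_neg h1)
    refine ⟨h1, ht _ h1 ?_⟩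
    rwa [show t' y = t y.1.1 from if_pos h1] at hy
  -- In degree `s` the single-circle resolutions have `s + n₊` crossings in `T`. They carry no
  -- Koszul term, so the differential of `t'` lives on resolutions with one crossing more; this is
  -- the level bound `n`.
  obtain ⟨v, hv, hw⟩ := L.isTriangular.exists_sub_mem_reducedPart
    L.deltaDeg_of_twistedDiff_ne_zero L.not_isMinus_of_isPlus (s := s)
    (n := (s + L.nPos + 1).toNat) (t := t') (fun x hx => by
      by_contra h
      obtain ⟨h1, h2⟩ := ht' x h
      exact hx ((L.deltaDeg_eq_of_unmarked_eq_empty h1).trans h2))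
    (fun x hx => if_neg fun h => Finset.not_nonempty_empty (h ▸ hx.1)) (fun x _ h => by
      obtain ⟨y, hy, hyx⟩ := exists_single_ne_zero h
      obtain ⟨h1, h2⟩ := ht' y hy
      rcases L.twistedDiff_single_ne_zero _ hyx with ⟨c, hc, h3⟩ | ⟨C, hC, -⟩
      · rw [h3, Finset.card_insert_of_notMem hc]
        omega
      · have := y.2 hC
        rw [h1] at this
        exact (Finset.notMem_empty C this).elim)
  refine ⟨_, hw, fun T hT => ?_, fun x hx hxs => ?_⟩
  · have h1 : v (L.treeState T) = 0 := hv _ fun h => (Finset.notMem_empty _ h.1).elim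
    rw [Pi.sub_apply, h1, sub_zero]
    exact if_pos hT
  · have h1 : v x = 0 := hv x fun h => by
      have := h.2.1
      omega
    rw [Pi.sub_apply, h1, sub_zero]
    exact if_neg hx.ne_empty

theorem exists_restrictTree_eq {t : L.TreeState → L.faceField} (ht : t ∈ L.treePart s) :
    ∃ w ∈ L.twistedReducedPart s, L.restrictTree w = t := by
  obtain ⟨w, hw, h, -⟩ := exists_reduced_extension (s := s)
    (fun T => if h : (L.circles T).card = 1 then t ⟨T, h⟩ else 0) fun T hT hne => by
      by_contra h
      refine hne ?_
      simp only [dif_pos (L.unmarked_eq_empty_iff.1 hT)]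
      exact ht _ h
  refine ⟨w, hw, funext fun T => (h T.1 (L.unmarked_eq_empty_iff.2 T.2)).trans ?_⟩
  exact dif_pos T.2

/-- A reduced element has no components on the small resolutions with several circles. -/
theorem reduced_apply_eq_zero (hw : w ∈ L.twistedReducedPart s) {x : L.PureState}
    (hx : (L.unmarked x.1.1).Nonempty) (hxs : x.1.1.card - L.nPos ≤ s) : w x = 0 := by
  obtain ⟨v, hv, h1, h2⟩ := exists_reduced_extension (s := s) (fun T => w (L.treeState T))
    fun T hT hne => by
      by_contra h
      refine hne (hw.1 _ fun h' => h ?_)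
      rw [← h', deltaDeg_treeState L hT]
  -- A reduced element is the only reduced extension of its own values on single circles, so it
  -- inherits the support of the constructed extension.
  have : v - w = 0 := eq_zero_of_restrictTree_eq_zero (Submodule.sub_mem _ hv hw) fun T hT => by
    rw [Pi.sub_apply, h1 T hT, sub_self]
  rw [← sub_eq_zero.1 this]
  exact h2 x hx hxs

/-- The value on the resolution `T` if this consists of a single circle. -/
def treeValue (w : L.PureState → L.faceField) (T : Finset X) : L.faceField :=
  if L.unmarked T = ∅ then w (L.treeState T) else 0

/-- As `w` is reduced, `∂ w` vanishes at the minus state of `S`. This equation says that the area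
times the coefficient of the plus state equals the sum of the neighbouring tree values, and it is
solved for the coefficient; signs are irrelevant in characteristic 2. -/
theorem reduced_apply_two_circles (hw : w ∈ L.twistedReducedPart s) {S : Finset X}
    (hS : (L.circles S).card = 2) (hs : S.card - L.nPos = s + 1) :
    w ⟨(S, L.unmarked S), Finset.Subset.rfl⟩ =
      (L.cleavedArea S)⁻¹ * ∑ c ∈ S, treeValue w (S.erase c) := by
  have hU := L.card_unmarked S
  obtain ⟨C, hC⟩ := Finset.card_eq_one.1 (show (L.unmarked S).card = 1 by omega)
  have hne : (L.unmarked S).Nonempty := hC ▸ Finset.singleton_nonempty C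
  have hCu : C ∈ L.unmarked S := hC ▸ Finset.mem_singleton_self C
  have h0 := hw.2.2 (L.treeState S) ⟨hne, Finset.notMem_empty _⟩
  have hk : L.khovanovDiff L.faceField w (L.treeState S) = ∑ c ∈ S, treeValue w (S.erase c) := by
    rw [khovanovDiff_eq_sum, LinearMap.sum_apply, Finset.sum_apply,
      ← Finset.sum_subset (Finset.subset_univ S)]
    · refine Finset.sum_congr rfl fun c hc => ?_
      rw [treeValue]
      split_ifs with h
      · exact L.edge_apply_of_tree _ hc (L.unmarked_eq_empty_iff.1 h) w
      -- Predecessors with several circles are too small to support a reduced element of this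
      -- degree.
      · refine L.edge_apply_eq_zero _ fun _ y hy => ?_
        have hy' : y.1.1 = S.erase c := hy
        have := Finset.card_erase_add_one hc
        refine reduced_apply_eq_zero hw ?_ ?_
        · rw [hy']
          exact Finset.nonempty_iff_ne_empty.2 h
        · rw [hy']
          omega
    · exact fun c _ hc => L.edge_apply_eq_zero _ fun hc' => (hc hc').elim
  have hA : L.cleavedArea S = algebraMap L.faceRing L.faceField (L.area S C) := by
    rw [cleavedArea, hC, Finset.sum_singleton]
  have hA0 : L.cleavedArea S ≠ 0 := by
    rw [hA, ne_eq, FaithfulSMul.algebraMap_eq_zero_iff]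
    exact L.area_ne_zero (L.mem_unmarked.1 hCu).1
  have hv := L.koszulDiff_apply_empty L.faceField hC w
  rw [twistedDiff, LinearMap.add_apply, Pi.add_apply, hk] at h0
  rw [← hA] at hv
  rw [eq_inv_mul_iff_mul_eq₀ hA0, ← hv, ← sub_eq_zero, CharTwo.sub_eq_add, add_comm]
  exact h0

/-- The tree differential is written as a sum over the two successive removals of crossings, to
match the path from `T` through a two-circle resolution to `T'`. -/
theorem treeDiff_restrictTree (T' : L.TreeState) : L.treeDiff (L.restrictTree w) T' =
    ∑ c ∈ T'.1, (L.cleavedArea (T'.1.erase c))⁻¹ *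
      ∑ c' ∈ T'.1.erase c, treeValue w ((T'.1.erase c).erase c') := by
  simp only [Finset.mul_sum]
  rw [sum_erase_erase T'.1 fun S T => (L.cleavedArea S)⁻¹ * treeValue w T]
  rw [treeDiff, Matrix.mulVecLin_apply, Matrix.mulVec, dotProduct]
  simp only [Matrix.of_apply]
  rw [← Finset.sum_subset (Finset.subset_univ (Finset.univ.filter fun T => (L.circles T).card = 1)),
    ← Finset.sum_subtype_eq_sum_filter, Finset.subtype_univ]
  · refine Finset.sum_congr rfl fun T _ => ?_
    split_ifs
    · rw [Finset.sum_mul]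
      refine Finset.sum_congr rfl fun c _ => ?_
      rw [treeValue, if_pos (L.unmarked_eq_empty_iff.2 T.2)]
      rfl
    · rw [zero_mul]
  · intro T _ hT
    have hT' : treeValue w T = 0 := if_neg fun h =>
      hT (Finset.mem_filter.2 ⟨Finset.mem_univ T, L.unmarked_eq_empty_iff.1 h⟩)
    simp [hT']

/-- The value of `∂ w` at `T'` collects the plus states of the resolutions `T' \ {c}`. Their
coefficients are inverse areas times tree values, which is the coefficient `1/[B] + 1/[W]` after
summing over both orders. -/
theorem restrictTree_twistedDiff (hw : w ∈ L.twistedReducedPart s) :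
    L.restrictTree (L.twistedDiff L.faceField w) = L.treeDiff (L.restrictTree w) := by
  funext T'
  rw [treeDiff_restrictTree]
  refine (L.twistedDiff_apply_tree L.faceField T'.2 w).trans (Finset.sum_congr rfl fun c hc => ?_)
  -- In all other degrees both sides vanish because `w` is homogeneous.
  by_cases hs : T'.1.card - L.nPos = s + 2
  · have := Finset.card_erase_add_one hc
    exact reduced_apply_two_circles hw (L.card_circles_erase T'.2 hc) (by omega)
  · have h1 : ∀ x, w x ≠ 0 → L.deltaDeg x = s := fun x hx => by_contra fun h => hx (hw.1 x h)
    have hcard := L.card_circles_erase T'.2 hc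
    have hU := L.card_unmarked (T'.1.erase c)
    have hc1 := Finset.card_erase_add_one hc
    rw [Finset.sum_eq_zero, mul_zero]
    · by_contra h
      have h2 := h1 _ h
      rw [deltaDeg_eq] at h2
      omega
    · intro c' hc'
      have hc2 := Finset.card_erase_add_one hc'
      rw [treeValue]
      split_ifs with hT
      · by_contra h
        have h2 := h1 _ h
        rw [L.deltaDeg_treeState hT] at h2
        omega
      · rfl

end LinkDiagram
end

/-! ### The assertions for link diagrams -/

noncomputable section

open scoped Classical

namespace LinkDiagram

variable {X O F : Type u} [Fintype X] [Fintype O] [Fintype F] (L : LinkDiagram X O F)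

/-- A basis vector lifts to a reduced element, and restriction turns the twisted differential into
the tree differential; so the identity is inherited from `∂² = 0`. -/
theorem treeDiff_comp_self : L.treeDiff ∘ₗ L.treeDiff = 0 := by
  refine LinearMap.pi_ext' fun T => LinearMap.ext_ring ?_
  have hT : (Pi.single T 1 : L.TreeState → L.faceField) ∈ L.treePart (T.1.card - L.nPos) :=
    single_mem_spanOn (P := fun T' : L.TreeState => (T'.1.card : ℤ) - L.nPos = T.1.card - L.nPos)
      rfl 1
  obtain ⟨w, hw, hwT⟩ := exists_restrictTree_eq hT
  change L.treeDiff (L.treeDiff (Pi.single T 1)) = 0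
  rw [← hwT, ← restrictTree_twistedDiff hw, ← restrictTree_twistedDiff (IsTriangular.map_mem_reducedPart
    L.deltaDeg_of_twistedDiff_ne_zero (L.twistedDiff_comp_self L.faceField) hw)]
  have : L.twistedDiff L.faceField (L.twistedDiff L.faceField w) = 0 :=
    LinearMap.congr_fun (L.twistedDiff_comp_self L.faceField) w
  rw [this, map_zero]

theorem nonempty_twistedHomology_equiv (s : ℤ) :
    Nonempty (L.twistedHomology L.faceField s ≃ₗ[L.faceField] L.HT s) :=
  L.isTriangular.nonempty_pieceHomology_equiv L.deltaDeg_of_twistedDiff_ne_zero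
    (L.twistedDiff_comp_self L.faceField) L.not_isMinus_of_isPlus L.treeDiff L.treePart
    L.restrictTree (fun _ _ hw => restrictTree_mem hw)
    (fun _ _ hw => restrictTree_twistedDiff hw) (fun _ _ ht => exists_restrictTree_eq ht)
    (fun _ _ hw h0 => eq_zero_of_restrictTree_eq_zero hw fun T hT =>
      congrFun h0 ⟨T, L.unmarked_eq_empty_iff.1 hT⟩) s

theorem finrank_HT_le (s : ℤ) : Module.finrank L.faceField (L.HT s) ≤
    Module.finrank L.faceField (L.deltaKH L.faceField s) := by
  obtain ⟨e⟩ := L.nonempty_twistedHomology_equiv s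
  rw [← e.finrank_eq]
  exact (L.isPerturbation L.faceField).finrank_pieceHomology_le s

theorem isFilteredComplex :
    IsFilteredComplex (L.twistedDiff L.faceField) (L.qFiltration L.faceField) :=
  (L.isPerturbation L.faceField).isFilteredComplex

theorem twistedDiff_map_qFiltration_le (p s : ℤ) :
    (L.qFiltration L.faceField p s).map (L.twistedDiff L.faceField) ≤
      L.qFiltration L.faceField p (s + 2) := by
  rintro _ ⟨x, hx, rfl⟩
  exact L.isFilteredComplex.map_mem p s x hx

theorem exists_qFiltration_bounds : ∃ a b : ℤ,
    (∀ p ≤ a, ∀ s, L.qFiltration L.faceField p s = ⊥) ∧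
      ∀ p ≥ b, ∀ s, L.qFiltration L.faceField p s = L.deltaPart L.faceField s :=
  exists_filteredPart_bounds L.qDeg L.deltaDeg

theorem subsingleton_page_one
    (E : InducedSpectralSequence (L.twistedDiff L.faceField) (L.qFiltration L.faceField))
    {q s : ℤ} (hqs : Odd (q + s)) : Subsingleton ((E.ss.page 1 zero_le_one).X (q, s)) := by
  obtain ⟨e⟩ := (L.isPerturbation L.faceField).nonempty_page_one_equiv E q s
  refine e.toEquiv.subsingleton_congr.2 ⟨fun x y => ?_⟩
  obtain ⟨x, rfl⟩ := Submodule.mkQ_surjective _ x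
  obtain ⟨y, rfl⟩ := Submodule.mkQ_surjective _ y
  have h0 : ∀ z : ↥(LinearMap.ker (L.khovanovDiff L.faceField) ⊓
      gradedPart L.faceField L.qDeg L.deltaDeg q s), z = 0 := fun z =>
    Subtype.ext ((L.gradedPart_eq_bot L.faceField hqs).le z.2.2)
  rw [h0 x, h0 y]

theorem nonempty_directSum_page_one_equiv
    (E : InducedSpectralSequence (L.twistedDiff L.faceField) (L.qFiltration L.faceField)) (s : ℤ) :
    Nonempty ((DirectSum ℤ fun q => (E.ss.page 1 zero_le_one).X (q, s)) ≃ₗ[L.faceField]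
      L.deltaKH L.faceField s) := by
  obtain ⟨e⟩ := (L.isPerturbation L.faceField).nonempty_directSum_equiv s
  exact ⟨(DFinsupp.mapRange.linearEquiv fun q =>
    ((L.isPerturbation L.faceField).nonempty_page_one_equiv E q s).some).trans e⟩

theorem nonempty_page_one_equiv
    (E : InducedSpectralSequence (L.twistedDiff L.faceField) (L.qFiltration L.faceField))
    (h q : ℤ) : Nonempty ((E.ss.page 1 zero_le_one).X (q, 2 * h - q) ≃ₗ[L.faceField]
      TensorProduct (ZMod 2) L.faceField (L.KH (ZMod 2) h q)) := by
  obtain ⟨e⟩ := (L.isPerturbation L.faceField).nonempty_page_one_equiv E q (2 * h - q)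
  obtain ⟨e'⟩ := L.nonempty_KH_equiv h q
  exact ⟨e.trans e'⟩

/-- The spectral sequence converges in finitely many steps. -/
theorem exists_page_equiv
    (E : InducedSpectralSequence (L.twistedDiff L.faceField) (L.qFiltration L.faceField)) :
    ∃ r₀ : ℤ, ∀ (r : ℤ) (hr : 0 ≤ r), r₀ ≤ r →
      (∀ i j, (E.ss.page r hr).d i j = 0) ∧
      ∀ p s : ℤ, ∃ ψ : (↥(L.twistedHomologyFil L.faceField p s) ⧸
          (L.twistedHomologyFil L.faceField (p - 1) s).submoduleOf
            (L.twistedHomologyFil L.faceField p s)) ≃ₗ[L.faceField]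
          (E.ss.page r hr).X (p, s),
        ∀ (z : ↥(LinearMap.ker (L.twistedDiff L.faceField) ⊓ L.deltaPart L.faceField s))
          (x : specZ (L.twistedDiff L.faceField) (L.qFiltration L.faceField) r p s)
          (y : L.twistedHomologyFil L.faceField p s),
          (z : L.PureState → L.faceField) = x →
            (y : L.twistedHomology L.faceField s) = Submodule.Quotient.mk z →
              ψ (Submodule.Quotient.mk y) = E.cls r hr p s x := by
  have hC := L.isFilteredComplex
  have ⟨a, b, h⟩ := L.exists_qFiltration_bounds
  exact ⟨b - a + 1, fun r hr hab => ⟨hC.page_d_eq_zero E h.1 h.2 hr (by omega), fun p s =>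
    hC.exists_page_equiv (D := L.deltaPart L.faceField) E h.1 h.2 hr hab p s⟩⟩

theorem exists_twistedHomologyFil_bounds : ∃ a b : ℤ, ∀ s : ℤ,
    (∀ p ≤ a, L.twistedHomologyFil L.faceField p s = ⊥) ∧
      ∀ p ≥ b, L.twistedHomologyFil L.faceField p s = ⊤ := by
  have ⟨a, b, h⟩ := L.exists_qFiltration_bounds
  refine ⟨a, b, fun s => ⟨fun p hp => ?_, fun p hp => ?_⟩⟩
  · rw [twistedHomologyFil, h.1 p hp]
    exact IsFilteredComplex.homologyFiltration_bot _ _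
  · rw [twistedHomologyFil, h.2 p hp]
    exact IsFilteredComplex.homologyFiltration_self _ _

/-- The associated graded page is the reduced Khovanov complex. -/
theorem exists_page_zero_equiv
    (E : InducedSpectralSequence (L.twistedDiff L.faceField) (L.qFiltration L.faceField)) :
    ∃ gr : ∀ p h : ℤ,
        L.bigradedPart L.faceField h p ≃ₗ[L.faceField] (E.ss.page 0 le_rfl).X (p, 2 * h - p),
      (∀ p h (x : L.bigradedPart L.faceField h p)
          (z : specZ (L.twistedDiff L.faceField) (L.qFiltration L.faceField) 0 p (2 * h - p)),
        (x : L.PureState → L.faceField) = z → gr p h x = E.cls 0 le_rfl p (2 * h - p) z) ∧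
      (∀ p h (x : L.bigradedPart L.faceField h p) (y : L.bigradedPart L.faceField (h + 1) p),
        (y : L.PureState → L.faceField) = L.khovanovDiff L.faceField x →
          ((E.ss.page 0 le_rfl).d (p, 2 * h - p) (p, 2 * (h + 1) - p)).hom (gr p h x) =
            gr p (h + 1) y) := by
  have hP := L.isPerturbation L.faceField
  choose e he using hP.exists_gradedPart_equiv E
  refine ⟨fun p h => LinearEquiv.ofEq _ _ (L.bigradedPart_eq L.faceField h p) ≪≫ₗ
    e p (2 * h - p), fun p h x z hxz => he _ _ _ z hxz, fun p h x y hxy => ?_⟩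
  exact hP.d_gradedPart_equiv E (by ring) (e p (2 * h - p)) (e p (2 * (h + 1) - p)) (he _ _)
    (he _ _) _ _ hxy

end LinkDiagram

end
theorem mainTheorem8 {X O F : Type u} [Fintype X] [Fintype O] [Fintype F]
    (L : LinkDiagram X O F) :
    -- the differentials square to zero
    (L.khovanovDiff (ZMod 2) ∘ₗ L.khovanovDiff (ZMod 2) = 0 ∧
      L.khovanovDiff L.faceField ∘ₗ L.khovanovDiff L.faceField = 0 ∧
      L.twistedDiff L.faceField ∘ₗ L.twistedDiff L.faceField = 0 ∧
      L.treeDiff ∘ₗ L.treeDiff = 0) ∧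
    -- the twisted differential raises the `δ`-grading by 2 and preserves the `q`-filtration
    (∀ p s, (L.qFiltration L.faceField p s).map (L.twistedDiff L.faceField) ≤
      L.qFiltration L.faceField p (s + 2)) ∧
    -- the spectral sequence induced by the `q`-filtration
    (∃ E : InducedSpectralSequence (L.twistedDiff L.faceField) (L.qFiltration L.faceField),
      -- the associated graded page is the reduced Khovanov complex over the field of fractions
      (∃ gr : ∀ p h : ℤ,
          L.bigradedPart L.faceField h p ≃ₗ[L.faceField] (E.ss.page 0 le_rfl).X (p, 2 * h - p),
        (∀ p h (x : L.bigradedPart L.faceField h p)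
            (z : specZ (L.twistedDiff L.faceField) (L.qFiltration L.faceField) 0 p (2 * h - p)),
          (x : L.PureState → L.faceField) = z → gr p h x = E.cls 0 le_rfl p (2 * h - p) z) ∧
        (∀ p h (x : L.bigradedPart L.faceField h p) (y : L.bigradedPart L.faceField (h + 1) p),
          (y : L.PureState → L.faceField) = L.khovanovDiff L.faceField x →
            ((E.ss.page 0 le_rfl).d (p, 2 * h - p) (p, 2 * (h + 1) - p)).hom (gr p h x) =
              gr p (h + 1) y)) ∧
      -- its homology is reduced characteristic 2 Khovanov homology over the field of fractions,
      -- both with its bigrading and with its `δ`-grading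
      (∀ h q : ℤ, Nonempty ((E.ss.page 1 zero_le_one).X (q, 2 * h - q) ≃ₗ[L.faceField]
        TensorProduct (ZMod 2) L.faceField (L.KH (ZMod 2) h q))) ∧
      (∀ q s : ℤ, Odd (q + s) → Subsingleton ((E.ss.page 1 zero_le_one).X (q, s))) ∧
      (∀ s : ℤ, Nonempty ((DirectSum ℤ fun q => (E.ss.page 1 zero_le_one).X (q, s)) ≃ₗ[L.faceField]
        L.deltaKH L.faceField s)) ∧
      -- after finitely many steps the pages are the associated graded of the homology
      (∃ r₀ : ℤ, ∀ (r : ℤ) (hr : 0 ≤ r), r₀ ≤ r →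
        (∀ i j, (E.ss.page r hr).d i j = 0) ∧
        ∀ p s : ℤ, ∃ ψ : (↥(L.twistedHomologyFil L.faceField p s) ⧸
            (L.twistedHomologyFil L.faceField (p - 1) s).submoduleOf
              (L.twistedHomologyFil L.faceField p s)) ≃ₗ[L.faceField]
            (E.ss.page r hr).X (p, s),
          ∀ (z : ↥(LinearMap.ker (L.twistedDiff L.faceField) ⊓ L.deltaPart L.faceField s))
            (x : specZ (L.twistedDiff L.faceField) (L.qFiltration L.faceField) r p s)
            (y : L.twistedHomologyFil L.faceField p s),
            (z : L.PureState → L.faceField) = x →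
            (y : L.twistedHomology L.faceField s) = Submodule.Quotient.mk z →
              ψ (Submodule.Quotient.mk y) = E.cls r hr p s x)) ∧
    -- the filtration of the homology is finite, and the homology is the spanning tree homology
    (∃ a b : ℤ, ∀ s : ℤ,
      (∀ p ≤ a, L.twistedHomologyFil L.faceField p s = ⊥) ∧
      (∀ p ≥ b, L.twistedHomologyFil L.faceField p s = ⊤)) ∧
    (∀ s : ℤ, Nonempty (L.twistedHomology L.faceField s ≃ₗ[L.faceField] L.HT s)) ∧
    -- the rank inequality
    (∀ s : ℤ, Module.finrank L.faceField (L.HT s) ≤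
      Module.finrank L.faceField (L.deltaKH L.faceField s)) := by
  -- The statements about pages hold for every spectral sequence with these class maps, so the
  -- construction of `E` may be forgotten.
  have E := L.isFilteredComplex.inducedSpectralSequence
  exact ⟨⟨L.khovanovDiff_comp_self _, L.khovanovDiff_comp_self _, L.twistedDiff_comp_self _,
    L.treeDiff_comp_self⟩, L.twistedDiff_map_qFiltration_le, ⟨E, L.exists_page_zero_equiv E,
    L.nonempty_page_one_equiv E, fun q s hqs => L.subsingleton_page_one E hqs,
    L.nonempty_directSum_page_one_equiv E, L.exists_page_equiv E⟩,
    L.exists_twistedHomologyFil_bounds, L.nonempty_twistedHomology_equiv, L.finrank_HT_le⟩
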